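/- Let $V=\mathbb C^N$, and for an operator $X$ on $V^{\otimes 2}$ let $X_i$ be $X$ acting in the factors $i,i+1$ of a tensor power of $V$. A \emph{Yang--Baxter matrix} is $X\in\mathrm{Aut}(V^{\otimes2})$ with $X_1X_2X_1=X_2X_1X_2$. It is \emph{skew invertible} if there is $\Psi_X\in\mathrm{End}(V^{\otimes 2})$ with $\mathrm{Tr}_{(2)}X_1(\Psi_X)_2=\mathrm{Tr}_{(2)}(\Psi_X)_1X_2=P$, the flip of $V\otimes V$, and \emph{strict skew invertible} if $X$ and $X^{-1}$ are skew invertible. Put $D_X:=\mathrm{Tr}_{(2)}\Psi_X\in\mathrm{End}(V)$, the trace being over the second factor. \textbf{BMW algebra.} Let $q\in\mathbb C\setminus\{0,\pm1\}$, $\mu\in\mathbb C\setminus\{0,q,-q^{-1}\}$, $\eta=\frac{(q-\mu)(q^{-1}+\mu)}{\mu(q-q^{-1})}$, $i_q=\frac{q^i-q^{-i}}{q-q^{-1}}$. The algebra $\mathcal W_n(q,\mu)$ is generated by invertible $\sigma_1,\dots,\sigma_{n-1}$ subject to the braid relations $\sigma_i\sigma_{i+1}\sigma_i=\sigma_{i+1}\sigma_i\sigma_{i+1}$,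 $\sigma_i\sigma_j=\sigma_j\sigma_i$ for $|i-j|>1$, and, with $\kappa_i=\frac{(q-\sigma_i)(q^{-1}+\sigma_i)}{\mu(q-q^{-1})}$, to $\sigma_i\kappa_i=\kappa_i\sigma_i=\mu\kappa_i$, $\kappa_i\sigma_{i\pm1}^{\epsilon}=\kappa_i\kappa_{i\pm1}\sigma_i^{-\epsilon}$ and $\sigma_{i\pm1}^{\epsilon}\kappa_i=\sigma_i^{-\epsilon}\kappa_{i\pm1}\kappa_i$ ($\epsilon=\pm1$), $\kappa_i\kappa_{i\pm1}\kappa_i=\kappa_i$, $\kappa_i^2=\eta\kappa_i$. Put $\sigma_i^-(x)=1+\frac{x-1}{q-q^{-1}}\sigma_i+\frac{\mu(x-1)}{\mu+qx}\kappa_i$, $a^{(1)}=1$, $a^{(i+1)}=\frac{q^i}{(i+1)_q}a^{(i)}\sigma_i^-(q^{-2i})a^{(i)}$; $a^{(i)\uparrow1}$ denotes $a^{(i)}$ with every $\sigma_j$ replaced by $\sigma_{j+1}$. An operator $R\in\mathrm{Aut}(V^{\otimes2})$ is of \emph{BMW type} if, for all $n$, $\sigma_i\mapsto R_i$ extends to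 a homomorphism $\rho_R:\mathcal W_n(q,\mu)\to\mathrm{End}(V^{\otimes n})$. \textbf{Type $O(k)$.} Let $k\ge2$. A skew invertible BMW type $R$ is of \emph{type $O(k)$} if $\mu=q^{1-k}$; $q^{2i}\ne1$ and $\mu\neq-q^{1-2i}$ for $i=1,\dots,k$; $\rho_R(a^{(i)})\ne0$ for $i=2,\dots,k$; $\rho_R\bigl(a^{(k)\uparrow1}\sigma_1^-(q^{-2k})a^{(k)\uparrow1}\bigr)=0$; and $\mathrm{rk}\,\rho_R(a^{(k)})=1$. \textbf{Algebras.} Let $\{R,F\}$ be a compatible pair of strict skew invertible Yang--Baxter matrices: $R_1F_2F_1=F_2F_1R_2$ and $R_2F_1F_2=F_1F_2R_1$. The quantum matrix algebra $\mathcal M(R,F)$ is the unital associative $\mathbb C$-algebra generated by the entries $M^a_b$ of an $N\times N$ matrix $M$ subject to $R_1M_{\overline1}M_{\overline2}=M_{\overline1}M_{\overline2}R_1$, where $M_{\overline1}=M_1$, $M_{\overline{i+1}}=F_iM_{\overline i}F_i^{-1}$. Its contraction is $g=\mu^2\,\mathrm{Tr}_{(1,2)}\bigl(M_{\overline1}M_{\overline2}\,\eta^{-1}\rho_R(\kappa_1)\bigr)$,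 and its elementary sums are $e_i=\mathrm{Tr}_{(1,\dots,i)}\bigl(D_R^{\otimes i}M_{\overline1}\cdots M_{\overline i}\,\rho_R(a^{(i)})\bigr)$, $i\ge 1$. Let $\mathcal M^\bullet(R,F)$ be the algebra obtained from $\mathcal M(R,F)$ by adjoining an inverse $g^{-1}$ of $g$; if $R$ is of type $O(k)$ it is denoted $O_k(R,F)$. The representations $\alpha_\pm$ of $\mathcal M(R,F)$ on $V=V_0$ are given by $\alpha_\pm(M_1)=R_{01}^{\pm1}F_{01}\in\mathrm{End}(V_0\otimes V_1)$. \textbf{Proposition.} Let $\ell\ge1$ and let $\{R,F\}$ be a compatible pair of strict skew invertible Yang--Baxter matrices with $R$ of type $O(2\ell)$. If at least one of the matrices $\alpha_+(e_\ell)$, $\alpha_-(e_\ell)$ is non-degenerate, then the element $g^{-\ell}e_{2\ell}$ is central in $O_{2\ell}(R,F)$. -/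

import Mathlib

/-! Throughout, `V = ℂ^N`; an operator on `V ⊗ V` is a matrix indexed by `Fin N × Fin N`, an
operator on the `n`-th tensor power of `V` is a matrix indexed by multi-indices `Fin n → Fin N`.
Tensor factors and braid generators are numbered from `0`: the `i`-th braid generator acts in the
factors `i` and `i + 1`. -/

namespace QMA

/-- Operators on `V ⊗ V`. -/
abbrev Op2 (N : ℕ) : Type := Matrix (Fin N × Fin N) (Fin N × Fin N) ℂ

/-- Operators on the `n`-th tensor power of `V`, with coefficients in `A`. -/
abbrev Op (N n : ℕ) (A : Type) : Type := Matrix (Fin n → Fin N) (Fin n → Fin N) A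

section Sites

variable {N : ℕ}

/-- The operator `X` acting in the `i`-th tensor factor (`i < n`), the identity in the others. -/
def site1 {A : Type} [Zero A] (X : Matrix (Fin N) (Fin N) A) (n i : ℕ) : Op N n A :=
  Matrix.of fun s t =>
    if h : i < n then
      if ∀ j : Fin n, j.val ≠ i → s j = t j then X (s ⟨i, h⟩) (t ⟨i, h⟩) else 0
    else 0

/-- The operator `X` acting in the tensor factors `i` and `i + 1` (`i + 1 < n`), the identity in
the others. -/
def site2 (X : Op2 N) (n i : ℕ) : Op N n ℂ :=
  Matrix.of fun s t =>
    if h : i + 1 < n then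
      if ∀ j : Fin n, j.val ≠ i → j.val ≠ i + 1 → s j = t j then
        X (s ⟨i, by omega⟩, s ⟨i + 1, h⟩) (t ⟨i, by omega⟩, t ⟨i + 1, h⟩)
      else 0
    else 0

/-- `Z ⊗ ⋯ ⊗ Z` (`n` factors). -/
def tensorPow (Z : Matrix (Fin N) (Fin N) ℂ) (n : ℕ) : Op N n ℂ :=
  Matrix.of fun s t => ∏ j : Fin n, Z (s j) (t j)

/-- A numeric operator viewed as an operator with coefficients in the `ℂ`-algebra `A`. -/
def num (A : Type) [Ring A] [Algebra ℂ A] {n : ℕ} (X : Op N n ℂ) : Op N n A :=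
  X.map (algebraMap ℂ A)

/-- The permutation operator `u ⊗ v ↦ v ⊗ u`. -/
def perm (N : ℕ) : Op2 N :=
  Matrix.of fun x y => if x.1 = y.2 ∧ x.2 = y.1 then 1 else 0

/-- Trace over the middle factor of `V ⊗ V ⊗ V`. -/
def traceMiddle (X : Op N 3 ℂ) : Op2 N :=
  Matrix.of fun x y => ∑ b : Fin N, X ![x.1, b, x.2] ![y.1, b, y.2]

end Sites

section YangBaxter

variable {N : ℕ}

/-- `R` is a Yang–Baxter matrix: invertible, and satisfying the braid relation. -/
structure IsYangBaxter (R : Op2 N) : Prop where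
  isUnit : IsUnit R
  braid : site2 R 3 0 * site2 R 3 1 * site2 R 3 0 = site2 R 3 1 * site2 R 3 0 * site2 R 3 1

/-- `Ψ` is the skew inverse of `R` (it is unique if it exists). -/
def IsSkewInverse (R Ψ : Op2 N) : Prop :=
  traceMiddle (site2 R 3 0 * site2 Ψ 3 1) = perm N ∧
    traceMiddle (site2 Ψ 3 0 * site2 R 3 1) = perm N

def SkewInvertible (R : Op2 N) : Prop := ∃ Ψ, IsSkewInverse R Ψ

def StrictSkewInvertible (R : Op2 N) : Prop := SkewInvertible R ∧ SkewInvertible R⁻¹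

open Classical in
/-- The skew inverse of a skew invertible operator (`0` if `R` is not skew invertible). -/
noncomputable def skewInverse (R : Op2 N) : Op2 N :=
  if h : SkewInvertible R then h.choose else 0

/-- The matrix `D_R`: the trace of the skew inverse of `R` over the second factor. -/
noncomputable def matD (R : Op2 N) : Matrix (Fin N) (Fin N) ℂ :=
  Matrix.of fun a c => ∑ b : Fin N, skewInverse R (a, b) (c, b)

/-- `{R, F}` is a compatible pair of Yang–Baxter matrices. -/
structure IsCompatiblePair (R F : Op2 N) : Prop where
  left : IsYangBaxter R
  right : IsYangBaxter F
  twist₁ : site2 R 3 0 * site2 F 3 1 * site2 F 3 0 = site2 F 3 1 * site2 F 3 0 * site2 R 3 1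
  twist₂ : site2 R 3 1 * site2 F 3 0 * site2 F 3 1 = site2 F 3 0 * site2 F 3 1 * site2 R 3 0

end YangBaxter

section BMW

/-- The `q`-number `i_q`. -/
noncomputable def qNum (q : ℂ) (i : ℕ) : ℂ := (q ^ i - (q ^ i)⁻¹) / (q - q⁻¹)

noncomputable def eta (q μ : ℂ) : ℂ := (q - μ) * (q⁻¹ + μ) / (μ * (q - q⁻¹))

variable {A : Type} [Ring A] [Algebra ℂ A]

/-- The element `κ` attached to a braid generator `x = σ`. -/
noncomputable def kappa (q μ : ℂ) (x : A) : A :=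
  (μ * (q - q⁻¹))⁻¹ • ((algebraMap ℂ A q - x) * (algebraMap ℂ A q⁻¹ + x))

/-- The elements `σ 0, …, σ (m - 1)` of `A`, with inverses `σ' 0, …, σ' (m - 1)`, satisfy the
defining relations of the Birman–Murakami–Wenzl algebra on `m + 1` strands with parameters
`q`, `μ`; in other words, they are the images of its generators under an algebra homomorphism
to `A`. -/
structure IsBMWRepresentation (q μ : ℂ) (m : ℕ) (σ σ' : ℕ → A) : Prop where
  mul_inv : ∀ i < m, σ i * σ' i = 1
  inv_mul : ∀ i < m, σ' i * σ i = 1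
  braid : ∀ i, i + 1 < m → σ i * σ (i + 1) * σ i = σ (i + 1) * σ i * σ (i + 1)
  far : ∀ i < m, ∀ j < m, i + 1 < j → σ i * σ j = σ j * σ i
  sigma_kappa : ∀ i < m, σ i * kappa q μ (σ i) = μ • kappa q μ (σ i)
  kappa_sigma : ∀ i < m, kappa q μ (σ i) * σ i = μ • kappa q μ (σ i)
  kappa_mul_sigma : ∀ i < m, ∀ j < m, (j = i + 1 ∨ i = j + 1) →
    kappa q μ (σ i) * σ j = kappa q μ (σ i) * kappa q μ (σ j) * σ' i
  kappa_mul_inv : ∀ i < m, ∀ j < m, (j = i + 1 ∨ i = j + 1) →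
    kappa q μ (σ i) * σ' j = kappa q μ (σ i) * kappa q μ (σ j) * σ i
  sigma_mul_kappa : ∀ i < m, ∀ j < m, (j = i + 1 ∨ i = j + 1) →
    σ j * kappa q μ (σ i) = σ' i * kappa q μ (σ j) * kappa q μ (σ i)
  inv_mul_kappa : ∀ i < m, ∀ j < m, (j = i + 1 ∨ i = j + 1) →
    σ' j * kappa q μ (σ i) = σ i * kappa q μ (σ j) * kappa q μ (σ i)
  kappa_kappa_kappa : ∀ i < m, ∀ j < m, (j = i + 1 ∨ i = j + 1) →
    kappa q μ (σ i) * kappa q μ (σ j) * kappa q μ (σ i) = kappa q μ (σ i)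
  kappa_sq : ∀ i < m, kappa q μ (σ i) * kappa q μ (σ i) = eta q μ • kappa q μ (σ i)

/-- The baxterized element `σ⁻(z)` attached to a braid generator `x = σ`. -/
noncomputable def baxMinus (q μ : ℂ) (x : A) (z : ℂ) : A :=
  1 + ((z - 1) / (q - q⁻¹)) • x + (μ * (z - 1) / (μ + q * z)) • kappa q μ x

/-- The `q`-antisymmetrizer `a^(i)` built from the braid generators `σ 0, …, σ (i - 2)`. -/
noncomputable def antisym (q μ : ℂ) (σ : ℕ → A) : ℕ → A
  | 0 => 1
  | 1 => 1
  | i + 2 => (q ^ (i + 1) / qNum q (i + 2)) •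
      (antisym q μ σ (i + 1) * baxMinus q μ (σ i) (q ^ (2 * (i + 1)))⁻¹ * antisym q μ σ (i + 1))

end BMW

section Orthogonal

variable {N : ℕ}

/-- The image of `a^(i)` on the `n`-th tensor power, shifted by `p` factors. -/
noncomputable def antisymOp (q μ : ℂ) (R : Op2 N) (n p i : ℕ) : Op N n ℂ :=
  antisym q μ (fun j => site2 R n (j + p)) i

/-- `R` is a Yang–Baxter matrix of BMW type with parameters `q`, `μ`. -/
structure IsBMWType (q μ : ℂ) (R : Op2 N) : Prop where
  isUnit : IsUnit R
  q_ne : q ≠ 0 ∧ q ≠ 1 ∧ q ≠ -1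
  μ_ne : μ ≠ 0 ∧ μ ≠ q ∧ μ ≠ -q⁻¹
  rep : ∀ m : ℕ, IsBMWRepresentation q μ m
    (fun i => site2 R (m + 1) i) (fun i => site2 R⁻¹ (m + 1) i)

/-- `R` is a (skew invertible, BMW type) Yang–Baxter matrix of height `k`. -/
structure HasHeight (k : ℕ) (q μ : ℂ) (R : Op2 N) : Prop where
  two_le : 2 ≤ k
  bmw : IsBMWType q μ R
  skew : SkewInvertible R
  q_pow_ne : ∀ i : ℕ, 1 ≤ i → i ≤ k → q ^ (2 * i) ≠ 1
  μ_ne : ∀ i : ℕ, 1 ≤ i → i ≤ k → μ ≠ -q ^ (1 - 2 * (i : ℤ))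
  rank_ne : ∀ i : ℕ, 2 ≤ i → i ≤ k → (antisymOp q μ R i 0 i).rank ≠ 0
  vanish : antisymOp q μ R (k + 1) 1 k *
    baxMinus q μ (site2 R (k + 1) 0) (q ^ (2 * k))⁻¹ * antisymOp q μ R (k + 1) 1 k = 0

/-- `R` is an orthogonal Yang–Baxter matrix of type `O(k)` (with parameters `q` and `μ`). -/
structure IsOrthogonal (k : ℕ) (q μ : ℂ) (R : Op2 N) : Prop where
  height : HasHeight k q μ R
  μ_eq : μ = q ^ (1 - (k : ℤ))
  rank_one : (antisymOp q μ R k 0 k).rank = 1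

end Orthogonal

section Matrices

/-! Constructions with an `N × N` matrix `M` over a `ℂ`-algebra `A`. -/

variable {N : ℕ} {A : Type} [Ring A] [Algebra ℂ A]

/-- The matrix copy of `M` number `i`, acting on the `n`-th tensor power. -/
noncomputable def copy (F : Op2 N) (M : Matrix (Fin N) (Fin N) A) (n : ℕ) : ℕ → Op N n A
  | 0 => site1 M n 0
  | i + 1 => num A (site2 F n i) * copy F M n i * num A (site2 F⁻¹ n i)

/-- The product of the first `n` matrix copies of `M` on the `n`-th tensor power. -/
noncomputable def string (F : Op2 N) (M : Matrix (Fin N) (Fin N) A) (n : ℕ) : Op N n A :=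
  ((List.range n).map (copy F M n)).prod

/-- The contraction of `M`:
`g = μ² Tr₍₁₂₎ (M₁ M₂ c⁽²⁾)`, where `c⁽²⁾ = η⁻¹ κ₁`. -/
noncomputable def contraction (R F : Op2 N) (q μ : ℂ) (M : Matrix (Fin N) (Fin N) A) : A :=
  μ ^ 2 • (string F M 2 * num A ((eta q μ)⁻¹ • kappa q μ (site2 R 2 0))).trace

/-- `ch(T) = Tr_R (M₁ ⋯ Mₙ T)`, with the R-trace taken over all `n` factors. -/
noncomputable def ch (R F : Op2 N) (M : Matrix (Fin N) (Fin N) A) {n : ℕ} (T : Op N n ℂ) : A :=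
  (num A (tensorPow (matD R) n) * (string F M n * num A T)).trace

/-- The elementary sum `e_i = ch(a^(i))` of `M`. -/
noncomputable def elementary (R F : Op2 N) (q μ : ℂ) (i : ℕ) (M : Matrix (Fin N) (Fin N) A) : A :=
  ch R F M (antisymOp q μ R i 0 i)

/-- The left hand side of the relation `R₁ M₁ M₂ = M₁ M₂ R₁` between the entries of `M`. -/
noncomputable def qmLeft (R F : Op2 N) (M : Matrix (Fin N) (Fin N) A) : Op N 2 A :=
  num A (site2 R 2 0) * (copy F M 2 0 * copy F M 2 1)

/-- The right hand side of the relation `R₁ M₁ M₂ = M₁ M₂ R₁` between the entries of `M`. -/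
noncomputable def qmRight (R F : Op2 N) (M : Matrix (Fin N) (Fin N) A) : Op N 2 A :=
  (copy F M 2 0 * copy F M 2 1) * num A (site2 R 2 0)

end Matrices

section Algebras

variable {N : ℕ}

/-- The matrix of generators of the free algebra. -/
def freeMatrix (N : ℕ) : Matrix (Fin N) (Fin N) (FreeAlgebra ℂ (Fin N × Fin N)) :=
  Matrix.of fun a b => FreeAlgebra.ι ℂ (a, b)

/-- The relations of `M(R, F)`: the entries of `R₁ M₁ M₂ = M₁ M₂ R₁`, where `M₁`, `M₂` are the
first two matrix copies. -/
inductive QMRel (R F : Op2 N) :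
    FreeAlgebra ℂ (Fin N × Fin N) → FreeAlgebra ℂ (Fin N × Fin N) → Prop
  | qm (s t : Fin 2 → Fin N) :
      QMRel R F (qmLeft R F (freeMatrix N) s t) (qmRight R F (freeMatrix N) s t)

/-- The quantum matrix algebra `M(R, F)`. -/
abbrev QMAlgebra (R F : Op2 N) : Type := RingQuot (QMRel R F)

/-- The quantum matrix of `M(R, F)`. -/
noncomputable def quantumMatrix (R F : Op2 N) : Matrix (Fin N) (Fin N) (QMAlgebra R F) :=
  (freeMatrix N).map (RingQuot.mkAlgHom ℂ (QMRel R F))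

/-- The matrix of generators of the free algebra with one more generator. -/
def freeExtMatrix (N : ℕ) :
    Matrix (Fin N) (Fin N) (FreeAlgebra ℂ (Option (Fin N × Fin N))) :=
  Matrix.of fun a b => FreeAlgebra.ι ℂ (some (a, b))

/-- The relations of the extended algebra: those of `M(R, F)`, and those saying that the
additional generator is inverse to the contraction. -/
inductive ExtRel (R F : Op2 N) (q μ : ℂ) :
    FreeAlgebra ℂ (Option (Fin N × Fin N)) → FreeAlgebra ℂ (Option (Fin N × Fin N)) → Prop
  | qm (s t : Fin 2 → Fin N) :
      ExtRel R F q μ (qmLeft R F (freeExtMatrix N) s t) (qmRight R F (freeExtMatrix N) s t)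
  | inv_mul : ExtRel R F q μ
      (FreeAlgebra.ι ℂ none * contraction R F q μ (freeExtMatrix N)) 1
  | mul_inv : ExtRel R F q μ
      (contraction R F q μ (freeExtMatrix N) * FreeAlgebra.ι ℂ none) 1

/-- The extended algebra: the localization of `M(R, F)` at the contraction `g`. -/
abbrev ExtAlgebra (R F : Op2 N) (q μ : ℂ) : Type := RingQuot (ExtRel R F q μ)

/-- The quantum matrix of the extended algebra. -/
noncomputable def extMatrix (R F : Op2 N) (q μ : ℂ) :
    Matrix (Fin N) (Fin N) (ExtAlgebra R F q μ) :=
  (freeExtMatrix N).map (RingQuot.mkAlgHom ℂ (ExtRel R F q μ))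

/-- The inverse `g⁻¹` of the contraction in the extended algebra. -/
noncomputable def contractionInv (R F : Op2 N) (q μ : ℂ) : ExtAlgebra R F q μ :=
  RingQuot.mkAlgHom ℂ (ExtRel R F q μ) (FreeAlgebra.ι ℂ none)

end Algebras

section Facts

/-! Facts needed to see that the representations below are well defined. -/

variable {N : ℕ}

theorem site2_mul (X Y : Op2 N) (n i : ℕ) :
    site2 (X * Y) n i = site2 X n i * site2 Y n i := by
  by_cases h : i + 1 < n
  swap
  · ext s t
    simp [site2, h, Matrix.mul_apply]
  ext s t
  by_cases hst : ∀ j : Fin n, j.val ≠ i → j.val ≠ i + 1 → s j = t j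
  · simp only [site2, h, Matrix.mul_apply, Matrix.of_apply, dif_pos, if_pos hst]
    let u : Fin N × Fin N → (Fin n → Fin N) := fun c j =>
      if j.val = i then c.1 else if j.val = i + 1 then c.2 else s j
    refine Finset.sum_of_injOn u ?_ ?_ ?_ ?_
    · intro c _ d _ hcd
      have h1 := congrFun hcd ⟨i, by omega⟩
      have h2 := congrFun hcd ⟨i + 1, h⟩
      simp [u] at h1 h2
      exact Prod.ext h1 h2
    · intro c _
      simp
    · intro v _ hv
      by_cases hsv : ∀ j : Fin n, j.val ≠ i → j.val ≠ i + 1 → s j = v j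
      · exfalso
        apply hv
        refine ⟨(v ⟨i, by omega⟩, v ⟨i + 1, h⟩), by simp, ?_⟩
        funext j
        by_cases h1 : j.val = i
        · have : j = ⟨i, by omega⟩ := Fin.ext h1
          rw [this]
          simp [u]
        · by_cases h2 : j.val = i + 1
          · have : j = ⟨i + 1, h⟩ := Fin.ext h2
            rw [this]
            simp [u]
          · simp [u, h1, h2, hsv j h1 h2]
      · rw [if_neg hsv, zero_mul]
    · intro c _
      have h1 : ∀ j : Fin n, j.val ≠ i → j.val ≠ i + 1 → s j = u c j := by
        intro j h1 h2
        simp [u, h1, h2]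
      have h2 : ∀ j : Fin n, j.val ≠ i → j.val ≠ i + 1 → u c j = t j := by
        intro j h1 h2
        simp [u, h1, h2, hst j h1 h2]
      rw [if_pos h1, if_pos h2]
      simp [u]
  · simp only [site2, h, Matrix.mul_apply, Matrix.of_apply, dif_pos, if_neg hst]
    symm
    apply Finset.sum_eq_zero
    intro v _
    by_cases hsv : ∀ j : Fin n, j.val ≠ i → j.val ≠ i + 1 → s j = v j
    · by_cases hvt : ∀ j : Fin n, j.val ≠ i → j.val ≠ i + 1 → v j = t j
      · exact absurd (fun j h1 h2 => (hsv j h1 h2).trans (hvt j h1 h2)) hst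
      · rw [if_neg hvt, mul_zero]
    · rw [if_neg hsv, zero_mul]

theorem site2_one (n i : ℕ) (h : i + 1 < n) : site2 (1 : Op2 N) n i = 1 := by
  ext s t
  simp only [site2, h, Matrix.of_apply, dif_pos, Matrix.one_apply]
  by_cases hst : s = t
  · subst hst
    simp
  · rw [if_neg hst]
    by_cases h1 : ∀ j : Fin n, j.val ≠ i → j.val ≠ i + 1 → s j = t j
    · rw [if_pos h1, if_neg]
      intro h2
      apply hst
      funext j
      by_cases h3 : j.val = i
      · have : j = ⟨i, by omega⟩ := Fin.ext h3
        rw [this]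
        exact (Prod.ext_iff.mp h2).1
      · by_cases h4 : j.val = i + 1
        · have : j = ⟨i + 1, h⟩ := Fin.ext h4
          rw [this]
          exact (Prod.ext_iff.mp h2).2
        · exact h1 j h3 h4
    · rw [if_neg h1]

/-- An operator on the `n`-th tensor power with coefficients in `End V`, as an operator on the
`(n + 1)`-st tensor power, the new factor being put first. -/
def unfold {n : ℕ} (X : Op N n (Matrix (Fin N) (Fin N) ℂ)) : Op N (n + 1) ℂ :=
  Matrix.of fun s t => X (Fin.tail s) (Fin.tail t) (s 0) (t 0)

theorem unfold_mul {n : ℕ} (X Y : Op N n (Matrix (Fin N) (Fin N) ℂ)) :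
    unfold (X * Y) = unfold X * unfold Y := by
  ext s t
  simp only [unfold, Matrix.mul_apply, Matrix.of_apply, Matrix.sum_apply]
  rw [← (Fin.consEquiv (fun _ : Fin (n + 1) => Fin N)).sum_comp, Fintype.sum_prod_type,
    Finset.sum_comm]
  simp [Fin.consEquiv]

theorem unfold_injective {n : ℕ} :
    Function.Injective (unfold : Op N n (Matrix (Fin N) (Fin N) ℂ) → _) := by
  intro X Y h
  ext s t c d
  have := congrFun (congrFun h (Fin.cons c s)) (Fin.cons d t)
  simpa [unfold] using this

theorem unfold_num (X : Op2 N) (n i : ℕ) :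
    unfold (num (Matrix (Fin N) (Fin N) ℂ) (site2 X n i)) = site2 X (n + 1) (i + 1) := by
  ext s t
  by_cases h : i + 1 < n
  · have h' : i + 1 + 1 < n + 1 := by omega
    have e : (∀ j : Fin (n + 1), j.val ≠ i + 1 → j.val ≠ i + 1 + 1 → s j = t j) ↔
        s 0 = t 0 ∧ ∀ j : Fin n, j.val ≠ i → j.val ≠ i + 1 → Fin.tail s j = Fin.tail t j := by
      simp [Fin.forall_fin_succ, Fin.tail]
    simp only [unfold, num, site2, Matrix.of_apply, Matrix.map_apply, dif_pos h, dif_pos h',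
      Matrix.algebraMap_matrix_apply]
    by_cases h0 : s 0 = t 0
    · by_cases hc : ∀ j : Fin n, j.val ≠ i → j.val ≠ i + 1 → Fin.tail s j = Fin.tail t j
      · rw [if_pos h0, if_pos hc, if_pos (e.mpr ⟨h0, hc⟩)]
        rfl
      · rw [if_pos h0, if_neg hc, if_neg (fun h => hc (e.mp h).2)]
        rfl
    · rw [if_neg h0, if_neg (fun h => h0 (e.mp h).1)]
  · have h' : ¬ (i + 1 + 1 < n + 1) := by omega
    simp [unfold, num, site2, h]

/-- The matrix over `End V₀` given by the operator `X` on `V₀ ⊗ V₁`. -/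
def blockMatrix (X : Op2 N) : Matrix (Fin N) (Fin N) (Matrix (Fin N) (Fin N) ℂ) :=
  Matrix.of fun a b => Matrix.of fun c d => X (c, a) (d, b)

theorem unfold_site1 (X : Op2 N) :
    unfold (site1 (blockMatrix X) 2 0) = site2 X 3 0 := by
  ext s t
  have e1 : (∀ j : Fin 2, j.val ≠ 0 → Fin.tail s j = Fin.tail t j) ↔ s 2 = t 2 := by
    simp [Fin.forall_fin_succ, Fin.tail]
  have e2 : (∀ j : Fin 3, j.val ≠ 0 → j.val ≠ 0 + 1 → s j = t j) ↔ s 2 = t 2 := by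
    simp [Fin.forall_fin_succ]
  simp only [unfold, site1, site2, Matrix.of_apply, dif_pos (show 0 < 2 by norm_num),
    dif_pos (show 0 + 1 < 2 + 1 by norm_num)]
  by_cases h : s 2 = t 2
  · rw [if_pos (e1.mpr h), if_pos (e2.mpr h)]
    rfl
  · rw [if_neg (mt e1.mp h), if_neg (mt e2.mp h)]
    rfl

theorem qm_blockMatrix {R S F : Op2 N} (hF : IsYangBaxter F)
    (h₁ : site2 R 3 0 * site2 F 3 1 * site2 F 3 0 = site2 F 3 1 * site2 F 3 0 * site2 R 3 1)
    (h₂ : site2 S 3 1 * site2 F 3 0 * site2 F 3 1 = site2 F 3 0 * site2 F 3 1 * site2 S 3 0)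
    (h₃ : site2 R 3 1 * site2 S 3 0 * site2 S 3 1 = site2 S 3 0 * site2 S 3 1 * site2 R 3 0) :
    qmLeft R F (blockMatrix (S * F)) = qmRight R F (blockMatrix (S * F)) := by
  apply unfold_injective
  have hdet : IsUnit F.det := (Matrix.isUnit_iff_isUnit_det F).mp hF.isUnit
  have hff : site2 F 3 1 * site2 F⁻¹ 3 1 = 1 := by
    rw [← site2_mul, Matrix.mul_nonsing_inv F hdet, site2_one 3 1 (by norm_num)]
  have hb := hF.braid
  simp only [qmLeft, qmRight, copy, unfold_mul, unfold_num, unfold_site1, site2_mul]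
  simp only [Nat.reduceAdd] at *
  generalize site2 R 3 0 = r0 at *
  generalize site2 R 3 1 = r1 at *
  generalize site2 S 3 0 = s0 at *
  generalize site2 S 3 1 = s1 at *
  generalize site2 F 3 0 = f0 at *
  generalize site2 F 3 1 = f1 at *
  generalize site2 F⁻¹ 3 1 = f1' at *
  have key : s0 * f0 * (f1 * (s0 * f0) * f1') = s0 * s1 * f1 * f0 := by
    calc s0 * f0 * (f1 * (s0 * f0) * f1') = s0 * (f0 * f1 * s0) * f0 * f1' := by noncomm_ring
      _ = s0 * s1 * (f0 * f1 * f0) * f1' := by rw [← h₂]; noncomm_ring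
      _ = s0 * s1 * f1 * f0 * (f1 * f1') := by rw [hb]; noncomm_ring
      _ = s0 * s1 * f1 * f0 := by rw [hff, mul_one]
  rw [key]
  calc r1 * (s0 * s1 * f1 * f0) = r1 * s0 * s1 * f1 * f0 := by noncomm_ring
    _ = s0 * s1 * (r0 * f1 * f0) := by rw [h₃]; noncomm_ring
    _ = s0 * s1 * f1 * f0 * r1 := by rw [h₁]; noncomm_ring

theorem num_map {A B : Type} [Ring A] [Algebra ℂ A] [Ring B] [Algebra ℂ B] (f : A →ₐ[ℂ] B)
    {n : ℕ} (X : Op N n ℂ) : (num A X).map f = num B X := by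
  ext s t
  simp [num]

theorem site1_map {A B : Type} [Ring A] [Algebra ℂ A] [Ring B] [Algebra ℂ B] (f : A →ₐ[ℂ] B)
    (M : Matrix (Fin N) (Fin N) A) (n i : ℕ) : (site1 M n i).map f = site1 (M.map f) n i := by
  ext s t
  simp only [site1, Matrix.map_apply, Matrix.of_apply]
  split_ifs <;> simp

theorem copy_map {A B : Type} [Ring A] [Algebra ℂ A] [Ring B] [Algebra ℂ B] (f : A →ₐ[ℂ] B)
    (F : Op2 N) (M : Matrix (Fin N) (Fin N) A) (n i : ℕ) :
    (copy F M n i).map f = copy F (M.map f) n i := by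
  induction i with
  | zero => exact site1_map f M n 0
  | succ i ih => simp only [copy, Matrix.map_mul, num_map, ih]

/-- The algebra homomorphism from `M(R, F)` that sends the quantum matrix to `M`. -/
noncomputable def liftQM {R F : Op2 N} {A : Type} [Ring A] [Algebra ℂ A]
    (M : Matrix (Fin N) (Fin N) A) (h : qmLeft R F M = qmRight R F M) :
    QMAlgebra R F →ₐ[ℂ] A :=
  RingQuot.liftAlgHom ℂ ⟨FreeAlgebra.lift ℂ fun ab => M ab.1 ab.2, by
    intro x y hxy
    obtain ⟨s, t⟩ := hxy
    have hM : (freeMatrix N).map (FreeAlgebra.lift ℂ fun ab => M ab.1 ab.2) = M := by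
      ext a b
      simp [freeMatrix]
    have hl : (qmLeft R F (freeMatrix N)).map (FreeAlgebra.lift ℂ fun ab => M ab.1 ab.2)
        = qmLeft R F M := by
      simp only [qmLeft, Matrix.map_mul, num_map, copy_map, hM]
    have hr : (qmRight R F (freeMatrix N)).map (FreeAlgebra.lift ℂ fun ab => M ab.1 ab.2)
        = qmRight R F M := by
      simp only [qmRight, Matrix.map_mul, num_map, copy_map, hM]
    have := congrFun (congrFun (hl.trans (h.trans hr.symm)) s) t
    simpa using this⟩

end Facts

section Representations

variable {N : ℕ} {R F : Op2 N}

/-- The representation `α₊` of `M(R, F)` on `V = V₀`: the quantum matrix goes to `R₀₁ F₀₁`. -/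
noncomputable def alphaPlus (h : IsCompatiblePair R F) :
    QMAlgebra R F →ₐ[ℂ] Matrix (Fin N) (Fin N) ℂ :=
  liftQM (blockMatrix (R * F))
    (qm_blockMatrix h.right h.twist₁ h.twist₂ h.left.braid.symm)

/-- The representation `α₋` of `M(R, F)` on `V = V₀`: the quantum matrix goes to
`R₀₁⁻¹ F₀₁`. -/
noncomputable def alphaMinus (h : IsCompatiblePair R F) :
    QMAlgebra R F →ₐ[ℂ] Matrix (Fin N) (Fin N) ℂ :=
  liftQM (blockMatrix (R⁻¹ * F)) (by
    have hdet : IsUnit R.det := (Matrix.isUnit_iff_isUnit_det R).mp h.left.isUnit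
    have e1 : ∀ i, i + 1 < 3 → site2 R 3 i * site2 R⁻¹ 3 i = 1 := fun i hi => by
      rw [← site2_mul, Matrix.mul_nonsing_inv R hdet, site2_one 3 i hi]
    have e2 : ∀ i, i + 1 < 3 → site2 R⁻¹ 3 i * site2 R 3 i = 1 := fun i hi => by
      rw [← site2_mul, Matrix.nonsing_inv_mul R hdet, site2_one 3 i hi]
    have a0 := e1 0 (by norm_num)
    have a1 := e1 1 (by norm_num)
    have b0 := e2 0 (by norm_num)
    have b1 := e2 1 (by norm_num)
    refine qm_blockMatrix h.right h.twist₁ ?_ ?_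
    · have t := h.twist₂
      generalize site2 R 3 0 = r0 at *
      generalize site2 R 3 1 = r1 at *
      generalize site2 R⁻¹ 3 0 = s0 at *
      generalize site2 R⁻¹ 3 1 = s1 at *
      generalize site2 F 3 0 = f0 at *
      generalize site2 F 3 1 = f1 at *
      calc s1 * f0 * f1 = s1 * (f0 * f1 * (r0 * s0)) := by rw [a0]; noncomm_ring
        _ = s1 * (f0 * f1 * r0) * s0 := by noncomm_ring
        _ = s1 * r1 * (f0 * f1 * s0) := by rw [← t]; noncomm_ring
        _ = f0 * f1 * s0 := by rw [b1, one_mul]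
    · have t := h.left.braid
      generalize site2 R 3 0 = r0 at *
      generalize site2 R 3 1 = r1 at *
      generalize site2 R⁻¹ 3 0 = s0 at *
      generalize site2 R⁻¹ 3 1 = s1 at *
      calc r1 * s0 * s1 = (s0 * (s1 * r1) * r0) * r1 * s0 * s1 := by
            rw [b1, mul_one, b0, one_mul]
        _ = s0 * s1 * (r1 * r0 * r1) * s0 * s1 := by noncomm_ring
        _ = s0 * s1 * r0 * r1 * (r0 * s0) * s1 := by rw [← t]; noncomm_ring
        _ = s0 * s1 * r0 * (r1 * s1) := by rw [a0]; noncomm_ring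
        _ = s0 * s1 * r0 := by rw [a1, mul_one])

end Representations

end QMA

set_option linter.unusedSectionVars false

namespace QMA

/-! ### Consequences of the BMW relations; the Yang–Baxter equation for baxterized generators. -/

section BMWRelations

variable {A : Type} [Ring A] [Algebra ℂ A] {q μ : ℂ} {m : ℕ} {σ σ' : ℕ → A}

/-! Let `w` be a numeric operator on `k` strands, expressed through the braid generators, of rank
one and with nonzero trace. The product of the first `k` copies of `M` commutes with `w`, hence
equals `δ_w w` on `w` for a single element `δ_w` of the algebra (`string_mul_word`). Two such words
matter: `κ`, with coefficient `γ`, where `g = μ²γ`; and `a^(2ℓ)`, with coefficient `Δ`, of which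
`e_{2ℓ}` is a numeric multiple.

Permutation relation (`commute_wordCoeff`). The product of `k + 1` copies is the first copy times
the rest, and also the first `k` copies times the last. Applying `w` to the rest, respectively to
the first `k`, and carrying one situation to the other by a braid in `X = R^{±1}` and `F`, one
relates `M δ_w` to `δ_w M`. The braid operator that appears is exactly the image of the product of
`k` copies under `α_±` (`unfold_string_blockMatrix`), so on `w` it acts as the numeric matrix
`α_±(δ_w)`. Hence `M` commutes with `δ_w α_±(δ_w)`. In particular `M` commutes with `γG`, where `G =
α_±(γ)` is invertible, and with `Δ α_±(Δ)`.

It therefore suffices that `α_±(Δ) = G^ℓ`: then `ΔG^ℓ = (Δγ^{-ℓ})(γG)^ℓ`, the invertible factor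
`(γG)^ℓ` cancels, and `Δγ^{-ℓ}` commutes with all entries of `M` (`commute_scalar_of_commute`).

For this, two identities hold for every quantum matrix: `γ^ℓ e_ℓ = e_ℓ Δ`
(`kapCoeff_pow_mul_elemSum`) and `γ e_ℓ = e_ℓ γ` (`elemSum_commute_kapCoeff`). Each comes from
evaluating one R-trace in two ways. For the first, the product of `3ℓ` copies is put between `ℓ`
nested caps and cups, with `a^(2ℓ)` on the last `2ℓ` strands. Contracting `a^(2ℓ)` with the cups
gives `γ^ℓ e_ℓ`; moving the cups cyclically around the trace gives `e_ℓ Δ`. The common factor is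
nonzero because `μ = q^{1-2ℓ}` and `q` is generic up to order `2ℓ` (`sandwichCoeff_ne`). In the
representation where `e_ℓ` is invertible the two identities give `Δ = γ^ℓ`.

The traces are computable since `κ X κ` is a multiple of the partial trace of `X` times `κ`
(`sandwich`), and cyclicity is available since `D ⊗ D` commutes with the rank-one operator `κ`
(`D_kappa`). The properties of the antisymmetrizers come from the Yang–Baxter equation with spectral
parameters (`antisym_eigen`). If `κ = 0`, then `g = 0` and the extended algebra is trivial. -/

theorem sub_inv_ne_zero (hq : q ≠ 0) (hq1 : q ^ 2 ≠ 1) : q - q⁻¹ ≠ 0 := by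
  intro h
  apply hq1
  field_simp at h
  linear_combination h

namespace IsBMWRepresentation

variable (h : IsBMWRepresentation q μ m σ σ')
include h

theorem shift {p m' : ℕ} (hm : m' + p ≤ m) :
    IsBMWRepresentation q μ m' (fun j => σ (j + p)) (fun j => σ' (j + p)) where
  mul_inv i hi := h.mul_inv _ (by omega)
  inv_mul i hi := h.inv_mul _ (by omega)
  braid i hi := by
    have := h.braid (i + p) (by omega)
    rwa [show i + p + 1 = i + 1 + p by omega] at this
  far i hi j hj hij := h.far _ (by omega) _ (by omega) (by omega)
  sigma_kappa i hi := h.sigma_kappa _ (by omega)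
  kappa_sigma i hi := h.kappa_sigma _ (by omega)
  kappa_mul_sigma i hi j hj hij := h.kappa_mul_sigma _ (by omega) _ (by omega) (by omega)
  kappa_mul_inv i hi j hj hij := h.kappa_mul_inv _ (by omega) _ (by omega) (by omega)
  sigma_mul_kappa i hi j hj hij := h.sigma_mul_kappa _ (by omega) _ (by omega) (by omega)
  inv_mul_kappa i hi j hj hij := h.inv_mul_kappa _ (by omega) _ (by omega) (by omega)
  kappa_kappa_kappa i hi j hj hij := h.kappa_kappa_kappa _ (by omega) _ (by omega) (by omega)
  kappa_sq i hi := h.kappa_sq _ (by omega)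

/-- The defining relations are symmetric under reversing the order of the strands. This transports
statements about the last strand to the first one. -/
theorem reverse :
    IsBMWRepresentation q μ m (fun j => σ (m - 1 - j)) (fun j => σ' (m - 1 - j)) where
  mul_inv i hi := h.mul_inv _ (by omega)
  inv_mul i hi := h.inv_mul _ (by omega)
  braid i hi := by
    have := h.braid (m - 1 - (i + 1)) (by omega)
    rw [show m - 1 - (i + 1) + 1 = m - 1 - i by omega] at this
    exact this.symm
  far i hi j hj hij := (h.far _ (by omega) _ (by omega) (by omega)).symm
  sigma_kappa i hi := h.sigma_kappa _ (by omega)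
  kappa_sigma i hi := h.kappa_sigma _ (by omega)
  kappa_mul_sigma i hi j hj hij := h.kappa_mul_sigma _ (by omega) _ (by omega) (by omega)
  kappa_mul_inv i hi j hj hij := h.kappa_mul_inv _ (by omega) _ (by omega) (by omega)
  sigma_mul_kappa i hi j hj hij := h.sigma_mul_kappa _ (by omega) _ (by omega) (by omega)
  inv_mul_kappa i hi j hj hij := h.inv_mul_kappa _ (by omega) _ (by omega) (by omega)
  kappa_kappa_kappa i hi j hj hij := h.kappa_kappa_kappa _ (by omega) _ (by omega) (by omega)
  kappa_sq i hi := h.kappa_sq _ (by omega)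

theorem inv_mul_kappa_self (hμ : μ ≠ 0) {i : ℕ} (hi : i < m) :
    σ' i * kappa q μ (σ i) = μ⁻¹ • kappa q μ (σ i) := by
  have h1 : kappa q μ (σ i) = μ⁻¹ • (σ i * kappa q μ (σ i)) := by
    rw [h.sigma_kappa i hi, smul_smul, inv_mul_cancel₀ hμ, one_smul]
  calc σ' i * kappa q μ (σ i) = σ' i * (μ⁻¹ • (σ i * kappa q μ (σ i))) := by rw [← h1]
    _ = μ⁻¹ • ((σ' i * σ i) * kappa q μ (σ i)) := by rw [mul_smul_comm, mul_assoc]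
    _ = _ := by rw [h.inv_mul i hi, one_mul]

theorem kappa_mul_inv_self (hμ : μ ≠ 0) {i : ℕ} (hi : i < m) :
    kappa q μ (σ i) * σ' i = μ⁻¹ • kappa q μ (σ i) := by
  have h1 : kappa q μ (σ i) = μ⁻¹ • (kappa q μ (σ i) * σ i) := by
    rw [h.kappa_sigma i hi, smul_smul, inv_mul_cancel₀ hμ, one_smul]
  calc kappa q μ (σ i) * σ' i = (μ⁻¹ • (kappa q μ (σ i) * σ i)) * σ' i := by rw [← h1]
    _ = μ⁻¹ • (kappa q μ (σ i) * (σ i * σ' i)) := by rw [smul_mul_assoc, mul_assoc]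
    _ = _ := by rw [h.mul_inv i hi, mul_one]

omit h in
theorem _root_.QMA.smul_kappa (hμ : μ ≠ 0) (hq : q ≠ 0) (hl : q - q⁻¹ ≠ 0) (x : A) :
    (μ * (q - q⁻¹)) • kappa q μ x = 1 + (q - q⁻¹) • x - x * x := by
  rw [kappa, smul_smul, mul_inv_cancel₀ (mul_ne_zero hμ hl), one_smul]
  simp only [Algebra.algebraMap_eq_smul_one, sub_mul, mul_add, smul_mul_assoc, mul_smul_comm,
    one_mul, mul_one]
  match_scalars <;> field_simp
  ring

theorem inv_eq (hμ : μ ≠ 0) (hq : q ≠ 0) (hl : q - q⁻¹ ≠ 0) {i : ℕ} (hi : i < m) :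
    σ' i = σ i - (q - q⁻¹) • 1 + (q - q⁻¹) • kappa q μ (σ i) := by
  have h1 := congrArg (· * σ' i) (smul_kappa hμ hq hl (σ i))
  simp only [smul_mul_assoc, h.kappa_mul_inv_self hμ hi, smul_smul, sub_mul (_ : A), add_mul (_ : A),
    one_mul, mul_assoc (_ : A), h.mul_inv i hi, mul_one] at h1
  rw [show μ * (q - q⁻¹) * μ⁻¹ = q - q⁻¹ by field_simp] at h1
  rw [h1]
  abel

omit h in
theorem _root_.QMA.mul_self_eq (hμ : μ ≠ 0) (hq : q ≠ 0) (hl : q - q⁻¹ ≠ 0) (x : A) :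
    x * x = 1 + (q - q⁻¹) • x - (μ * (q - q⁻¹)) • kappa q μ x := by
  rw [smul_kappa hμ hq hl]
  abel

theorem kappa_sigma_kappa (hμ : μ ≠ 0) {i j : ℕ} (hi : i < m) (hj : j < m)
    (hij : j = i + 1 ∨ i = j + 1) :
    kappa q μ (σ i) * σ j * kappa q μ (σ i) = μ⁻¹ • kappa q μ (σ i) := by
  rw [h.kappa_mul_sigma i hi j hj hij, mul_assoc, h.inv_mul_kappa_self hμ hi, mul_smul_comm,
    h.kappa_kappa_kappa i hi j hj hij]

theorem sigma_sigma_kappa {i j : ℕ} (hi : i < m) (hj : j < m)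
    (hij : j = i + 1 ∨ i = j + 1) :
    σ i * σ j * kappa q μ (σ i) = kappa q μ (σ j) * kappa q μ (σ i) := by
  rw [mul_assoc, h.sigma_mul_kappa i hi j hj hij, ← mul_assoc, ← mul_assoc, h.mul_inv i hi,
    one_mul]

theorem kappa_sigma_sigma {i j : ℕ} (hi : i < m) (hj : j < m)
    (hij : j = i + 1 ∨ i = j + 1) :
    kappa q μ (σ i) * σ j * σ i = kappa q μ (σ i) * kappa q μ (σ j) := by
  rw [h.kappa_mul_sigma i hi j hj hij, mul_assoc, h.inv_mul i hi, mul_one]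

theorem sigma_kappa_kappa (hμ : μ ≠ 0) (hq : q ≠ 0) (hl : q - q⁻¹ ≠ 0) {i j : ℕ}
    (hi : i < m) (hj : j < m) (hij : j = i + 1 ∨ i = j + 1) :
    σ i * kappa q μ (σ j) * kappa q μ (σ i) =
      σ j * kappa q μ (σ i) - (q - q⁻¹) • kappa q μ (σ i) +
        (q - q⁻¹) • (kappa q μ (σ j) * kappa q μ (σ i)) := by
  rw [← h.inv_mul_kappa i hi j hj hij, h.inv_eq hμ hq hl hj]
  simp only [sub_mul, add_mul, smul_mul_assoc, one_mul]

theorem kappa_kappa_sigma (hμ : μ ≠ 0) (hq : q ≠ 0) (hl : q - q⁻¹ ≠ 0) {i j : ℕ}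
    (hi : i < m) (hj : j < m) (hij : j = i + 1 ∨ i = j + 1) :
    kappa q μ (σ i) * kappa q μ (σ j) * σ i =
      kappa q μ (σ i) * σ j - (q - q⁻¹) • kappa q μ (σ i) +
        (q - q⁻¹) • (kappa q μ (σ i) * kappa q μ (σ j)) := by
  rw [← h.kappa_mul_inv i hi j hj hij, h.inv_eq hμ hq hl hj]
  simp only [mul_sub, mul_add, mul_smul_comm, mul_one]

/-- Both `σ_i κ_j σ_i` and `σ_j⁻¹ κ_i σ_j⁻¹` equal `σ_i κ_j κ_i κ_j σ_i`; the inverses are then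
expanded through `σ⁻¹ = σ - (q - q⁻¹) + (q - q⁻¹)κ`. -/
theorem sigma_kappa_sigma (hμ : μ ≠ 0) (hq : q ≠ 0) (hl : q - q⁻¹ ≠ 0) {i j : ℕ}
    (hi : i < m) (hj : j < m) (hij : j = i + 1 ∨ i = j + 1) :
    σ i * kappa q μ (σ j) * σ i =
      σ j * kappa q μ (σ i) * σ j
      + (q - q⁻¹) • (σ i * kappa q μ (σ j) - σ j * kappa q μ (σ i))
      + (q - q⁻¹) • (kappa q μ (σ j) * σ i - kappa q μ (σ i) * σ j)
      + (q - q⁻¹) ^ 2 • (kappa q μ (σ i) - kappa q μ (σ j)) := by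
  have hji : i = j + 1 ∨ j = i + 1 := hij.symm
  have e1 : σ i * kappa q μ (σ j) * σ i = σ' j * kappa q μ (σ i) * σ' j := by
    rw [h.inv_mul_kappa i hi j hj hij, mul_assoc _ _ (σ' j), h.kappa_mul_inv i hi j hj hij,
      ← mul_assoc, ← mul_assoc, mul_assoc (σ i) _ (kappa q μ (σ i)),
      mul_assoc (σ i) _ (kappa q μ (σ j)), h.kappa_kappa_kappa j hj i hi hji]
  rw [e1, h.inv_eq hμ hq hl hj]
  have e2 := h.sigma_kappa_kappa hμ hq hl hj hi hji
  have e3 := h.kappa_kappa_sigma hμ hq hl hj hi hji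
  have e4 := h.kappa_kappa_kappa j hj i hi hji
  simp only [mul_sub, mul_add, sub_mul, add_mul, smul_mul_assoc, mul_smul_comm, one_mul, mul_one,
    e2, e3, e4]
  module

/-- The Yang–Baxter equation for the baxterized generators. -/
theorem baxMinus_yangBaxter (hμ : μ ≠ 0) (hq : q ≠ 0) (hl : q - q⁻¹ ≠ 0) {i j : ℕ}
    (hi : i < m) (hj : j < m) (hij : j = i + 1 ∨ i = j + 1) {x y : ℂ}
    (hx : μ + q * x ≠ 0) (hy : μ + q * y ≠ 0) (hxy : μ + q * (x * y) ≠ 0) :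
    baxMinus q μ (σ i) x * baxMinus q μ (σ j) (x * y) * baxMinus q μ (σ i) y =
      baxMinus q μ (σ j) y * baxMinus q μ (σ i) (x * y) * baxMinus q μ (σ j) x := by
  have hji : i = j + 1 ∨ j = i + 1 := hij.symm
  have b : σ i * σ j * σ i = σ j * σ i * σ j := by
    rcases hij with rfl | rfl
    · exact h.braid _ hj
    · exact (h.braid _ hi).symm
  have i1 := mul_self_eq hμ hq hl (σ i)
  have i2 := h.sigma_kappa i hi
  have i3 := h.kappa_sigma i hi
  have i4 := h.kappa_sq i hi
  have i5 := h.kappa_sigma_kappa hμ hi hj hij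
  have i6 := h.sigma_sigma_kappa hi hj hij
  have i7 := h.kappa_sigma_sigma hi hj hij
  have i8 := h.sigma_kappa_kappa hμ hq hl hi hj hij
  have i9 := h.kappa_kappa_sigma hμ hq hl hi hj hij
  have i10 := h.kappa_kappa_kappa i hi j hj hij
  have i11 := h.sigma_kappa_sigma hμ hq hl hi hj hij
  have j1 := mul_self_eq hμ hq hl (σ j)
  have j2 := h.sigma_kappa j hj
  have j3 := h.kappa_sigma j hj
  have j4 := h.kappa_sq j hj
  have j5 := h.kappa_sigma_kappa hμ hj hi hji
  have j6 := h.sigma_sigma_kappa hj hi hji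
  have j7 := h.kappa_sigma_sigma hj hi hji
  have j8 := h.sigma_kappa_kappa hμ hq hl hj hi hji
  have j9 := h.kappa_kappa_sigma hμ hq hl hj hi hji
  have j10 := h.kappa_kappa_kappa j hj i hi hji
  simp only [baxMinus]
  -- The relations serve as rewriting rules that bring both sides to combinations of the same words.
  -- For `σκσ` only the rule in one direction (`i11`) is included, since its mirror image would undo
  -- it.
  simp only [mul_add, add_mul, smul_mul_assoc, mul_smul_comm, one_mul, mul_one,
    i1, i2, i3, i4, i5, i6, i7, i8, i9, i10, i11, j1, j2, j3, j4, j5, j6, j7, j8, j9, j10, b, eta]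
  clear i1 i2 i3 i4 i5 i6 i7 i8 i9 i10 i11 j1 j2 j3 j4 j5 j6 j7 j8 j9 j10 b
  have hq2 : q ^ 2 - 1 ≠ 0 := fun e => hl (by field_simp; rw [e, mul_zero])
  have hl' : q - q⁻¹ = (q ^ 2 - 1) / q := by field_simp
  rw [hl']
  clear hl hl'
  -- The same nonvanishing denominators in every arrangement of their factors, for clearing
  -- denominators in the coefficients.
  have hxy' : μ + q * x * y ≠ 0 := by rwa [mul_assoc]
  have hxy'' : μ + x * q * y ≠ 0 := by rwa [mul_comm x]
  have hxy₃ : μ + x * y * q ≠ 0 := by rwa [mul_comm (x * y)]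
  have hxy₄ : μ + y * q * x ≠ 0 := by rwa [mul_comm y, mul_assoc, mul_comm y]
  have hxy₅ : μ + q * y * x ≠ 0 := by rwa [mul_assoc, mul_comm y]
  have hxy₆ : μ + y * x * q ≠ 0 := by rwa [mul_comm y, mul_comm (x * y)]
  have hx' : μ + x * q ≠ 0 := by rwa [mul_comm x]
  have hy' : μ + y * q ≠ 0 := by rwa [mul_comm y]
  match_scalars <;> field_simp <;> ring

end IsBMWRepresentation

end BMWRelations

section Polynomials

/-! Compatibility of `κ`, `σ⁻(z)` and the antisymmetrizers with intertwiners and homomorphisms. -/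

variable {A B : Type} [Ring A] [Algebra ℂ A] [Ring B] [Algebra ℂ B] {q μ : ℂ}

theorem map_kappa (f : A →ₐ[ℂ] B) (x : A) : f (kappa q μ x) = kappa q μ (f x) := by
  simp [kappa]

theorem map_baxMinus (f : A →ₐ[ℂ] B) (x : A) (z : ℂ) :
    f (baxMinus q μ x z) = baxMinus q μ (f x) z := by
  simp [baxMinus, map_kappa]

theorem map_antisym (f : A →ₐ[ℂ] B) (σ : ℕ → A) (i : ℕ) :
    f (antisym q μ σ i) = antisym q μ (fun j => f (σ j)) i := by
  induction i with
  | zero => simp [antisym]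
  | succ i ih =>
    cases i with
    | zero => simp [antisym]
    | succ i => simp only [antisym, map_smul, map_mul, ih, map_baxMinus]

theorem kappa_intertwine {x s t : A} (h : x * s = t * x) :
    x * kappa q μ s = kappa q μ t * x := by
  have e : ∀ c : ℂ, x * algebraMap ℂ A c = algebraMap ℂ A c * x :=
    fun c => (Algebra.commutes c x).symm
  rw [kappa, kappa, mul_smul_comm, smul_mul_assoc]
  congr 1
  calc x * ((algebraMap ℂ A q - s) * (algebraMap ℂ A q⁻¹ + s))
      = (x * algebraMap ℂ A q - x * s) * (algebraMap ℂ A q⁻¹ + s) := by noncomm_ring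
    _ = (algebraMap ℂ A q - t) * x * (algebraMap ℂ A q⁻¹ + s) := by
        rw [e, h]; noncomm_ring
    _ = (algebraMap ℂ A q - t) * (x * algebraMap ℂ A q⁻¹ + x * s) := by noncomm_ring
    _ = _ := by rw [e, h]; noncomm_ring

theorem baxMinus_intertwine {x s t : A} (h : x * s = t * x) (z : ℂ) :
    x * baxMinus q μ s z = baxMinus q μ t z * x := by
  simp only [baxMinus, mul_add, add_mul, mul_smul_comm, smul_mul_assoc, h,
    kappa_intertwine (q := q) (μ := μ) h, mul_one, one_mul]

theorem antisym_intertwine {x : A} {s t : ℕ → A} (i : ℕ)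
    (h : ∀ j, j + 1 < i → x * s j = t j * x) :
    x * antisym q μ s i = antisym q μ t i * x := by
  induction i with
  | zero => simp [antisym]
  | succ i ih =>
    cases i with
    | zero => simp [antisym]
    | succ i =>
      have e := ih fun j hj => h j (by omega)
      have eb := baxMinus_intertwine (q := q) (μ := μ) (h i (by omega))
        (q ^ (2 * (i + 1)))⁻¹
      simp only [antisym, mul_smul_comm, smul_mul_assoc]
      congr 1
      calc _ = (x * antisym q μ s (i + 1)) * baxMinus q μ (s i) (q ^ (2 * (i + 1)))⁻¹
            * antisym q μ s (i + 1) := by noncomm_ring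
        _ = antisym q μ t (i + 1) * (x * baxMinus q μ (s i) (q ^ (2 * (i + 1)))⁻¹)
            * antisym q μ s (i + 1) := by rw [e]; noncomm_ring
        _ = antisym q μ t (i + 1) * baxMinus q μ (t i) (q ^ (2 * (i + 1)))⁻¹
            * (x * antisym q μ s (i + 1)) := by rw [eb]; noncomm_ring
        _ = _ := by rw [e]; noncomm_ring

theorem antisym_commute {x : A} {s : ℕ → A} (i : ℕ) (h : ∀ j, j + 1 < i → Commute x (s j)) :
    Commute x (antisym q μ s i) :=
  antisym_intertwine i fun j hj => h j hj

theorem kappa_commute {x s : A} (h : Commute x s) : Commute x (kappa q μ s) :=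
  kappa_intertwine h

theorem baxMinus_commute {x s : A} (h : Commute x s) (z : ℂ) : Commute x (baxMinus q μ s z) :=
  baxMinus_intertwine h z

theorem antisym_congr {s t : ℕ → A} (i : ℕ) (h : ∀ j, j + 1 < i → s j = t j) :
    antisym q μ s i = antisym q μ t i := by
  have := antisym_intertwine (q := q) (μ := μ) (x := (1 : A)) (s := s) (t := t) i
    fun j hj => by rw [one_mul, mul_one, h j hj]
  simpa using this

/-- `κ` is quadratic in its generator, and `x s² = x t s = x s t = x t²` by commutation. -/
theorem mul_kappa_eq {s t x : A} (h : x * s = x * t) (hst : Commute s t) :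
    x * kappa q μ s = x * kappa q μ t := by
  have h2 : x * (s * s) = x * (t * t) := by
    rw [← mul_assoc, h, mul_assoc, ← hst.eq, ← mul_assoc, h, mul_assoc]
  have e : ∀ u : A, x * ((algebraMap ℂ A q - u) * (algebraMap ℂ A q⁻¹ + u)) =
      x * (algebraMap ℂ A q * algebraMap ℂ A q⁻¹) + (x * u) * (algebraMap ℂ A q - algebraMap ℂ A q⁻¹)
        - x * (u * u) := fun u => by
    have := Algebra.commutes (A := A) q u
    calc _ = x * (algebraMap ℂ A q * algebraMap ℂ A q⁻¹) + x * (algebraMap ℂ A q * u)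
          - x * (u * algebraMap ℂ A q⁻¹) - x * (u * u) := by noncomm_ring
      _ = _ := by rw [this]; noncomm_ring
  rw [kappa, kappa, mul_smul_comm, mul_smul_comm, e, e, h, h2]

/-- If generators `s j` and `t j` from two commuting families act equally on `x`, so do their
antisymmetrizers. -/
theorem mul_antisym_eq {x : A} {s t : ℕ → A} (i : ℕ)
    (h : ∀ j, j + 1 < i → x * s j = x * t j)
    (hst : ∀ j, j + 1 < i → ∀ j', j' + 1 < i → Commute (s j) (t j')) :
    x * antisym q μ s i = x * antisym q μ t i := by
  induction i with
  | zero => simp [antisym]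
  | succ i ih =>
    cases i with
    | zero => simp [antisym]
    | succ i =>
      have e := ih (fun j hj => h j (by omega))
        fun j hj j' hj' => hst j (by omega) j' (by omega)
      have eb : x * baxMinus q μ (s i) (q ^ (2 * (i + 1)))⁻¹ =
          x * baxMinus q μ (t i) (q ^ (2 * (i + 1)))⁻¹ := by
        simp only [baxMinus, mul_add, mul_smul_comm, h i (by omega),
          mul_kappa_eq (q := q) (μ := μ) (h i (by omega)) (hst i (by omega) i (by omega))]
      have c1 : Commute (antisym q μ s (i + 1)) (antisym q μ t (i + 1)) :=
        antisym_commute _ fun j hj =>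
          (antisym_commute _ fun j' hj' => (hst j' (by omega) j (by omega)).symm).symm
      have c2 : Commute (baxMinus q μ (s i) (q ^ (2 * (i + 1)))⁻¹) (antisym q μ t (i + 1)) :=
        antisym_commute _ fun j hj =>
          (baxMinus_commute (hst i (by omega) j (by omega)).symm _).symm
      have c3 : Commute (antisym q μ s (i + 1)) (baxMinus q μ (t i) (q ^ (2 * (i + 1)))⁻¹) :=
        baxMinus_commute (antisym_commute _ fun j hj => (hst j (by omega) i (by omega)).symm).symm _
      simp only [antisym, mul_smul_comm]
      congr 1
      set a := antisym q μ s (i + 1)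
      set a' := antisym q μ t (i + 1)
      set b := baxMinus q μ (s i) (q ^ (2 * (i + 1)))⁻¹
      set b' := baxMinus q μ (t i) (q ^ (2 * (i + 1)))⁻¹
      -- Exchanging factors one at a time reverses their order: `x s₁ s₂ = x t₁ s₂ = x s₂ t₁ = x t₂
      -- t₁`. This is harmless here because `a b a` is a palindrome.
      calc x * (a * b * a) = (x * a) * b * a := by noncomm_ring
        _ = x * (a' * b) * a := by rw [e]; noncomm_ring
        _ = (x * b) * (a' * a) := by rw [← c2.eq]; noncomm_ring
        _ = x * (b' * a) * a' := by rw [eb, ← c1.eq]; noncomm_ring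
        _ = (x * a) * b' * a' := by rw [← c3.eq]; noncomm_ring
        _ = x * (a' * b' * a') := by rw [e]; noncomm_ring

end Polynomials

/-- The parameters are generic up to order `k`. -/
structure IsGeneric (k : ℕ) (q μ : ℂ) : Prop where
  q_ne : q ≠ 0
  μ_ne : μ ≠ 0
  q_pow : ∀ i : ℕ, 1 ≤ i → i ≤ k → q ^ (2 * i) ≠ 1
  denom : ∀ i : ℕ, 1 ≤ i → i ≤ k → μ + q * (q ^ (2 * i))⁻¹ ≠ 0

/-- The value of `σ⁻(z)` at `σ = -q⁻¹`, `κ = 0`. -/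
noncomputable def baxChar (q z : ℂ) : ℂ := 1 - q⁻¹ * ((z - 1) / (q - q⁻¹))

/-- The coefficient in `κ a^(n+1) κ = c a^(n) κ`. -/
noncomputable def sandwichCoeff (q μ : ℂ) (n : ℕ) : ℂ :=
  q ^ n / qNum q (n + 1) *
    (eta q μ + ((q ^ (2 * n))⁻¹ - 1) / (q - q⁻¹) * μ⁻¹ +
      μ * ((q ^ (2 * n))⁻¹ - 1) / (μ + q * (q ^ (2 * n))⁻¹))

namespace IsGeneric

variable {k : ℕ} {q μ : ℂ} (g : IsGeneric k q μ)
include g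

theorem lam_ne (hk : 1 ≤ k) : q - q⁻¹ ≠ 0 :=
  sub_inv_ne_zero g.q_ne (by simpa using g.q_pow 1 le_rfl hk)

theorem qNum_ne {i : ℕ} (hi : 1 ≤ i) (hk : i ≤ k) : qNum q i ≠ 0 := by
  have h0 := g.q_ne
  refine div_ne_zero ?_ (g.lam_ne (hi.trans hk))
  intro h
  apply g.q_pow i hi hk
  have h1 : q ^ i ≠ 0 := pow_ne_zero _ h0
  field_simp at h
  rw [two_mul, pow_add]
  linear_combination h

/-- The normalization in the definition of `a^(i+1)` is the inverse of the value of the baxterized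
factor on the eigenvalue `-q⁻¹`, so that antisymmetrizers fix antisymmetric vectors. -/
theorem coeff_mul_baxChar {i : ℕ} (hk : i + 1 ≤ k) :
    q ^ i / qNum q (i + 1) * baxChar q (q ^ (2 * i))⁻¹ = 1 := by
  have h0 := g.q_ne
  have h1 := g.qNum_ne (Nat.le_add_left 1 i) hk
  have h2 := g.lam_ne ((Nat.le_add_left 1 i).trans hk)
  have h3 : q ^ i ≠ 0 := pow_ne_zero _ h0
  rw [div_mul_eq_mul_div, div_eq_one_iff_eq h1, qNum, eq_div_iff h2, baxChar, two_mul, pow_add,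
    pow_succ]
  have h4 : q ^ 2 - 1 ≠ 0 := fun e => h2 (by field_simp; rw [e, mul_zero])
  field_simp
  ring

end IsGeneric

namespace IsBMWRepresentation

variable {A : Type} [Ring A] [Algebra ℂ A] {q μ : ℂ} {m k : ℕ} {σ σ' : ℕ → A}

section Antisymmetrizer

variable (h : IsBMWRepresentation q μ m σ σ') (g : IsGeneric k q μ)
include h g

/-- `κσ = μκ` gives `(μ + q⁻¹) κ x = 0`, and `μ + q⁻¹` is the denominator of `IsGeneric` with `i =
1`. -/
theorem kappa_mul_of_eigen (hk : 1 ≤ k) {x : A} {j : ℕ} (hj : j < m)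
    (hx : σ j * x = -q⁻¹ • x) : kappa q μ (σ j) * x = 0 := by
  have h1 : (μ + q⁻¹) • (kappa q μ (σ j) * x) = 0 := by
    have h2 : kappa q μ (σ j) * (σ j * x) = μ • (kappa q μ (σ j) * x) := by
      rw [← mul_assoc, h.kappa_sigma j hj, smul_mul_assoc]
    rw [add_smul, ← h2, hx, mul_smul_comm, ← add_smul, neg_add_cancel, zero_smul]
  refine (smul_eq_zero.mp h1).resolve_left ?_
  have h0 := g.q_ne
  have := g.denom 1 le_rfl hk
  rwa [show q * (q ^ (2 * 1))⁻¹ = q⁻¹ by field_simp] at this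

theorem mul_kappa_of_eigen (hk : 1 ≤ k) {x : A} {j : ℕ} (hj : j < m)
    (hx : x * σ j = -q⁻¹ • x) : x * kappa q μ (σ j) = 0 := by
  have h1 : (μ + q⁻¹) • (x * kappa q μ (σ j)) = 0 := by
    have h2 : x * σ j * kappa q μ (σ j) = μ • (x * kappa q μ (σ j)) := by
      rw [mul_assoc, h.sigma_kappa j hj, mul_smul_comm]
    rw [add_smul, ← h2, hx, smul_mul_assoc, ← add_smul, neg_add_cancel, zero_smul]
  refine (smul_eq_zero.mp h1).resolve_left ?_
  have h0 := g.q_ne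
  have := g.denom 1 le_rfl hk
  rwa [show q * (q ^ (2 * 1))⁻¹ = q⁻¹ by field_simp] at this

theorem baxMinus_mul_of_eigen (hk : 1 ≤ k) {x : A} {j : ℕ} (hj : j < m)
    (hx : σ j * x = -q⁻¹ • x) (z : ℂ) : baxMinus q μ (σ j) z * x = baxChar q z • x := by
  simp only [baxMinus, add_mul, smul_mul_assoc, one_mul, hx, h.kappa_mul_of_eigen g hk hj hx,
    smul_zero, add_zero, baxChar]
  module

theorem mul_baxMinus_of_eigen (hk : 1 ≤ k) {x : A} {j : ℕ} (hj : j < m)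
    (hx : x * σ j = -q⁻¹ • x) (z : ℂ) : x * baxMinus q μ (σ j) z = baxChar q z • x := by
  simp only [baxMinus, mul_add, mul_smul_comm, mul_one, hx, h.mul_kappa_of_eigen g hk hj hx,
    smul_zero, add_zero, baxChar]
  module

theorem antisym_mul_of_eigen {x : A} (n : ℕ) (hn : n ≤ m + 1) (hk : n ≤ k)
    (hx : ∀ j, j + 1 < n → σ j * x = -q⁻¹ • x) : antisym q μ σ n * x = x := by
  induction n with
  | zero => simp [antisym]
  | succ n ih =>
    cases n with
    | zero => simp [antisym]
    | succ n =>
      have e := ih (by omega) (by omega) fun j hj => hx j (by omega)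
      rw [antisym, smul_mul_assoc, mul_assoc, e, mul_assoc,
        h.baxMinus_mul_of_eigen g (by omega) (by omega) (hx n (by omega)), mul_smul_comm, e,
        smul_smul, g.coeff_mul_baxChar hk, one_smul]

theorem mul_antisym_of_eigen {x : A} (n : ℕ) (hn : n ≤ m + 1) (hk : n ≤ k)
    (hx : ∀ j, j + 1 < n → x * σ j = -q⁻¹ • x) : x * antisym q μ σ n = x := by
  induction n with
  | zero => simp [antisym]
  | succ n ih =>
    cases n with
    | zero => simp [antisym]
    | succ n =>
      have e := ih (by omega) (by omega) fun j hj => hx j (by omega)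
      rw [antisym, mul_smul_comm, ← mul_assoc, ← mul_assoc, e,
        h.mul_baxMinus_of_eigen g (by omega) (by omega) (hx n (by omega)), smul_mul_assoc, e,
        smul_smul, g.coeff_mul_baxChar hk, one_smul]

/-- At `z = q⁻²` the baxterized element is, up to a factor, the spectral projector of `σ` for the
eigenvalue `-q⁻¹`. -/
theorem sigma_mul_baxMinus (hk : 1 ≤ k) {j : ℕ} (hj : j < m) :
    σ j * baxMinus q μ (σ j) (q ^ (2 * 1))⁻¹ = -q⁻¹ • baxMinus q μ (σ j) (q ^ (2 * 1))⁻¹ := by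
  have h0 := g.q_ne
  have hd := g.denom 1 le_rfl hk
  have hl := g.lam_ne hk
  have h4 : q ^ 2 - 1 ≠ 0 := fun e => hl (by field_simp; rw [e, mul_zero])
  have e1 : μ + q * (q ^ (2 * 1))⁻¹ = (μ * q + 1) / q := by field_simp; ring
  have hd' : μ * q + 1 ≠ 0 := fun e => hd (by rw [e1, e, zero_div])
  have hd2 : q * μ + 1 ≠ 0 := by rwa [mul_comm q]
  have hd3 : 1 + q * μ ≠ 0 := by rwa [add_comm]
  have hd4 : 1 + μ * q ≠ 0 := by rwa [add_comm]
  have hm := g.μ_ne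
  simp only [baxMinus, mul_add, mul_smul_comm, mul_one, mul_self_eq g.μ_ne h0 hl (σ j),
    h.sigma_kappa j hj, e1]
  clear hd e1
  match_scalars <;> field_simp <;> ring

theorem baxMinus_mul_sigma (hk : 1 ≤ k) {j : ℕ} (hj : j < m) :
    baxMinus q μ (σ j) (q ^ (2 * 1))⁻¹ * σ j = -q⁻¹ • baxMinus q μ (σ j) (q ^ (2 * 1))⁻¹ := by
  rw [← h.sigma_mul_baxMinus g hk hj]
  exact (baxMinus_commute (Commute.refl (σ j)) _).eq.symm

/-- Only the newest generator needs an argument. By the Yang–Baxter equation the antisymmetrizer can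
be rewritten to begin, or to end, with the baxterized newest generator at `q⁻²`, which that
generator multiplies by `-q⁻¹`. -/
theorem antisym_eigen (n : ℕ) (hn : n ≤ m + 1) (hk : n ≤ k) :
    ∀ j, j + 1 < n → σ j * antisym q μ σ n = -q⁻¹ • antisym q μ σ n ∧
      antisym q μ σ n * σ j = -q⁻¹ • antisym q μ σ n := by
  induction n with
  | zero => intro j hj; omega
  | succ n ih =>
    intro j hj
    obtain _ | n := n
    · omega
    have IH := ih (by omega) (by omega)
    obtain hj' | rfl : j + 1 < n + 1 ∨ j = n := by omega
    · obtain ⟨e1, e2⟩ := IH j hj'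
      constructor
      · rw [antisym, mul_smul_comm, ← mul_assoc, ← mul_assoc, e1, smul_mul_assoc, smul_mul_assoc,
          smul_comm]
      · rw [antisym, smul_mul_assoc, mul_assoc, e2, mul_smul_comm, smul_comm]
    obtain _ | n := j
    · simp only [antisym, one_mul, mul_one, mul_smul_comm, smul_mul_assoc]
      rw [h.sigma_mul_baxMinus g (by omega) (by omega), h.baxMinus_mul_sigma g (by omega) (by omega),
        smul_comm]
      exact ⟨rfl, rfl⟩
    have hχ := g.coeff_mul_baxChar (i := 1) (by omega)
    have hb1 := h.baxMinus_mul_of_eigen g (by omega) (by omega) (IH n (by omega)).1 (q ^ (2 * 1))⁻¹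
    have hb2 := h.mul_baxMinus_of_eigen g (by omega) (by omega) (IH n (by omega)).2 (q ^ (2 * 1))⁻¹
    have habs1 := h.antisym_mul_of_eigen g (x := antisym q μ σ (n + 2)) (n + 1) (by omega)
      (by omega) fun j hj => (IH j (by omega)).1
    have habs2 := h.mul_antisym_of_eigen g (x := antisym q μ σ (n + 2)) (n + 1) (by omega)
      (by omega) fun j hj => (IH j (by omega)).2
    -- The spectral parameter of the new factor is the product of the previous one with `q⁻²`, as
    -- the middle factor of the Yang–Baxter equation requires.
    have hz : (q ^ (2 * (n + 2)))⁻¹ = (q ^ (2 * (n + 1)))⁻¹ * (q ^ (2 * 1))⁻¹ := by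
      rw [show 2 * (n + 2) = 2 * (n + 1) + 2 * 1 by ring, pow_add, _root_.mul_inv]
    have hz' : (q ^ (2 * (n + 2)))⁻¹ = (q ^ (2 * 1))⁻¹ * (q ^ (2 * (n + 1)))⁻¹ := by
      rw [hz, mul_comm]
    have d1 := g.denom 1 le_rfl (by omega)
    have d2 := g.denom (n + 1) (by omega) (by omega)
    have d3 := g.denom (n + 2) (by omega) (by omega)
    have hc : Commute (baxMinus q μ (σ (n + 1)) (q ^ (2 * (n + 2)))⁻¹) (antisym q μ σ (n + 1)) :=
      antisym_commute _ fun j hj => (baxMinus_commute (h.far j (by omega) _ (by omega) (by omega)) _).symm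
    have hc1 : Commute (baxMinus q μ (σ (n + 1)) (q ^ (2 * 1))⁻¹) (antisym q μ σ (n + 1)) :=
      antisym_commute _ fun j hj => (baxMinus_commute (h.far j (by omega) _ (by omega) (by omega)) _).symm
    have hyb1 := h.baxMinus_yangBaxter g.μ_ne g.q_ne (g.lam_ne (by omega)) (i := n) (j := n + 1)
      (by omega) (by omega) (Or.inl rfl) (x := (q ^ (2 * (n + 1)))⁻¹) (y := (q ^ (2 * 1))⁻¹) d2 d1
      (by rw [← hz]; exact d3)
    have hyb2 := h.baxMinus_yangBaxter g.μ_ne g.q_ne (g.lam_ne (by omega)) (i := n) (j := n + 1)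
      (by omega) (by omega) (Or.inl rfl) (x := (q ^ (2 * 1))⁻¹) (y := (q ^ (2 * (n + 1)))⁻¹) d1 d2
      (by rw [← hz']; exact d3)
    rw [← hz] at hyb1
    rw [← hz'] at hyb2
    have hs1 := h.sigma_mul_baxMinus g (j := n + 1) (by omega) (by omega)
    have hs2 := h.baxMinus_mul_sigma g (j := n + 1) (by omega) (by omega)
    have ha : antisym q μ σ (n + 2) = (q ^ (n + 1) / qNum q (n + 2)) • (antisym q μ σ (n + 1) *
        baxMinus q μ (σ n) (q ^ (2 * (n + 1)))⁻¹ * antisym q μ σ (n + 1)) := rfl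
    have ha3 : antisym q μ σ (n + 3) = (q ^ (n + 2) / qNum q (n + 3)) • (antisym q μ σ (n + 2) *
        baxMinus q μ (σ (n + 1)) (q ^ (2 * (n + 2)))⁻¹ * antisym q μ σ (n + 2)) := rfl
    set a := antisym q μ σ (n + 2)
    set a' := antisym q μ σ (n + 1)
    set B := baxMinus q μ (σ (n + 1)) (q ^ (2 * (n + 2)))⁻¹
    set B1 := baxMinus q μ (σ (n + 1)) (q ^ (2 * 1))⁻¹
    set b1 := baxMinus q μ (σ n) (q ^ (2 * 1))⁻¹
    set b := baxMinus q μ (σ n) (q ^ (2 * (n + 1)))⁻¹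
    set c := q ^ (n + 1) / qNum q (n + 2)
    set χ := baxChar q (q ^ (2 * 1))⁻¹
    set c1 := q ^ 1 / qNum q (1 + 1)
    -- A factor at `q⁻²`, on which `a` has a known eigenvalue, is inserted so that the three factors
    -- of one side of the Yang–Baxter equation become adjacent.
    have ea1 : a = c1 • (b1 * a) := by rw [hb1, smul_smul, hχ, one_smul]
    have ea2 : a = c1 • (a * b1) := by rw [hb2, smul_smul, hχ, one_smul]
    have k1 : a * B * a = (c * c1) • (B1 * (a' * baxMinus q μ (σ n) (q ^ (2 * (n + 2)))⁻¹ *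
        baxMinus q μ (σ (n + 1)) (q ^ (2 * (n + 1)))⁻¹ * a)) := by
      calc a * B * a = c • (a' * b * (a' * B) * a) := by
            conv_lhs => lhs; lhs; rw [ha]
            simp only [smul_mul_assoc]; congr 1; noncomm_ring
        _ = c • (a' * b * B * (a' * a)) := by rw [← hc.eq]; congr 1; noncomm_ring
        _ = c • (a' * b * B * (c1 • (b1 * a))) := by rw [habs1, ← ea1]
        _ = (c * c1) • (a' * (b * B * b1) * a) := by
            rw [mul_smul_comm, smul_smul]; congr 1; noncomm_ring
        _ = (c * c1) • ((a' * B1) * baxMinus q μ (σ n) (q ^ (2 * (n + 2)))⁻¹ *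
        baxMinus q μ (σ (n + 1)) (q ^ (2 * (n + 1)))⁻¹ * a) := by
            rw [hyb1]; congr 1; noncomm_ring
        _ = _ := by rw [← hc1.eq]; congr 1; noncomm_ring
    have k2 : a * B * a = (c * c1) • (a * baxMinus q μ (σ (n + 1)) (q ^ (2 * (n + 1)))⁻¹ *
        baxMinus q μ (σ n) (q ^ (2 * (n + 2)))⁻¹ * a' * B1) := by
      calc a * B * a = c • (a * (B * a') * b * a') := by
            conv_lhs => rhs; rw [ha]
            simp only [mul_smul_comm]; congr 1; noncomm_ring
        _ = c • ((a * a') * B * b * a') := by rw [hc.eq]; congr 1; noncomm_ring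
        _ = c • ((c1 • (a * b1)) * B * b * a') := by rw [habs2, ← ea2]
        _ = (c * c1) • (a * (b1 * B * b) * a') := by
            rw [smul_mul_assoc, smul_mul_assoc, smul_mul_assoc, smul_smul]; congr 1; noncomm_ring
        _ = (c * c1) • (a * baxMinus q μ (σ (n + 1)) (q ^ (2 * (n + 1)))⁻¹ *
        baxMinus q μ (σ n) (q ^ (2 * (n + 2)))⁻¹ * (B1 * a')) := by
            rw [hyb2]; congr 1; noncomm_ring
        _ = _ := by rw [hc1.eq]; congr 1; noncomm_ring
    rw [ha3]
    constructor
    · rw [k1, mul_smul_comm, mul_smul_comm, ← mul_assoc, hs1, smul_mul_assoc]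
      module
    · rw [k2, smul_mul_assoc, smul_mul_assoc, mul_assoc, hs2, mul_smul_comm]
      module

theorem sigma_mul_antisym {n j : ℕ} (hn : n ≤ m + 1) (hk : n ≤ k) (hj : j + 1 < n) :
    σ j * antisym q μ σ n = -q⁻¹ • antisym q μ σ n :=
  (h.antisym_eigen g n hn hk j hj).1

theorem antisym_mul_sigma {n j : ℕ} (hn : n ≤ m + 1) (hk : n ≤ k) (hj : j + 1 < n) :
    antisym q μ σ n * σ j = -q⁻¹ • antisym q μ σ n :=
  (h.antisym_eigen g n hn hk j hj).2

theorem antisym_mul_self {n : ℕ} (hn : n ≤ m + 1) (hk : n ≤ k) :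
    antisym q μ σ n * antisym q μ σ n = antisym q μ σ n :=
  h.antisym_mul_of_eigen g n hn hk fun _ hj => h.sigma_mul_antisym g hn hk hj

/-- The antisymmetrizer is invariant under the reversal of the strands. -/
theorem antisym_reverse {n : ℕ} (hn : n ≤ m + 1) (hk : n ≤ k) :
    antisym q μ (fun j => σ (n - 2 - j)) n = antisym q μ σ n := by
  have h' : IsBMWRepresentation q μ (n - 1) (fun j => σ (n - 1 - 1 - j + 0))
      (fun j => σ' (n - 1 - 1 - j + 0)) :=
    (h.shift (p := 0) (m' := n - 1) (by omega)).reverse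
  have e0 : (fun j => σ (n - 2 - j)) = fun j => σ (n - 1 - 1 - j + 0) := by
    funext j
    rw [show n - 1 - 1 - j + 0 = n - 2 - j by omega]
  rw [e0]
  -- Both antisymmetrizers are eigenvectors of all the generators, so each absorbs the other: their
  -- product equals the one and also the other.
  have e1 := h.antisym_mul_of_eigen g (x := antisym q μ (fun j => σ (n - 1 - 1 - j + 0)) n) n hn hk
    fun j hj => by
      have := h'.sigma_mul_antisym g (n := n) (j := n - 2 - j) (by omega) hk (by omega)
      simpa only [show n - 1 - 1 - (n - 2 - j) + 0 = j by omega] using this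
  have e2 := h'.mul_antisym_of_eigen g (x := antisym q μ σ n) n (by omega) hk
    fun j hj => h.antisym_mul_sigma g hn hk (by omega)
  exact e1.symm.trans e2

/-- `κ_n` commutes with `a^(n)`, so in `κ_n a^(n) σ⁻_{n-1} a^(n) κ_n` the two `κ_n` can be brought
next to `σ⁻_{n-1}`, where the BMW relations leave a multiple of `κ_n`. -/
theorem kappa_antisym_kappa {n : ℕ} (hn1 : 1 ≤ n) (hn : n < m) (hk : n + 1 ≤ k) :
    kappa q μ (σ n) * antisym q μ σ (n + 1) * kappa q μ (σ n) =
      sandwichCoeff q μ n • (antisym q μ σ n * kappa q μ (σ n)) := by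
  obtain ⟨n, rfl⟩ : ∃ n', n = n' + 1 := ⟨n - 1, by omega⟩
  have hc : Commute (kappa q μ (σ (n + 1))) (antisym q μ σ (n + 1)) :=
    antisym_commute _ fun j hj => (kappa_commute (h.far j (by omega) _ (by omega) (by omega))).symm
  have hI := h.antisym_mul_self g (n := n + 1) (by omega) (by omega)
  have hsand : kappa q μ (σ (n + 1)) * baxMinus q μ (σ n) (q ^ (2 * (n + 1)))⁻¹ *
      kappa q μ (σ (n + 1)) = (eta q μ + ((q ^ (2 * (n + 1)))⁻¹ - 1) / (q - q⁻¹) * μ⁻¹ +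
      μ * ((q ^ (2 * (n + 1)))⁻¹ - 1) / (μ + q * (q ^ (2 * (n + 1)))⁻¹)) •
        kappa q μ (σ (n + 1)) := by
    simp only [baxMinus, mul_add, add_mul, mul_smul_comm, smul_mul_assoc, mul_one,
      h.kappa_sq (n + 1) hn, h.kappa_sigma_kappa g.μ_ne hn (show n < m by omega) (Or.inr rfl),
      h.kappa_kappa_kappa (n + 1) hn n (by omega) (Or.inr rfl)]
    module
  rw [antisym, mul_smul_comm, smul_mul_assoc, sandwichCoeff, mul_smul]
  congr 1
  set a := antisym q μ σ (n + 1)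
  set κ := kappa q μ (σ (n + 1))
  set b := baxMinus q μ (σ n) (q ^ (2 * (n + 1)))⁻¹
  calc κ * (a * b * a) * κ = (κ * a) * b * (a * κ) := by simp only [mul_assoc]
    _ = (a * κ) * b * (κ * a) := by rw [hc.eq]
    _ = a * (κ * b * κ) * a := by simp only [mul_assoc]
    _ = _ := by rw [hsand, mul_smul_comm, smul_mul_assoc, mul_assoc, hc.eq, ← mul_assoc, hI]

/-- Mirror image of `kappa_antisym_kappa`; the antisymmetrizers are invariant under reversal of
their own strands. -/
theorem kappa_antisym_kappa_left {n p : ℕ} (hn1 : 1 ≤ n) (hn : n + p < m) (hk : n + 1 ≤ k) :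
    kappa q μ (σ p) * antisym q μ (fun j => σ (j + (p + 1))) (n + 1) * kappa q μ (σ p) =
      sandwichCoeff q μ n • (antisym q μ (fun j => σ (j + (p + 2))) n * kappa q μ (σ p)) := by
  have h' := (h.shift (p := p) (m' := n + 1) (by omega)).reverse
  have e := h'.kappa_antisym_kappa g hn1 (by omega) hk
  have r1 := (h.shift (p := p + 1) (m' := n) (by omega)).antisym_reverse g (n := n + 1) le_rfl hk
  have r2 := (h.shift (p := p + 2) (m' := n - 1) (by omega)).antisym_reverse g (n := n) (by omega)
    (by omega)
  have c1 : antisym q μ (fun j => σ (n + 1 - 1 - j + p)) (n + 1) =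
      antisym q μ (fun j => σ (j + (p + 1))) (n + 1) := by
    rw [← r1]
    exact antisym_congr _ fun j hj => by
      rw [show n + 1 - 1 - j + p = n + 1 - 2 - j + (p + 1) by omega]
  have c2 : antisym q μ (fun j => σ (n + 1 - 1 - j + p)) n =
      antisym q μ (fun j => σ (j + (p + 2))) n := by
    rw [← r2]
    exact antisym_congr _ fun j hj => by
      rw [show n + 1 - 1 - j + p = n - 2 - j + (p + 2) by omega]
  rw [c1, c2] at e
  simpa using e

end Antisymmetrizer

end IsBMWRepresentation

/-! ### Diagrammatic words: rows, nested caps and cups. -/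

section Words

variable {A : Type} [Ring A] (x : ℕ → A)

/-- The word `x p * ⋯ * x (p + n - 1)`. -/
def row (p : ℕ) : ℕ → A
  | 0 => 1
  | n + 1 => row p n * x (p + n)

/-- The word `x (p + n - 1) * ⋯ * x p`. -/
def rowRev (p : ℕ) : ℕ → A
  | 0 => 1
  | n + 1 => x (p + n) * rowRev p n

/-- A word with `n` nested caps on the strands `p, …, p + 2 n - 1` at the bottom, and adjacent
cups at the top. -/
def capWord : ℕ → ℕ → A
  | 0, _ => 1
  | n + 1, p => capWord n (p + 2) * row x p (n + 1)

/-- The word `capWord` reversed. -/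
def cupWord : ℕ → ℕ → A
  | 0, _ => 1
  | n + 1, p => rowRev x p (n + 1) * cupWord n (p + 2)

/-- The word `x p * x (p + 2) * ⋯ * x (p + 2 n - 2)`. -/
def pairWord : ℕ → ℕ → A
  | 0, _ => 1
  | n + 1, p => x p * pairWord n (p + 2)

variable {x}

theorem row_succ_left (p n : ℕ) : row x p (n + 1) = x p * row x (p + 1) n := by
  induction n with
  | zero => simp [row]
  | succ n ih => rw [row, ih, row, mul_assoc, show p + (n + 1) = p + 1 + n by omega]

section Commute

variable {y : A}

theorem row_commute {p n : ℕ} (h : ∀ j, p ≤ j → j < p + n → Commute y (x j)) :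
    Commute y (row x p n) := by
  induction n with
  | zero => exact Commute.one_right y
  | succ n ih =>
    exact (ih fun j h1 h2 => h j h1 (by omega)).mul_right (h _ (by omega) (by omega))

theorem rowRev_commute {p n : ℕ} (h : ∀ j, p ≤ j → j < p + n → Commute y (x j)) :
    Commute y (rowRev x p n) := by
  induction n with
  | zero => exact Commute.one_right y
  | succ n ih =>
    exact (h _ (by omega) (by omega)).mul_right (ih fun j h1 h2 => h j h1 (by omega))

theorem capWord_commute {n p : ℕ} (h : ∀ j, p ≤ j → j + 1 < p + 2 * n → Commute y (x j)) :
    Commute y (capWord x n p) := by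
  induction n generalizing p with
  | zero => exact Commute.one_right y
  | succ n ih =>
    exact (ih fun j h1 h2 => h j (by omega) (by omega)).mul_right
      (row_commute fun j h1 h2 => h j (by omega) (by omega))

theorem cupWord_commute {n p : ℕ} (h : ∀ j, p ≤ j → j + 1 < p + 2 * n → Commute y (x j)) :
    Commute y (cupWord x n p) := by
  induction n generalizing p with
  | zero => exact Commute.one_right y
  | succ n ih =>
    exact (rowRev_commute fun j h1 h2 => h j (by omega) (by omega)).mul_right
      (ih fun j h1 h2 => h j (by omega) (by omega))

theorem pairWord_commute {n p : ℕ} (h : ∀ j, p ≤ j → j + 1 < p + 2 * n → Commute y (x j)) :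
    Commute y (pairWord x n p) := by
  induction n generalizing p with
  | zero => exact Commute.one_right y
  | succ n ih =>
    exact (h _ (by omega) (by omega)).mul_right (ih fun j h1 h2 => h j (by omega) (by omega))

end Commute

section Map

variable {B : Type} [Ring B] (f : A →+* B)

theorem map_row (p n : ℕ) : f (row x p n) = row (fun j => f (x j)) p n := by
  induction n with
  | zero => simp [row]
  | succ n ih => simp [row, ih]

theorem map_rowRev (p n : ℕ) : f (rowRev x p n) = rowRev (fun j => f (x j)) p n := by
  induction n with
  | zero => simp [rowRev]
  | succ n ih => simp [rowRev, ih]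

theorem map_capWord (n p : ℕ) : f (capWord x n p) = capWord (fun j => f (x j)) n p := by
  induction n generalizing p with
  | zero => simp [capWord]
  | succ n ih => simp [capWord, ih, map_row]

theorem map_cupWord (n p : ℕ) : f (cupWord x n p) = cupWord (fun j => f (x j)) n p := by
  induction n generalizing p with
  | zero => simp [cupWord]
  | succ n ih => simp [cupWord, ih, map_rowRev]

theorem map_pairWord (n p : ℕ) : f (pairWord x n p) = pairWord (fun j => f (x j)) n p := by
  induction n generalizing p with
  | zero => simp [pairWord]
  | succ n ih => simp [pairWord, ih]

end Map

end Words

namespace IsBMWRepresentation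

variable {A : Type} [Ring A] [Algebra ℂ A] {q μ : ℂ} {m k : ℕ} {σ σ' : ℕ → A}
variable (h : IsBMWRepresentation q μ m σ σ')
include h

theorem sigma_commute {i j : ℕ} (hi : i < m) (hj : j < m) (hij : i + 1 < j ∨ j + 1 < i) :
    Commute (σ i) (σ j) := by
  rcases hij with hij | hij
  · exact h.far i hi j hj hij
  · exact (h.far j hj i hi hij).symm

theorem sigma_commute_kappa {i j : ℕ} (hi : i < m) (hj : j < m) (hij : i + 1 < j ∨ j + 1 < i) :
    Commute (σ i) (kappa q μ (σ j)) :=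
  kappa_commute (h.sigma_commute hi hj hij)

theorem kappa_commute_kappa {i j : ℕ} (hi : i < m) (hj : j < m) (hij : i + 1 < j ∨ j + 1 < i) :
    Commute (kappa q μ (σ i)) (kappa q μ (σ j)) :=
  (kappa_commute (h.sigma_commute_kappa hi hj hij).symm).symm

local notation "ϰ" => fun j => kappa q μ (σ j)

/-- The palindrome of `κ`'s collapses from its centre outwards by `κ_i κ_{i+1} κ_i = κ_i`. -/
theorem row_mul_rowRev_conj {p n : ℕ} (hp : p + n < m) :
    row ϰ p n * kappa q μ (σ (p + n)) * rowRev ϰ p n = kappa q μ (σ p) := by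
  induction n with
  | zero => simp [row, rowRev]
  | succ n ih =>
    have e := h.kappa_kappa_kappa (p + n) (by omega) (p + n + 1) (by omega) (Or.inl rfl)
    rw [← ih (by omega), row, rowRev]
    conv_rhs => rw [← e]
    simp only [mul_assoc, add_assoc]

theorem row_mul_rowRev {p n : ℕ} (hp : p + n < m) :
    row ϰ p (n + 1) * rowRev ϰ p (n + 1) = eta q μ • kappa q μ (σ p) := by
  rw [← h.row_mul_rowRev_conj hp, row, rowRev, ← smul_mul_assoc, ← mul_smul_comm,
    ← h.kappa_sq (p + n) hp]
  simp only [mul_assoc]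

theorem rowRev_mul_row {p n : ℕ} (hp : p + n < m) :
    rowRev ϰ p (n + 1) * row ϰ p (n + 1) = eta q μ • kappa q μ (σ (p + n)) := by
  induction n with
  | zero => simpa [row, rowRev] using h.kappa_sq p hp
  | succ n ih =>
    have e := h.kappa_kappa_kappa (p + n + 1) hp (p + n) (by omega) (Or.inr rfl)
    rw [row, rowRev, mul_assoc, ← mul_assoc (rowRev _ _ _), ih (by omega), smul_mul_assoc,
      mul_smul_comm, ← mul_assoc]
    exact congrArg _ e

theorem kappa_mul_row {p n : ℕ} (hp : p < m) :
    kappa q μ (σ p) * row ϰ p (n + 1) = eta q μ • row ϰ p (n + 1) := by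
  rw [row_succ_left, ← mul_assoc, h.kappa_sq p hp, smul_mul_assoc]

/-- As a diagram, a row of `κ`'s is a cup at one end and a cap at the other with the strands between
them shifted by two places, so crossings slide along it. -/
theorem sigma_mul_row {p n j : ℕ} (hp : p + n ≤ m) (hpj : p ≤ j) (hj : j + 2 < p + n) :
    σ (j + 2) * row ϰ p n = row ϰ p n * σ j := by
  induction n with
  | zero => omega
  | succ n ih =>
    obtain hj' | hj' : j + 2 < p + n ∨ j + 2 = p + n := by omega
    · rw [row, ← mul_assoc, ih (by omega) hj', mul_assoc, mul_assoc,
        (h.sigma_commute_kappa (i := j) (j := p + n) (by omega) (by omega) (by omega)).eq]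
    · obtain ⟨n, rfl⟩ : ∃ n', n = n' + 2 := ⟨n - 2, by omega⟩
      obtain rfl : j = p + n := by omega
      have c1 : Commute (σ (p + n + 2)) (row ϰ p n) := row_commute fun i h1 h2 =>
        h.sigma_commute_kappa (by omega) (by omega) (by omega)
      have c2 := h.sigma_commute_kappa (i := p + n + 2) (j := p + n) (by omega) (by omega) (by omega)
      have c3 := h.sigma_commute_kappa (i := p + n) (j := p + n + 2) (by omega) (by omega) (by omega)
      have e1 := h.inv_mul_kappa (p + n + 2) (by omega) (p + n + 1) (by omega) (Or.inr rfl)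
      have e2 := h.kappa_mul_inv (p + n) (by omega) (p + n + 1) (by omega) (Or.inl rfl)
      -- With the strands renumbered: `σ₂κ₀κ₁κ₂ = κ₀σ₂κ₁κ₂ = κ₀σ₁⁻¹κ₂ = κ₀κ₁σ₀κ₂ = κ₀κ₁κ₂σ₀`.
      have e3 : σ (p + n + 2) * (kappa q μ (σ (p + n)) * kappa q μ (σ (p + n + 1)) *
          kappa q μ (σ (p + n + 2))) = kappa q μ (σ (p + n)) * kappa q μ (σ (p + n + 1)) *
          kappa q μ (σ (p + n + 2)) * σ (p + n) := by
        calc _ = (σ (p + n + 2) * kappa q μ (σ (p + n))) * kappa q μ (σ (p + n + 1)) *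
              kappa q μ (σ (p + n + 2)) := by simp only [mul_assoc]
          _ = kappa q μ (σ (p + n)) * (σ (p + n + 2) * kappa q μ (σ (p + n + 1)) *
              kappa q μ (σ (p + n + 2))) := by rw [c2.eq]; simp only [mul_assoc]
          _ = kappa q μ (σ (p + n)) * σ' (p + n + 1) * kappa q μ (σ (p + n + 2)) := by
              rw [← e1, mul_assoc]
          _ = kappa q μ (σ (p + n)) * kappa q μ (σ (p + n + 1)) *
              (σ (p + n) * kappa q μ (σ (p + n + 2))) := by rw [e2]; simp only [mul_assoc]
          _ = _ := by rw [c3.eq]; simp only [mul_assoc]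
      have e4 : row ϰ p (n + 2 + 1) = row ϰ p n * (kappa q μ (σ (p + n)) *
          kappa q μ (σ (p + n + 1)) * kappa q μ (σ (p + n + 2))) := by
        simp only [row, mul_assoc, add_assoc]
      rw [e4, ← mul_assoc, c1.eq, mul_assoc, e3]
      simp only [mul_assoc]

theorem antisym_mul_row {p n : ℕ} (hp : p + n + 1 ≤ m) :
    antisym q μ (fun j => σ (j + (p + 2))) n * row ϰ p (n + 1) =
      row ϰ p (n + 1) * antisym q μ (fun j => σ (j + p)) n :=
  (antisym_intertwine n fun j hj => by
    have := h.sigma_mul_row (p := p) (n := n + 1) (j := j + p) (by omega) (by omega) (by omega)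
    rw [show j + (p + 2) = j + p + 2 by omega, this]).symm

/-- A crossing of two neighbouring legs on the right of the nested caps slides over the caps to its
mirror position on the left. For the two innermost caps both sides become the inverse generator in
the middle. -/
theorem capWord_mul_sigma {n p i : ℕ} (hp : p + 2 * n ≤ m + 1) (hi : i + 2 ≤ n) :
    capWord ϰ n p * σ (p + n + i) = capWord ϰ n p * σ (p + n - 2 - i) := by
  induction n generalizing p i with
  | zero => omega
  | succ n ih =>
    rw [capWord]
    obtain _ | i := i
    · obtain ⟨n, rfl⟩ : ∃ n', n = n' + 1 := ⟨n - 1, by omega⟩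
      have e4 : row ϰ p (n + 1 + 1) = row ϰ p n * kappa q μ (σ (p + n)) *
          kappa q μ (σ (p + n + 1)) := by
        simp only [row, add_assoc]
      have e5 : row ϰ (p + 2) (n + 1) = row ϰ (p + 2) n * kappa q μ (σ (p + n + 2)) := by
        rw [row, show p + 2 + n = p + n + 2 by omega]
      have c1 : Commute (kappa q μ (σ (p + n + 2))) (row ϰ p n * kappa q μ (σ (p + n))) :=
        (row_commute fun j h1 h2 =>
          h.kappa_commute_kappa (by omega) (by omega) (by omega)).mul_right
          (h.kappa_commute_kappa (by omega) (by omega) (by omega))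
      have e1 := h.kappa_mul_inv (p + n + 2) (by omega) (p + n + 1) (by omega) (Or.inr rfl)
      have e2 := h.kappa_mul_inv (p + n) (by omega) (p + n + 1) (by omega) (Or.inl rfl)
      rw [capWord, e4, e5, show p + (n + 1 + 1) + 0 = p + n + 2 by omega,
        show p + (n + 1 + 1) - 2 - 0 = p + n by omega]
      set κ := kappa q μ (σ (p + n + 2))
      set L := capWord ϰ n (p + 2 + 2) * row ϰ (p + 2) n
      set W := row ϰ p n
      have e6 : κ * W * kappa q μ (σ (p + n)) = W * kappa q μ (σ (p + n)) * κ := by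
        rw [mul_assoc, c1.eq]
      calc _ = L * (κ * W * kappa q μ (σ (p + n))) * kappa q μ (σ (p + n + 1)) *
            σ (p + n + 2) := by simp only [L, mul_assoc]
        _ = L * (W * kappa q μ (σ (p + n))) * (κ * kappa q μ (σ (p + n + 1)) *
            σ (p + n + 2)) := by rw [e6]; simp only [mul_assoc]
        _ = L * (W * kappa q μ (σ (p + n)) * κ) * σ' (p + n + 1) := by
            rw [← e1]; simp only [mul_assoc]
        _ = L * κ * W * (kappa q μ (σ (p + n)) * σ' (p + n + 1)) := by
            rw [← e6]; simp only [mul_assoc]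
        _ = _ := by rw [e2]; simp only [L, mul_assoc]
    · have c1 : Commute (σ (p + (n + 1) + (i + 1))) (row ϰ p (n + 1)) :=
        row_commute fun j h1 h2 => h.sigma_commute_kappa (by omega) (by omega) (by omega)
      have e1 := ih (p := p + 2) (i := i) (by omega) (by omega)
      have e2 := h.sigma_mul_row (p := p) (n := n + 1) (j := p + n - 2 - i) (by omega) (by omega)
        (by omega)
      rw [mul_assoc, ← c1.eq, ← mul_assoc, show p + (n + 1) + (i + 1) = p + 2 + n + i by omega, e1,
        mul_assoc, mul_assoc, show p + 2 + n - 2 - i = p + n - 2 - i + 2 by omega, e2,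
        show p + (n + 1) - 2 - (i + 1) = p + n - 2 - i by omega]

/-- `capWord` has adjacent cups at the top, so each factor of `pairWord` only closes a loop worth
`η`. -/
theorem pairWord_mul_capWord {n p : ℕ} (hp : p + 2 * n ≤ m + 1) :
    pairWord ϰ n p * capWord ϰ n p = eta q μ ^ n • capWord ϰ n p := by
  induction n generalizing p with
  | zero => simp [pairWord, capWord]
  | succ n ih =>
    have c1 : Commute (kappa q μ (σ p)) (capWord ϰ n (p + 2)) :=
      capWord_commute fun j h1 h2 => h.kappa_commute_kappa (by omega) (by omega) (by omega)
    have e1 := ih (p := p + 2) (by omega)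
    rw [pairWord, capWord, mul_assoc, ← mul_assoc (pairWord _ _ _), e1, smul_mul_assoc,
      mul_smul_comm, ← mul_assoc, c1.eq, mul_assoc, h.kappa_mul_row (by omega), mul_smul_comm,
      smul_smul, pow_succ]

section Antisymmetrizer

variable (g : IsGeneric k q μ)
include g

/-- Sliding over the caps reverses the order of the strands, which the antisymmetrizer does not
notice. -/
theorem capWord_mul_antisym {n p : ℕ} (hp : p + 2 * n ≤ m + 1) (hk : n ≤ k) :
    capWord ϰ n p * antisym q μ (fun j => σ (j + (p + n))) n =
      capWord ϰ n p * antisym q μ (fun j => σ (j + p)) n := by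
  obtain _ | n := n
  · simp [antisym]
  have r := (h.shift (p := p) (m' := n) (by omega)).antisym_reverse g (n := n + 1) le_rfl hk
  rw [← r]
  apply mul_antisym_eq
  · intro j hj
    have := h.capWord_mul_sigma (n := n + 1) (p := p) (i := j) hp (by omega)
    rwa [show p + (n + 1) + j = j + (p + (n + 1)) by omega,
      show p + (n + 1) - 2 - j = n + 1 - 2 - j + p by omega] at this
  · intro j hj j' hj'
    exact h.sigma_commute (by omega) (by omega) (by omega)

/-- The innermost cap and cup contract the first strand of the antisymmetrizer by
`kappa_antisym_kappa_left`; the rest of the two rows then collapses to `κ_p`, and the remaining caps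
and cups repeat this with one strand fewer. -/
theorem capWord_antisym_cupWord {n p i : ℕ} (hp : p + 2 * n + i ≤ m + 1) (hi : 1 ≤ i)
    (hk : i + n ≤ k) :
    capWord ϰ n p * antisym q μ (fun j => σ (j + (p + n))) (i + n) * cupWord ϰ n p =
      (∏ j ∈ Finset.range n, sandwichCoeff q μ (i + j)) •
        (pairWord ϰ n p * antisym q μ (fun j => σ (j + (p + 2 * n))) i) := by
  induction n generalizing p with
  | zero => simp [capWord, cupWord, pairWord]
  | succ n ih =>
    have e1 := h.kappa_antisym_kappa_left g (n := i + n) (p := p + n) (by omega) (by omega) (by omega)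
    have c1 : ∀ j, p ≤ j → j < p + n →
        Commute (antisym q μ (fun j => σ (j + (p + n + 2))) (i + n)) (kappa q μ (σ j)) :=
      fun j h1 h2 => (antisym_commute _ fun i' hi' =>
        (h.sigma_commute_kappa (by omega) (by omega) (by omega)).symm).symm
    have c2 : Commute (antisym q μ (fun j => σ (j + (p + n + 2))) (i + n)) (row ϰ p n) :=
      row_commute c1
    have c3 : Commute (kappa q μ (σ p)) (cupWord ϰ n (p + 2)) :=
      cupWord_commute fun j h1 h2 => h.kappa_commute_kappa (by omega) (by omega) (by omega)
    have c4 : Commute (kappa q μ (σ p))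
        (pairWord ϰ n (p + 2) * antisym q μ (fun j => σ (j + (p + 2 + 2 * n))) i) :=
      (pairWord_commute fun j h1 h2 =>
        h.kappa_commute_kappa (by omega) (by omega) (by omega)).mul_right
      (antisym_commute _ fun j hj =>
        (h.sigma_commute_kappa (by omega) (by omega) (by omega)).symm)
    have e2 := ih (p := p + 2) (by omega) (by omega)
    have e3 := h.row_mul_rowRev_conj (p := p) (n := n) (by omega)
    rw [capWord, cupWord, pairWord, row, rowRev, Finset.prod_range_succ,
      show p + 2 * (n + 1) = p + 2 + 2 * n by omega]
    set a := antisym q μ (fun j => σ (j + (p + n + 2))) (i + n) with ha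
    have ha' : antisym q μ (fun j => σ (j + (p + 2 + n))) (i + n) = a := by
      rw [ha, show p + n + 2 = p + 2 + n by omega]
    rw [ha'] at e2
    rw [show p + n + 1 = p + (n + 1) by omega, show i + n + 1 = i + (n + 1) by omega] at e1
    calc _ = capWord ϰ n (p + 2) * (row ϰ p n * (kappa q μ (σ (p + n)) *
          antisym q μ (fun j => σ (j + (p + (n + 1)))) (i + (n + 1)) * kappa q μ (σ (p + n))) *
          rowRev ϰ p n) * cupWord ϰ n (p + 2) := by simp only [mul_assoc]
      _ = sandwichCoeff q μ (i + n) • (capWord ϰ n (p + 2) * ((row ϰ p n * a) *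
          kappa q μ (σ (p + n)) * rowRev ϰ p n) * cupWord ϰ n (p + 2)) := by
          rw [e1]; simp only [mul_smul_comm, smul_mul_assoc, mul_assoc]
      _ = sandwichCoeff q μ (i + n) • (capWord ϰ n (p + 2) * a * ((row ϰ p n *
          kappa q μ (σ (p + n)) * rowRev ϰ p n) * cupWord ϰ n (p + 2))) := by
          rw [← c2.eq]; simp only [mul_assoc]
      _ = sandwichCoeff q μ (i + n) • ((capWord ϰ n (p + 2) * a * cupWord ϰ n (p + 2)) *
          kappa q μ (σ p)) := by rw [e3, c3.eq]; simp only [mul_assoc]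
      _ = _ := by
          rw [e2, smul_mul_assoc, ← c4.eq, smul_smul, mul_comm (sandwichCoeff _ _ _), mul_assoc]

end Antisymmetrizer

end IsBMWRepresentation

/-- The factored form exhibits the only zeros of the coefficient: `z = -qμ` and `q²z = μ²`. -/
theorem sandwichCoeff_factor {q μ z : ℂ} (hq : q ≠ 0) (hμ : μ ≠ 0) (hl : q - q⁻¹ ≠ 0)
    (hd : μ + q * z ≠ 0) :
    eta q μ + (z - 1) / (q - q⁻¹) * μ⁻¹ + μ * (z - 1) / (μ + q * z) =
      (z + q * μ) * (q * z - q⁻¹ * μ ^ 2) / (μ * (q - q⁻¹) * (μ + q * z)) := by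
  have h4 : q ^ 2 - 1 ≠ 0 := fun e => hl (by field_simp; rw [e, mul_zero])
  have h5 : q - q⁻¹ = (q ^ 2 - 1) / q := by field_simp
  rw [eta, h5]
  field_simp
  ring

/-- For `z = q^{-2n}` and `μ = q^{1-2l}` a zero would mean `q^{2(n+1-l)} = -1` or `q^{2(2l-n)} = 1`.
The squared first equation and the second are excluded by genericity up to `2l` when `l ≤ n < 2l`.
This is the range met in contracting `a^(2l)` down to `a^(l)`. -/
theorem IsGeneric.sandwichCoeff_ne {q μ : ℂ} {l n : ℕ} (g : IsGeneric (2 * l) q μ)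
    (hμ : μ = q ^ (1 - ((2 * l : ℕ) : ℤ))) (h1 : l ≤ n) (h2 : n + 1 ≤ 2 * l) :
    sandwichCoeff q μ n ≠ 0 := by
  have hq := g.q_ne
  have hm := g.μ_ne
  have hl := g.lam_ne (by omega)
  have hn := g.qNum_ne (i := n + 1) (by omega) h2
  have hd := g.denom n (by omega) (by omega)
  refine mul_ne_zero (div_ne_zero (pow_ne_zero _ hq) hn) ?_
  rw [sandwichCoeff_factor hq hm hl hd]
  have hz : (q ^ (2 * n))⁻¹ = q ^ (-(2 * n : ℤ)) := by
    rw [zpow_neg]; norm_cast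
  refine div_ne_zero (mul_ne_zero ?_ ?_) (mul_ne_zero (mul_ne_zero hm hl) hd)
  · intro e
    apply g.q_pow (2 * (n + 1 - l)) (by omega) (by omega)
    have e1 : q ^ (2 * (n + 1 - l)) = -1 := by
      rw [hz, hμ, ← zpow_one_add₀ hq] at e
      have e2 : q ^ (1 + (1 - ((2 * l : ℕ) : ℤ))) =
          q ^ (2 * (n + 1 - l)) * q ^ (-(2 * n : ℤ)) := by
        rw [← zpow_natCast, ← zpow_add₀ hq]
        congr 1
        push_cast [Nat.cast_sub (show l ≤ n + 1 by omega)]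
        ring
      rw [e2] at e
      have h3 : q ^ (-(2 * n : ℤ)) ≠ 0 := zpow_ne_zero _ hq
      have : (q ^ (2 * (n + 1 - l)) + 1) * q ^ (-(2 * n : ℤ)) = 0 := by linear_combination e
      exact eq_neg_of_add_eq_zero_left ((mul_eq_zero.mp this).resolve_right h3)
    rw [mul_comm, pow_mul, e1]
    norm_num
  · intro e
    apply g.q_pow (2 * l - n) (by omega) (by omega)
    rw [hz, hμ, ← zpow_one_add₀ hq, ← zpow_natCast (q ^ _), ← zpow_mul, ← zpow_neg_one,
      ← zpow_add₀ hq] at e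
    have h3 : q ^ (-1 + (1 - ((2 * l : ℕ) : ℤ)) * ((2 : ℕ) : ℤ)) ≠ 0 := zpow_ne_zero _ hq
    have e2 : q ^ (1 + -(2 * n : ℤ)) = q ^ (2 * (2 * l - n)) *
        q ^ (-1 + (1 - ((2 * l : ℕ) : ℤ)) * ((2 : ℕ) : ℤ)) := by
      rw [← zpow_natCast, ← zpow_add₀ hq]
      congr 1
      push_cast [Nat.cast_sub (show n ≤ 2 * l by omega)]
      ring
    rw [e2] at e
    refine mul_right_cancel₀ h3 ?_
    rw [one_mul]
    linear_combination e

/-! ### Operators with coefficients in an algebra: extra strands, disjoint factors, partial traces.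
-/

section Framework

variable {N : ℕ} {A : Type} [Ring A] [Algebra ℂ A] {n : ℕ}

theorem sum_snoc {B : Type} [AddCommMonoid B] (f : (Fin (n + 1) → Fin N) → B) :
    ∑ u, f u = ∑ v : Fin n → Fin N, ∑ a : Fin N, f (Fin.snoc v a) := by
  rw [← (Fin.snocEquiv fun _ : Fin (n + 1) => Fin N).sum_comp, Fintype.sum_prod_type,
    Finset.sum_comm]
  rfl

theorem ext_snoc {B : Type} {X Y : Matrix (Fin (n + 1) → Fin N) (Fin (n + 1) → Fin N) B}
    (h : ∀ s a t b, X (Fin.snoc s a) (Fin.snoc t b) = Y (Fin.snoc s a) (Fin.snoc t b)) :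
    X = Y := by
  ext s t
  rw [← Fin.snoc_init_self s, ← Fin.snoc_init_self t]
  exact h _ _ _ _

theorem init_snoc' (v : Fin n → Fin N) (a : Fin N) :
    Fin.init (Fin.snoc v a : Fin (n + 1) → Fin N) = v := Fin.init_snoc _ _

/-! ### Numeric operators -/

variable (A) in
/-- Numeric operators as operators with coefficients in `A`. -/
noncomputable def numHom (N n : ℕ) : Op N n ℂ →ₐ[ℂ] Op N n A := (Algebra.ofId ℂ A).mapMatrix

theorem numHom_apply (X : Op N n ℂ) : numHom A N n X = num A X := rfl

theorem num_apply (X : Op N n ℂ) (s t) : num A X s t = algebraMap ℂ A (X s t) := rfl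

/-- The scalar operator with value `a`. -/
def sc (N n : ℕ) : A →+* Op N n A := Matrix.scalar _

theorem sc_apply (a : A) (s t) : sc N n a s t = if s = t then a else 0 := by
  simp [sc, Matrix.diagonal_apply]

theorem sc_mul_apply (a : A) (X : Op N n A) (s t) : (sc N n a * X) s t = a * X s t := by
  simp [sc]

theorem mul_sc_apply (a : A) (X : Op N n A) (s t) : (X * sc N n a) s t = X s t * a := by
  simp [sc]

theorem sc_commute_num (a : A) (X : Op N n ℂ) : Commute (sc N n a) (num A X) := by
  ext s t
  rw [sc_mul_apply, mul_sc_apply, num_apply]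
  exact (Algebra.commutes _ _).symm

theorem sc_smul (c : ℂ) (a : A) : sc N n (c • a) = c • sc N n a := by
  ext s t
  rw [Matrix.smul_apply, sc_apply, sc_apply]
  split_ifs <;> simp

/-! ### An additional strand at the end -/

/-- The operator `X ⊗ 1`, with one more tensor factor put last. -/
def ext : Op N n A →ₐ[ℂ] Op N (n + 1) A where
  toFun X := Matrix.of fun s t =>
    if s (Fin.last n) = t (Fin.last n) then X (Fin.init s) (Fin.init t) else 0
  map_one' := by
    apply ext_snoc
    intro s a t b
    have : (Fin.snoc s a : Fin (n + 1) → Fin N) = Fin.snoc t b ↔ s = t ∧ a = b :=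
      Fin.snoc_inj
    simp only [Matrix.of_apply, Fin.snoc_last, init_snoc', Matrix.one_apply, this]
    split_ifs <;> simp_all
  map_mul' X Y := by
    apply ext_snoc
    intro s a t b
    simp only [Matrix.mul_apply, Matrix.of_apply, Fin.snoc_last, init_snoc', sum_snoc]
    by_cases h : a = b
    · subst h
      simp
    · rw [if_neg h]
      symm
      refine Finset.sum_eq_zero fun v _ => Finset.sum_eq_zero fun c _ => ?_
      by_cases h1 : a = c
      · subst h1
        rw [if_neg h, mul_zero]
      · rw [if_neg h1, zero_mul]
  map_zero' := by ext; simp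
  map_add' X Y := by
    ext s t
    simp only [Matrix.of_apply, Matrix.add_apply]
    split_ifs <;> simp
  commutes' c := by
    apply ext_snoc
    intro s a t b
    have : (Fin.snoc s a : Fin (n + 1) → Fin N) = Fin.snoc t b ↔ s = t ∧ a = b :=
      Fin.snoc_inj
    simp only [Matrix.of_apply, Fin.snoc_last, init_snoc', Matrix.algebraMap_matrix_apply, this]
    split_ifs <;> simp_all

theorem ext_snoc_apply (X : Op N n A) (s a t b) :
    ext X (Fin.snoc s a) (Fin.snoc t b) = if a = b then X s t else 0 := by
  simp [ext]

theorem ext_num (X : Op N n ℂ) : ext (num A X) = num A (ext X) := by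
  apply ext_snoc
  intro s a t b
  simp only [num_apply, ext_snoc_apply]
  split_ifs <;> simp

theorem ext_sc (a : A) : ext (sc N n a) = sc N (n + 1) a := by
  apply ext_snoc
  intro s c t b
  have : (Fin.snoc s c : Fin (n + 1) → Fin N) = Fin.snoc t b ↔ s = t ∧ c = b := Fin.snoc_inj
  simp only [ext_snoc_apply, sc_apply, this]
  split_ifs <;> simp_all

theorem ext_site1 (X : Matrix (Fin N) (Fin N) A) {i : ℕ} (h : i < n) :
    ext (site1 X n i) = site1 X (n + 1) i := by
  apply ext_snoc
  intro s a t b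
  have e : (∀ j : Fin (n + 1), j.val ≠ i → (Fin.snoc s a : Fin (n + 1) → Fin N) j =
      (Fin.snoc t b : Fin (n + 1) → Fin N) j) ↔ a = b ∧ ∀ j : Fin n, j.val ≠ i → s j = t j := by
    rw [Fin.forall_fin_succ']
    simp only [Fin.val_castSucc, Fin.snoc_castSucc, Fin.val_last, Fin.snoc_last]
    have : n ≠ i := by omega
    tauto
  have h' : i < n + 1 := by omega
  have e1 : (⟨i, h'⟩ : Fin (n + 1)) = Fin.castSucc ⟨i, h⟩ := rfl
  simp only [ext_snoc_apply, site1, Matrix.of_apply, dif_pos h, dif_pos h', e, e1,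
    Fin.snoc_castSucc]
  split_ifs <;> simp_all

theorem ext_site2 (X : Op2 N) {i : ℕ} (h : i + 1 < n) :
    ext (site2 X n i) = site2 X (n + 1) i := by
  apply ext_snoc
  intro s a t b
  have e : (∀ j : Fin (n + 1), j.val ≠ i → j.val ≠ i + 1 →
      (Fin.snoc s a : Fin (n + 1) → Fin N) j = (Fin.snoc t b : Fin (n + 1) → Fin N) j) ↔
      a = b ∧ ∀ j : Fin n, j.val ≠ i → j.val ≠ i + 1 → s j = t j := by
    rw [Fin.forall_fin_succ']
    simp only [Fin.val_castSucc, Fin.snoc_castSucc, Fin.val_last, Fin.snoc_last]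
    have : n ≠ i := by omega
    have : n ≠ i + 1 := by omega
    tauto
  have h' : i + 1 < n + 1 := by omega
  have e1 : (⟨i, by omega⟩ : Fin (n + 1)) = Fin.castSucc ⟨i, by omega⟩ := rfl
  have e2 : (⟨i + 1, h'⟩ : Fin (n + 1)) = Fin.castSucc ⟨i + 1, h⟩ := rfl
  simp only [ext_snoc_apply, site2, Matrix.of_apply, dif_pos h, dif_pos h', e, e1, e2,
    Fin.snoc_castSucc]
  split_ifs <;> simp_all

/-! ### An additional strand at the beginning -/

/-- The operator `1 ⊗ X`, with one more tensor factor put first. -/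
noncomputable def prepend (X : Op N n ℂ) : Op N (n + 1) ℂ :=
  unfold (num (Matrix (Fin N) (Fin N) ℂ) X)

/-- `prepend` as a homomorphism. -/
noncomputable def prependHom (N n : ℕ) : Op N n ℂ →ₐ[ℂ] Op N (n + 1) ℂ where
  toFun X := prepend X
  map_one' := by
    ext s t
    have e : s = t ↔ s 0 = t 0 ∧ Fin.tail s = Fin.tail t :=
      ⟨fun h => by rw [h]; exact ⟨rfl, rfl⟩, fun h => by
        rw [← Fin.cons_self_tail s, ← Fin.cons_self_tail t, h.1, h.2]⟩
    simp only [prepend, unfold, num, Matrix.of_apply, Matrix.map_apply, Matrix.one_apply,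
      Matrix.algebraMap_matrix_apply, e]
    split_ifs <;> simp_all
  map_mul' X Y := by
    rw [prepend, prepend, prepend, ← unfold_mul, ← numHom_apply, ← numHom_apply, ← numHom_apply,
      map_mul]
  map_zero' := by
    ext s t
    simp [prepend, unfold, num]
  map_add' X Y := by
    ext s t
    simp [prepend, unfold, num]
  commutes' c := by
    ext s t
    have e : s = t ↔ s 0 = t 0 ∧ Fin.tail s = Fin.tail t :=
      ⟨fun h => by rw [h]; exact ⟨rfl, rfl⟩, fun h => by
        rw [← Fin.cons_self_tail s, ← Fin.cons_self_tail t, h.1, h.2]⟩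
    simp only [prepend, unfold, num, Matrix.of_apply, Matrix.map_apply,
      Matrix.algebraMap_matrix_apply, e]
    split_ifs <;> simp_all

theorem prependHom_site2 (X : Op2 N) (n i : ℕ) :
    prependHom N n (site2 X n i) = site2 X (n + 1) (i + 1) := unfold_num X n i

/-- Relations between operators on three strands hold on any three consecutive strands. -/
theorem exists_embedding (N : ℕ) {n i : ℕ} (h : i + 2 < n) : ∃ φ : Op N 3 ℂ →+* Op N n ℂ,
    ∀ X : Op2 N, φ (site2 X 3 0) = site2 X n i ∧ φ (site2 X 3 1) = site2 X n (i + 1) := by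
  induction i generalizing n with
  | zero =>
    induction n, h using Nat.le_induction with
    | base => exact ⟨RingHom.id _, fun X => ⟨rfl, rfl⟩⟩
    | succ n hn ih =>
      obtain ⟨φ, hφ⟩ := ih
      refine ⟨(ext (N := N) (A := ℂ) (n := n)).toRingHom.comp φ, fun X => ?_⟩
      rw [← ext_site2 X (show 0 + 1 < n by omega), ← (hφ X).1,
        ← ext_site2 X (show 0 + 1 + 1 < n by omega), ← (hφ X).2]
      exact ⟨rfl, rfl⟩
  | succ i ih =>
    obtain ⟨n, rfl⟩ : ∃ n', n = n' + 1 := ⟨n - 1, by omega⟩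
    obtain ⟨φ, hφ⟩ := ih (n := n) (by omega)
    refine ⟨(prependHom N n).toRingHom.comp φ, fun X => ?_⟩
    rw [← prependHom_site2 X n i, ← prependHom_site2 X n (i + 1), ← (hφ X).1, ← (hφ X).2]
    exact ⟨rfl, rfl⟩

/-! ### Operators acting in disjoint sets of factors -/

/-- `X` acts in the factors belonging to `S` only. -/
structure ActsOn (S : Finset (Fin n)) (X : Op N n A) : Prop where
  eq_zero : ∀ s t, (¬ ∀ j ∉ S, s j = t j) → X s t = 0
  congr : ∀ s t s' t', (∀ j ∉ S, s j = t j) → (∀ j ∉ S, s' j = t' j) → (∀ j ∈ S, s j = s' j) →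
    (∀ j ∈ S, t j = t' j) → X s t = X s' t'

/-- Only one intermediate multi-index contributes: it agrees with `t` on `S` and with `s` off `S`.
-/
theorem mul_apply_of_actsOn {S : Finset (Fin n)} {X Y : Op N n A}
    (hX : ∀ s t, (¬ ∀ j ∉ S, s j = t j) → X s t = 0)
    (hY : ∀ s t, (¬ ∀ j ∈ S, s j = t j) → Y s t = 0) (s t) :
    (X * Y) s t = X s (S.piecewise t s) * Y (S.piecewise t s) t := by
  rw [Matrix.mul_apply]
  refine Finset.sum_eq_single _ (fun u _ hu => ?_) (by simp)
  by_cases h1 : ∀ j ∉ S, s j = u j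
  · rw [hY u t, mul_zero]
    intro h2
    apply hu
    funext j
    by_cases hj : j ∈ S
    · rw [Finset.piecewise_eq_of_mem _ _ _ hj, h2 j hj]
    · rw [Finset.piecewise_eq_of_notMem _ _ _ hj, h1 j hj]
  · rw [hX s u h1, zero_mul]

theorem commute_of_actsOn {S : Finset (Fin n)} {X Y : Op N n A} (hX : ActsOn S X)
    (hY : ActsOn Sᶜ Y) (h : ∀ s t s' t', Commute (X s t) (Y s' t')) : Commute X Y := by
  ext s t
  rw [mul_apply_of_actsOn hX.eq_zero (by simpa using hY.eq_zero),
    mul_apply_of_actsOn (S := Sᶜ) hY.eq_zero (by simpa using hX.eq_zero), (h _ _ _ _).eq]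
  have p1 : ∀ (u v : Fin n → Fin N), ∀ j ∈ S, S.piecewise u v j = u j :=
    fun u v j hj => Finset.piecewise_eq_of_mem _ _ _ hj
  have p2 : ∀ (u v : Fin n → Fin N), ∀ j ∉ S, S.piecewise u v j = v j :=
    fun u v j hj => Finset.piecewise_eq_of_notMem _ _ _ hj
  rw [Finset.piecewise_compl]
  congr 1
  · refine hY.congr _ _ _ _ ?_ ?_ ?_ ?_ <;> intro j hj <;>
      simp only [Finset.mem_compl, not_not] at hj <;> simp_all
  · refine hX.congr _ _ _ _ ?_ ?_ ?_ ?_ <;> intro j hj <;> simp_all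

theorem ActsOn.mono {S T : Finset (Fin n)} {X : Op N n A} (hX : ActsOn S X) (h : S ⊆ T) :
    ActsOn T X where
  eq_zero s t hst := hX.eq_zero s t fun h' => hst fun j hj => h' j fun hj' => hj (h hj')
  congr s t s' t' h1 h2 h3 h4 := by
    by_cases hst : ∀ j ∉ S, s j = t j
    · refine hX.congr _ _ _ _ hst (fun j hj => ?_) (fun j hj => h3 j (h hj)) fun j hj => h4 j (h hj)
      by_cases hj' : j ∈ T
      · rw [← h3 j hj', ← h4 j hj', hst j hj]
      · exact h2 j hj'
    · rw [hX.eq_zero s t hst, hX.eq_zero s' t']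
      intro h'
      apply hst
      intro j hj
      by_cases hj' : j ∈ T
      · rw [h3 j hj', h4 j hj', h' j hj]
      · exact h1 j hj'

/-- The factors `i` and `i + 1`. -/
def pairSet (n i : ℕ) : Finset (Fin n) := Finset.univ.filter fun j => j.val = i ∨ j.val = i + 1

theorem actsOn_num_site2 (X : Op2 N) (n i : ℕ) : ActsOn (pairSet n i) (num A (site2 X n i)) where
  eq_zero s t h := by
    simp only [pairSet, Finset.mem_filter, Finset.mem_univ, true_and, not_or] at h
    rw [num_apply, site2, Matrix.of_apply]
    split_ifs with h1 h2
    · exact absurd (fun j hj => h2 j hj.1 hj.2) h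
    all_goals simp
  congr s t s' t' h1 h2 h3 h4 := by
    simp only [pairSet, Finset.mem_filter, Finset.mem_univ, true_and, not_or] at h1 h2 h3 h4
    rw [num_apply, site2, Matrix.of_apply, num_apply, Matrix.of_apply]
    split_ifs with h
    · rw [h3 ⟨i, by omega⟩ (Or.inl rfl), h3 ⟨i + 1, h⟩ (Or.inr rfl), h4 ⟨i, by omega⟩ (Or.inl rfl),
        h4 ⟨i + 1, h⟩ (Or.inr rfl)]
    · exact absurd (fun j e e' => h2 j ⟨e, e'⟩) ‹_›
    · exact absurd (fun j e e' => h1 j ⟨e, e'⟩) ‹_›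
    · rfl
    · rfl

theorem actsOn_site1 (X : Matrix (Fin N) (Fin N) A) (n : ℕ) :
    ActsOn (Finset.univ.filter fun j : Fin n => j.val = 0) (site1 X n 0) where
  eq_zero s t h := by
    simp only [Finset.mem_filter, Finset.mem_univ, true_and] at h
    rw [site1, Matrix.of_apply]
    split_ifs with h1
    all_goals rfl
  congr s t s' t' h1 h2 h3 h4 := by
    simp only [Finset.mem_filter, Finset.mem_univ, true_and] at h1 h2 h3 h4
    rw [site1, Matrix.of_apply, Matrix.of_apply]
    split_ifs with h
    · rw [h3 ⟨0, h⟩ rfl, h4 ⟨0, h⟩ rfl]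
    · rfl

theorem num_site2_commute (X Y : Op2 N) {n i j : ℕ} (h : i + 1 < j) :
    Commute (num A (site2 X n i)) (num A (site2 Y n j)) := by
  refine commute_of_actsOn (actsOn_num_site2 X n i) ((actsOn_num_site2 Y n j).mono ?_)
    fun _ _ _ _ => Algebra.commutes _ _
  intro k
  simp only [pairSet, Finset.mem_filter, Finset.mem_univ, true_and, Finset.mem_compl]
  omega

theorem num_site2_commute_site1 (X : Op2 N) (M : Matrix (Fin N) (Fin N) A) {n i : ℕ} (h : 1 ≤ i) :
    Commute (num A (site2 X n i)) (site1 M n 0) := by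
  refine commute_of_actsOn (actsOn_num_site2 X n i) ((actsOn_site1 M n).mono ?_)
    fun _ _ _ _ => Algebra.commutes _ _
  intro k
  simp only [pairSet, Finset.mem_filter, Finset.mem_univ, true_and, Finset.mem_compl]
  omega

/-! ### Partial traces -/

section PartialTrace

variable (D : Matrix (Fin N) (Fin N) ℂ)

/-- The partial trace over the last factor, weighted by `D`. -/
def ptr : Op N (n + 1) A →ₗ[ℂ] Op N n A where
  toFun X := Matrix.of fun s t => ∑ a, ∑ b, D b a • X (Fin.snoc s a) (Fin.snoc t b)
  map_add' X Y := by
    ext s t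
    simp [Finset.sum_add_distrib]
  map_smul' c X := by
    ext s t
    simp [Finset.smul_sum, smul_comm c]

theorem ptr_apply (X : Op N (n + 1) A) (s t) :
    ptr D X s t = ∑ a, ∑ b, D b a • X (Fin.snoc s a) (Fin.snoc t b) := rfl

theorem ext_mul_apply (X : Op N n A) (Y : Op N (n + 1) A) (s a t) :
    (ext X * Y) (Fin.snoc s a) t = ∑ u, X s u * Y (Fin.snoc u a) t := by
  simp [Matrix.mul_apply, sum_snoc, ext_snoc_apply]

theorem mul_ext_apply (X : Op N n A) (Y : Op N (n + 1) A) (s t a) :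
    (Y * ext X) s (Fin.snoc t a) = ∑ u, Y s (Fin.snoc u a) * X u t := by
  simp [Matrix.mul_apply, sum_snoc, ext_snoc_apply]

theorem ptr_ext_mul (X : Op N n A) (Y : Op N (n + 1) A) : ptr D (ext X * Y) = X * ptr D Y := by
  ext s t
  simp only [ptr_apply, ext_mul_apply]
  simp only [Matrix.mul_apply, ptr_apply, Finset.smul_sum, Finset.mul_sum,
    mul_smul_comm]
  rw [Finset.sum_comm_cycle]

theorem ptr_mul_ext (X : Op N n A) (Y : Op N (n + 1) A) : ptr D (Y * ext X) = ptr D Y * X := by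
  ext s t
  simp only [ptr_apply, mul_ext_apply]
  simp only [Matrix.mul_apply, ptr_apply, Finset.smul_sum, Finset.sum_mul,
    smul_mul_assoc]
  rw [Finset.sum_comm_cycle]

/-- The trace weighted by `D` in all factors. -/
noncomputable def wtr (X : Op N n A) : A := (num A (tensorPow D n) * X).trace

theorem wtr_eq (X : Op N n A) : wtr D X = ∑ s, ∑ t, tensorPow D n t s • X s t := by
  simp only [wtr, Matrix.trace, Matrix.diag, Matrix.mul_apply, num_apply, ← Algebra.smul_def]
  rw [Finset.sum_comm]

theorem tensorPow_snoc (s : Fin n → Fin N) (a t b) :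
    tensorPow D (n + 1) (Fin.snoc s a) (Fin.snoc t b) = tensorPow D n s t * D a b := by
  simp [tensorPow, Fin.prod_univ_castSucc]

theorem wtr_ptr (X : Op N (n + 1) A) : wtr D (ptr D X) = wtr D X := by
  simp only [wtr_eq, sum_snoc, tensorPow_snoc, ptr_apply, Finset.smul_sum, smul_smul]
  refine Finset.sum_congr rfl fun s _ => ?_
  rw [Finset.sum_comm]

theorem wtr_smul (c : ℂ) (X : Op N n A) : wtr D (c • X) = c • wtr D X := by
  simp [wtr]

theorem wtr_sc_mul (a : A) (X : Op N n A) : wtr D (sc N n a * X) = a * wtr D X := by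
  simp only [wtr_eq, sc_mul_apply, Finset.mul_sum, mul_smul_comm]

theorem wtr_mul_sc (a : A) (X : Op N n A) : wtr D (X * sc N n a) = wtr D X * a := by
  simp only [wtr_eq, mul_sc_apply, Finset.sum_mul, smul_mul_assoc]

theorem trace_num_mul (X : Op N n ℂ) (Y : Op N n A) : (num A X * Y).trace = (Y * num A X).trace := by
  simp only [Matrix.trace, Matrix.diag, Matrix.mul_apply, num_apply]
  rw [Finset.sum_comm]
  simp only [Algebra.commutes]

/-- Cyclicity fails for general operators over a noncommutative `A`, but holds for a numeric `X`,
whose entries are central; commutation with `D ⊗ ⋯ ⊗ D` carries `X` past the weight. -/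
theorem wtr_num_mul {X : Op N n ℂ} (h : Commute (tensorPow D n) X) (Y : Op N n A) :
    wtr D (num A X * Y) = wtr D (Y * num A X) := by
  have e : num A (tensorPow D n) * num A X = num A X * num A (tensorPow D n) := by
    rw [← numHom_apply, ← numHom_apply, ← map_mul, h.eq, map_mul]
  rw [wtr, wtr, ← mul_assoc, e, mul_assoc, trace_num_mul, mul_assoc]

/-- `Y` is obtained from `X` by `k` partial traces over the last `k` of the `n` factors. -/
inductive Ptr (p : ℕ) : ℕ → (n : ℕ) → Op N n A → Op N p A → Prop
  | refl (X : Op N p A) : Ptr p 0 p X X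
  | step {k n : ℕ} {X : Op N (n + 1) A} {Y : Op N p A} :
      Ptr p k n (ptr D X) Y → Ptr p (k + 1) (n + 1) X Y

namespace Ptr

variable {D} {p k : ℕ}

theorem wtr_eq {X : Op N n A} {Y : Op N p A} (h : Ptr D p k n X Y) : wtr D X = wtr D Y := by
  induction h with
  | refl X => rfl
  | step h ih => rw [← ih, wtr_ptr]

theorem add_eq {X : Op N n A} {Y : Op N p A} (h : Ptr D p k n X Y) : n = p + k := by
  induction h with
  | refl X => rfl
  | step h ih => omega

theorem smul {X : Op N n A} {Y : Op N p A} (h : Ptr D p k n X Y) (c : ℂ) :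
    Ptr D p k n (c • X) (c • Y) := by
  induction h with
  | refl X => exact refl _
  | step h ih =>
    refine step ?_
    rwa [map_smul]

/-- The factor is a family `Z`, with a member for each number of strands, because every partial
trace removes one strand; compatibility with `ext` says that the traced strands do not meet it. -/
theorem mul_left {X : Op N n A} {Y : Op N p A} (h : Ptr D p k n X Y)
    (Z : (n : ℕ) → Op N n A) (hZ : ∀ j, p ≤ j → j < n → ext (Z j) = Z (j + 1)) :
    Ptr D p k n (Z n * X) (Z p * Y) := by
  induction h with
  | refl X => exact refl _
  | step h ih =>
    refine step ?_
    rw [← hZ _ (by have := h.add_eq; omega) (by omega), ptr_ext_mul]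
    exact ih fun j h1 h2 => hZ j h1 (by omega)

theorem mul_right {X : Op N n A} {Y : Op N p A} (h : Ptr D p k n X Y)
    (Z : (n : ℕ) → Op N n A) (hZ : ∀ j, p ≤ j → j < n → ext (Z j) = Z (j + 1)) :
    Ptr D p k n (X * Z n) (Y * Z p) := by
  induction h with
  | refl X => exact refl _
  | step h ih =>
    refine step ?_
    rw [← hZ _ (by have := h.add_eq; omega) (by omega), ptr_mul_ext]
    exact ih fun j h1 h2 => hZ j h1 (by omega)

theorem ptr {X : Op N n A} {Y : Op N (p + 1) A} (h : Ptr D (p + 1) k n X Y) :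
    Ptr D p (k + 1) n X (ptr D Y) := by
  induction h with
  | refl X => exact step (refl _)
  | step h ih => exact step ih

theorem exists_of_eq {p k n : ℕ} (hn : n = p + k) (X : Op N n A) : ∃ Y, Ptr D p k n X Y := by
  induction k generalizing n with
  | zero =>
    obtain rfl : n = p := hn
    exact ⟨X, refl X⟩
  | succ k ih =>
    obtain rfl : n = p + k + 1 := hn
    obtain ⟨Y, hY⟩ := ih rfl (QMA.ptr D X)
    exact ⟨Y, step hY⟩

end Ptr

end PartialTrace

end Framework

theorem IsBMWRepresentation.map {A B : Type} [Ring A] [Algebra ℂ A] [Ring B] [Algebra ℂ B]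
    {q μ : ℂ} {m : ℕ} {σ σ' : ℕ → A} (h : IsBMWRepresentation q μ m σ σ') (f : A →ₐ[ℂ] B) :
    IsBMWRepresentation q μ m (fun i => f (σ i)) (fun i => f (σ' i)) where
  mul_inv i hi := by rw [← map_mul, h.mul_inv i hi, map_one]
  inv_mul i hi := by rw [← map_mul, h.inv_mul i hi, map_one]
  braid i hi := by simp only [← map_mul, h.braid i hi]
  far i hi j hj hij := by simp only [← map_mul, h.far i hi j hj hij]
  sigma_kappa i hi := by simp only [← map_mul, ← map_kappa, ← map_smul, h.sigma_kappa i hi]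
  kappa_sigma i hi := by simp only [← map_mul, ← map_kappa, ← map_smul, h.kappa_sigma i hi]
  kappa_mul_sigma i hi j hj hij := by
    simp only [← map_mul, ← map_kappa, h.kappa_mul_sigma i hi j hj hij]
  kappa_mul_inv i hi j hj hij := by
    simp only [← map_mul, ← map_kappa, h.kappa_mul_inv i hi j hj hij]
  sigma_mul_kappa i hi j hj hij := by
    simp only [← map_mul, ← map_kappa, h.sigma_mul_kappa i hi j hj hij]
  inv_mul_kappa i hi j hj hij := by
    simp only [← map_mul, ← map_kappa, h.inv_mul_kappa i hi j hj hij]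
  kappa_kappa_kappa i hi j hj hij := by
    simp only [← map_mul, ← map_kappa, h.kappa_kappa_kappa i hi j hj hij]
  kappa_sq i hi := by simp only [← map_mul, ← map_kappa, ← map_smul, h.kappa_sq i hi]

/-! ### Braid generators over a coefficient algebra, and their matrix entries. -/

section Generators

variable {N : ℕ} {A : Type} [Ring A] [Algebra ℂ A] {n : ℕ}

variable (A) in
/-- The operator `X` acting in the factors `i` and `i + 1`, with coefficients in `A`. -/
noncomputable def gen (X : Op2 N) (n i : ℕ) : Op N n A := num A (site2 X n i)

theorem gen_mul (X Y : Op2 N) (n i : ℕ) : gen A (X * Y) n i = gen A X n i * gen A Y n i := by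
  rw [gen, site2_mul, ← numHom_apply, map_mul]
  rfl

theorem gen_one {i : ℕ} (h : i + 1 < n) : gen A (1 : Op2 N) n i = 1 := by
  rw [gen, site2_one n i h, ← numHom_apply, map_one]

theorem gen_add (X Y : Op2 N) (n i : ℕ) : gen A (X + Y) n i = gen A X n i + gen A Y n i := by
  ext s t
  simp only [gen, num_apply, site2, Matrix.of_apply, Matrix.add_apply]
  split_ifs <;> simp

theorem gen_smul (c : ℂ) (X : Op2 N) (n i : ℕ) : gen A (c • X) n i = c • gen A X n i := by
  ext s t
  simp only [gen, num_apply, site2, Matrix.of_apply, Matrix.smul_apply]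
  split_ifs <;> simp [Algebra.smul_def]

variable (A) in
/-- `gen` as a homomorphism. -/
noncomputable def genHom (N : ℕ) {n i : ℕ} (h : i + 1 < n) : Op2 N →ₐ[ℂ] Op N n A :=
  AlgHom.ofLinearMap
    { toFun := fun X => gen A X n i
      map_add' := fun X Y => gen_add X Y n i
      map_smul' := fun c X => gen_smul c X n i }
    (gen_one h) fun X Y => gen_mul X Y n i

theorem kappa_gen (q μ : ℂ) (X : Op2 N) {i : ℕ} (h : i + 1 < n) :
    kappa q μ (gen A X n i) = gen A (kappa q μ X) n i :=
  (map_kappa (genHom A N h) X).symm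

theorem ext_gen (X : Op2 N) {i : ℕ} (h : i + 1 < n) : ext (gen A X n i) = gen A X (n + 1) i := by
  rw [gen, ext_num, ext_site2 X h]
  rfl

theorem gen_commute (X Y : Op2 N) {i j : ℕ} (h : i + 1 < j ∨ j + 1 < i) :
    Commute (gen A X n i) (gen A Y n j) := by
  rcases h with h | h
  · exact num_site2_commute X Y h
  · exact (num_site2_commute Y X h).symm

theorem gen_relation {X Y Z U V W : Op2 N}
    (h : site2 X 3 1 * site2 Y 3 0 * site2 Z 3 1 = site2 U 3 0 * site2 V 3 1 * site2 W 3 0)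
    {i : ℕ} (hi : i + 2 < n) :
    gen A X n (i + 1) * gen A Y n i * gen A Z n (i + 1) =
      gen A U n i * gen A V n (i + 1) * gen A W n i := by
  obtain ⟨φ, hφ⟩ := exists_embedding N hi
  have := congrArg (fun x => numHom A N n (φ x)) h
  simp only [map_mul, (hφ _).1, (hφ _).2] at this
  exact this

theorem gen_inv_mul {X : Op2 N} (hX : IsUnit X) {i : ℕ} (h : i + 1 < n) :
    gen A X⁻¹ n i * gen A X n i = 1 := by
  rw [← gen_mul, Matrix.nonsing_inv_mul X ((Matrix.isUnit_iff_isUnit_det X).mp hX), gen_one h]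

theorem gen_mul_inv {X : Op2 N} (hX : IsUnit X) {i : ℕ} (h : i + 1 < n) :
    gen A X n i * gen A X⁻¹ n i = 1 := by
  rw [← gen_mul, Matrix.mul_nonsing_inv X ((Matrix.isUnit_iff_isUnit_det X).mp hX), gen_one h]

theorem IsBMWType.gen_rep {q μ : ℂ} {R : Op2 N} (h : IsBMWType q μ R) (m : ℕ) :
    IsBMWRepresentation q μ m (fun i => gen A R (m + 1) i) (fun i => gen A R⁻¹ (m + 1) i) :=
  (h.rep m).map (numHom A N (m + 1))

/-! ### Entries -/

theorem site2_last (X : Op2 N) (s : Fin n → Fin N) (b c t b' c') :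
    site2 X (n + 2) n (Fin.snoc (Fin.snoc s b : Fin (n + 1) → Fin N) c)
      (Fin.snoc (Fin.snoc t b' : Fin (n + 1) → Fin N) c') =
      if s = t then X (b, c) (b', c') else 0 := by
  have e : (∀ j : Fin (n + 2), j.val ≠ n → j.val ≠ n + 1 →
      (Fin.snoc (Fin.snoc s b : Fin (n + 1) → Fin N) c : Fin (n + 2) → Fin N) j =
      (Fin.snoc (Fin.snoc t b' : Fin (n + 1) → Fin N) c' : Fin (n + 2) → Fin N) j) ↔ s = t := by
    rw [Fin.forall_fin_succ', Fin.forall_fin_succ', funext_iff]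
    simp only [Fin.val_castSucc, Fin.snoc_castSucc, Fin.val_last, Fin.snoc_last, ne_eq,
      not_true_eq_false, false_imp_iff, imp_true_iff, and_true]
    exact forall_congr' fun j => ⟨fun h => h (by omega) (by omega), fun h _ _ => h⟩
  have e1 : (⟨n, by omega⟩ : Fin (n + 2)) = Fin.castSucc (Fin.last n) := rfl
  have e2 : (⟨n + 1, by omega⟩ : Fin (n + 2)) = Fin.last (n + 1) := rfl
  simp only [site2, Matrix.of_apply, dif_pos (show n + 1 < n + 2 by omega), e, e1, e2,
    Fin.snoc_castSucc, Fin.snoc_last]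

theorem gen_last_mul_apply (X : Op2 N) (Y : Op N (n + 2) A) (s : Fin n → Fin N) (b c t) :
    (gen A X (n + 2) n * Y) (Fin.snoc (Fin.snoc s b : Fin (n + 1) → Fin N) c) t =
      ∑ b', ∑ c', X (b, c) (b', c') •
        Y (Fin.snoc (Fin.snoc s b' : Fin (n + 1) → Fin N) c') t := by
  simp only [Matrix.mul_apply, sum_snoc, gen, num_apply, site2_last, ← Algebra.smul_def]
  rw [Finset.sum_eq_single s (fun u _ hu => by simp [hu.symm]) (by simp)]
  simp

theorem mul_gen_last_apply (X : Op2 N) (Y : Op N (n + 2) A) (t : Fin n → Fin N) (b c s) :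
    (Y * gen A X (n + 2) n) s (Fin.snoc (Fin.snoc t b : Fin (n + 1) → Fin N) c) =
      ∑ b', ∑ c', X (b', c') (b, c) •
        Y s (Fin.snoc (Fin.snoc t b' : Fin (n + 1) → Fin N) c') := by
  simp only [Matrix.mul_apply, sum_snoc, gen, num_apply, site2_last, Algebra.smul_def,
    Algebra.commutes]
  rw [Finset.sum_eq_single t (fun u _ hu => by simp [hu]) (by simp)]
  simp

theorem ext_ext_mul_gen_last (X : Op2 N) (Y : Op N n A) (s t : Fin n → Fin N) (b c b' c') :
    (ext (ext Y) * gen A X (n + 2) n) (Fin.snoc (Fin.snoc s b : Fin (n + 1) → Fin N) c)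
      (Fin.snoc (Fin.snoc t b' : Fin (n + 1) → Fin N) c') = X (b, c) (b', c') • Y s t := by
  rw [mul_gen_last_apply]
  simp [ext_snoc_apply]

theorem ext_ext_commute_gen_last (X : Op2 N) (Y : Op N n A) :
    Commute (ext (ext Y)) (gen A X (n + 2) n) := by
  apply ext_snoc
  intro s c t c'
  obtain ⟨s, b, rfl⟩ : ∃ s' b, s = Fin.snoc s' b := ⟨_, _, (Fin.snoc_init_self s).symm⟩
  obtain ⟨t, b', rfl⟩ : ∃ s' b, t = Fin.snoc s' b := ⟨_, _, (Fin.snoc_init_self t).symm⟩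
  rw [ext_ext_mul_gen_last, gen_last_mul_apply]
  simp [ext_snoc_apply]

/-- Comparison at one nonzero entry of `X`. With `X = κ` this cancels the noninvertible `κ` from
identities between sandwiches. -/
theorem eq_of_ext_ext_mul_gen_last {X : Op2 N} (hX : X ≠ 0) {Y Z : Op N n A}
    (h : ext (ext Y) * gen A X (n + 2) n = ext (ext Z) * gen A X (n + 2) n) : Y = Z := by
  obtain ⟨⟨b, c⟩, ⟨b', c'⟩, hX⟩ : ∃ x y, X x y ≠ 0 := by
    by_contra! h0
    exact hX (Matrix.ext h0)
  ext s t
  have := congrFun (congrFun h (Fin.snoc (Fin.snoc s b : Fin (n + 1) → Fin N) c))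
    (Fin.snoc (Fin.snoc t b' : Fin (n + 1) → Fin N) c')
  rw [ext_ext_mul_gen_last, ext_ext_mul_gen_last] at this
  exact smul_right_injective A hX this

theorem site2_three_zero (X : Op2 N) (a b c a' b' c' : Fin N) :
    site2 X 3 0 ![a, b, c] ![a', b', c'] = if c = c' then X (a, b) (a', b') else 0 := by
  have e : (∀ j : Fin 3, j.val ≠ 0 → j.val ≠ 0 + 1 →
      (![a, b, c] : Fin 3 → Fin N) j = (![a', b', c'] : Fin 3 → Fin N) j) ↔ c = c' := by
    simp [Fin.forall_fin_succ]
  simp only [site2, Matrix.of_apply, dif_pos (show 0 + 1 < 3 by omega), e]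
  rfl

theorem site2_three_one (X : Op2 N) (a b c a' b' c' : Fin N) :
    site2 X 3 1 ![a, b, c] ![a', b', c'] = if a = a' then X (b, c) (b', c') else 0 := by
  have e : (∀ j : Fin 3, j.val ≠ 1 → j.val ≠ 1 + 1 →
      (![a, b, c] : Fin 3 → Fin N) j = (![a', b', c'] : Fin 3 → Fin N) j) ↔ a = a' := by
    simp [Fin.forall_fin_succ]
  simp only [site2, Matrix.of_apply, dif_pos (show 1 + 1 < 3 by omega), e]
  rfl

theorem sum_three {B : Type} [AddCommMonoid B] (f : (Fin 3 → Fin N) → B) :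
    ∑ u, f u = ∑ a, ∑ b, ∑ c, f ![a, b, c] := by
  rw [sum_snoc, sum_snoc, sum_snoc, Fintype.sum_eq_single Fin.elim0 (fun x h => absurd (Subsingleton.elim _ _) h)]
  refine Finset.sum_congr rfl fun a _ => Finset.sum_congr rfl fun b _ =>
    Finset.sum_congr rfl fun c _ => congrArg f ?_
  funext j
  fin_cases j <;> rfl

theorem site2_one_zero_one (X Y Z : Op2 N) (a b c a' b' c' : Fin N) :
    (site2 X 3 1 * site2 Y 3 0 * site2 Z 3 1) ![a, b, c] ![a', b', c'] =
      ∑ x, ∑ y, ∑ z, X (b, c) (x, z) * Y (a, x) (a', y) * Z (y, z) (b', c') := by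
  simp only [Matrix.mul_apply, sum_three, site2_three_zero, site2_three_one, mul_ite, ite_mul,
    mul_zero, zero_mul, Finset.sum_ite_eq, Finset.sum_ite_eq', Finset.mem_univ, if_true,
    Finset.sum_mul, Finset.sum_ite_irrel, Finset.sum_const_zero]
  exact Finset.sum_comm_cycle

theorem site2_zero_one_zero (X Y Z : Op2 N) (a b c a' b' c' : Fin N) :
    (site2 X 3 0 * site2 Y 3 1 * site2 Z 3 0) ![a, b, c] ![a', b', c'] =
      ∑ x, ∑ y, ∑ z, X (a, b) (z, x) * Y (x, c) (y, c') * Z (z, y) (a', b') := by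
  simp only [Matrix.mul_apply, sum_three, site2_three_zero, site2_three_one, mul_ite, ite_mul,
    mul_zero, zero_mul, Finset.sum_ite_eq, Finset.sum_ite_eq', Finset.mem_univ, if_true,
    Finset.sum_mul, Finset.sum_ite_irrel, Finset.sum_const_zero]
  rw [Finset.sum_comm_cycle]
  exact Finset.sum_congr rfl fun x _ => Finset.sum_comm

theorem skew_apply {R Ψ : Op2 N} (h : traceMiddle (site2 Ψ 3 0 * site2 R 3 1) = perm N)
    (a c a' c' : Fin N) :
    ∑ b, ∑ r, Ψ (a, b) (a', r) * R (r, c) (b, c') = if a = c' ∧ c = a' then 1 else 0 := by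
  have := congrFun (congrFun h (a, c)) (a', c')
  simp only [traceMiddle, perm, Matrix.of_apply] at this
  rw [← this]
  simp only [Matrix.mul_apply, sum_three, site2_three_zero, site2_three_one, mul_ite, ite_mul,
    mul_zero, zero_mul, Finset.sum_ite_eq, Finset.sum_ite_eq', Finset.mem_univ, if_true,
    Finset.sum_ite_irrel, Finset.sum_const_zero]

end Generators

/-! ### The operator `κ` has rank one; its relation to the matrix `D`. -/

theorem num_complex {N n : ℕ} (X : Op N n ℂ) : num ℂ X = X := rfl

theorem kappa_site2 {N n : ℕ} (q μ : ℂ) (X : Op2 N) {i : ℕ} (h : i + 1 < n) :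
    kappa q μ (site2 X n i) = site2 (kappa q μ X) n i :=
  kappa_gen (A := ℂ) q μ X h

/-- A BMW type operator whose `κ` does not vanish, together with its matrix `D`. -/
structure BMWData {N : ℕ} (q μ : ℂ) (R : Op2 N) (D : Matrix (Fin N) (Fin N) ℂ) : Prop where
  bmw : IsBMWType q μ R
  kappa_ne : kappa q μ R ≠ 0
  lam_ne : q - q⁻¹ ≠ 0
  contract : ∀ a b c a' b' c', ∑ p, kappa q μ R (b, c) (a', p) * kappa q μ R (a, p) (b', c') =
    μ⁻¹ * kappa q μ R (b, c) (b', c') * D a a'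

/-- The relation `κ₁ R₀ κ₁ = μ⁻¹ κ₁`, contracted with the skew inverse, which strips off `R`: the
left side becomes the product of two `κ`'s, the right side the trace of `Ψ`. -/
theorem IsBMWType.contract {N : ℕ} {q μ : ℂ} {R Ψ : Op2 N} (h : IsBMWType q μ R)
    (hΨ : IsSkewInverse R Ψ) (a b c a' b' c' : Fin N) :
    ∑ p, kappa q μ R (b, c) (a', p) * kappa q μ R (a, p) (b', c') =
      μ⁻¹ * kappa q μ R (b, c) (b', c') * ∑ x, Ψ (a, x) (a', x) := by
  set K := kappa q μ R
  have e : site2 K 3 1 * site2 R 3 0 * site2 K 3 1 = μ⁻¹ • site2 K 3 1 := by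
    have := (h.rep 2).kappa_sigma_kappa h.μ_ne.1 (i := 1) (j := 0) (by omega) (by omega)
      (Or.inr rfl)
    simpa only [kappa_site2 q μ R (show 1 + 1 < 2 + 1 by omega)] using this
  have e1 : ∀ x x', ∑ y, ∑ y', ∑ z, K (b, c) (y, z) * R (x, y) (x', y') * K (y', z) (b', c') =
      if x = x' then μ⁻¹ * K (b, c) (b', c') else 0 := fun x x' => by
    rw [← site2_one_zero_one, e, Matrix.smul_apply, site2_three_one]
    split_ifs <;> simp
  calc _ = ∑ y, ∑ y', ∑ z, K (b, c) (y, z) * K (y', z) (b', c') *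
        (if a = y' ∧ y = a' then 1 else 0) := by
        simp [ite_and]
    _ = ∑ y, ∑ y', ∑ z, ∑ x', ∑ x, Ψ (a, x') (a', x) *
        (K (b, c) (y, z) * R (x, y) (x', y') * K (y', z) (b', c')) := by
        simp only [← skew_apply hΨ.2 a _ a' _, Finset.mul_sum]
        refine Finset.sum_congr rfl fun y _ => Finset.sum_congr rfl fun y' _ =>
          Finset.sum_congr rfl fun z _ => Finset.sum_congr rfl fun x' _ =>
          Finset.sum_congr rfl fun x _ => by ring
    _ = ∑ x', ∑ x, Ψ (a, x') (a', x) * ∑ y, ∑ y', ∑ z,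
        K (b, c) (y, z) * R (x, y) (x', y') * K (y', z) (b', c') := by
        simp only [Finset.mul_sum]
        simp only [← Fintype.sum_prod_type']
        refine Finset.sum_bij' (fun w _ => (w.2.2.2.1, w.2.2.2.2, w.1, w.2.1, w.2.2.1))
          (fun w _ => (w.2.2.1, w.2.2.2.1, w.2.2.2.2, w.1, w.2.1)) ?_ ?_ ?_ ?_ ?_ <;> simp
    _ = _ := by
        simp only [e1, mul_ite, mul_zero, Finset.sum_ite_eq', Finset.mem_univ, if_true,
          Finset.mul_sum]
        exact Finset.sum_congr rfl fun x _ => mul_comm _ _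

namespace BMWData

variable {N : ℕ} {q μ : ℂ} {R : Op2 N} {D : Matrix (Fin N) (Fin N) ℂ} (d : BMWData q μ R D)
include d

local notation "𝕂" => kappa q μ R

theorem μ_ne : μ ≠ 0 := d.bmw.μ_ne.1

theorem eta_ne : eta q μ ≠ 0 := by
  have h1 := d.bmw.μ_ne
  refine div_ne_zero (mul_ne_zero (sub_ne_zero.mpr h1.2.1.symm) ?_) (mul_ne_zero h1.1 d.lam_ne)
  intro h
  exact h1.2.2 (eq_neg_of_add_eq_zero_right h)

theorem kkk_zero (a b c a' b' c' : Fin N) :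
    ∑ x, ∑ y, ∑ z, 𝕂 (a, b) (z, x) * 𝕂 (x, c) (y, c') * 𝕂 (z, y) (a', b') =
      if c = c' then 𝕂 (a, b) (a', b') else 0 := by
  have := (d.bmw.rep 2).kappa_kappa_kappa 0 (by omega) 1 (by omega) (Or.inl rfl)
  rw [kappa_site2 q μ R (show 0 + 1 < 2 + 1 by omega),
    kappa_site2 q μ R (show 1 + 1 < 2 + 1 by omega)] at this
  rw [← site2_zero_one_zero, this, site2_three_zero]

theorem kkk_one (a b c a' b' c' : Fin N) :
    ∑ x, ∑ y, ∑ z, 𝕂 (b, c) (x, z) * 𝕂 (a, x) (a', y) * 𝕂 (y, z) (b', c') =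
      if a = a' then 𝕂 (b, c) (b', c') else 0 := by
  have := (d.bmw.rep 2).kappa_kappa_kappa 1 (by omega) 0 (by omega) (Or.inr rfl)
  rw [kappa_site2 q μ R (show 0 + 1 < 2 + 1 by omega),
    kappa_site2 q μ R (show 1 + 1 < 2 + 1 by omega)] at this
  rw [← site2_one_zero_one, this, site2_three_one]

theorem kk : 𝕂 * 𝕂 = eta q μ • 𝕂 := by
  have := (d.bmw.rep 2).kappa_sq 0 (by omega)
  rw [kappa_site2 q μ R (show 0 + 1 < 2 + 1 by omega), ← site2_mul] at this
  have h3 : site2 (𝕂 * 𝕂) 3 0 = eta q μ • site2 𝕂 3 0 := this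
  ext ⟨a, b⟩ ⟨a', b'⟩
  have h4 := congrFun (congrFun h3 ![a, b, a]) ![a', b', a]
  rw [Matrix.smul_apply, site2_three_zero, site2_three_zero, if_pos rfl, if_pos rfl] at h4
  rw [Matrix.smul_apply, h4]

theorem exists_ne : ∃ B B', 𝕂 B B' ≠ 0 := by
  by_contra! h
  exact d.kappa_ne (Matrix.ext h)

theorem D_isUnit : IsUnit D := by
  have hμ := d.μ_ne
  rw [← Matrix.mulVec_injective_iff_isUnit]
  refine (injective_iff_map_eq_zero (Matrix.mulVecLin D)).mpr fun v hv => ?_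
  have hv : ∀ a, ∑ a', D a a' * v a' = 0 := fun a => congrFun hv a
  obtain ⟨⟨k1, k2⟩, ⟨k3, k4⟩, hk⟩ := d.exists_ne
  have h1 : ∀ b c a b' c', ∑ p, (∑ a', 𝕂 (b, c) (a', p) * v a') * 𝕂 (a, p) (b', c') = 0 := by
    intro b c a b' c'
    calc _ = ∑ a', (∑ p, 𝕂 (b, c) (a', p) * 𝕂 (a, p) (b', c')) * v a' := by
          simp only [Finset.sum_mul]
          rw [Finset.sum_comm]
          refine Finset.sum_congr rfl fun x _ => Finset.sum_congr rfl fun y _ => by ring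
      _ = μ⁻¹ * 𝕂 (b, c) (b', c') * ∑ a', D a a' * v a' := by
          simp only [d.contract, Finset.mul_sum, mul_assoc]
      _ = 0 := by rw [hv, mul_zero]
  have h2 : ∀ b c p, ∑ a', 𝕂 (b, c) (a', p) * v a' = 0 := by
    intro b c p
    set w : Fin N → ℂ := fun p => ∑ a', 𝕂 (b, c) (a', p) * v a' with hw
    have e : ∑ c, w c * (if c = p then 𝕂 (k1, k2) (k3, k4) else 0) = 0 := by
      calc _ = ∑ x, ∑ y, ∑ z, 𝕂 (k1, k2) (z, x) * (∑ c, w c * 𝕂 (x, c) (y, p)) *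
            𝕂 (z, y) (k3, k4) := by
            simp only [← d.kkk_zero, Finset.mul_sum, Finset.sum_mul]
            rw [Finset.sum_comm]
            refine Finset.sum_congr rfl fun x _ => ?_
            rw [Finset.sum_comm]
            refine Finset.sum_congr rfl fun y _ => ?_
            rw [Finset.sum_comm]
            refine Finset.sum_congr rfl fun z _ => Finset.sum_congr rfl fun c _ => by ring
        _ = 0 := by simp only [hw, h1, mul_zero, zero_mul, Finset.sum_const_zero]
    simp only [mul_ite, mul_zero, Finset.sum_ite_eq', Finset.mem_univ, if_true] at e
    exact (mul_eq_zero.mp e).resolve_right hk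
  funext a
  have e : ∑ a', (if a = a' then 𝕂 (k1, k2) (k3, k4) else 0) * v a' = 0 := by
    calc _ = ∑ x, ∑ y, ∑ z, 𝕂 (k1, k2) (x, z) * (∑ a', 𝕂 (a, x) (a', y) * v a') *
          𝕂 (y, z) (k3, k4) := by
          simp only [← d.kkk_one, Finset.mul_sum, Finset.sum_mul]
          rw [Finset.sum_comm]
          refine Finset.sum_congr rfl fun x _ => ?_
          rw [Finset.sum_comm]
          refine Finset.sum_congr rfl fun y _ => ?_
          rw [Finset.sum_comm]
          refine Finset.sum_congr rfl fun z _ => Finset.sum_congr rfl fun c _ => by ring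
      _ = 0 := by simp only [h2, mul_zero, zero_mul, Finset.sum_const_zero]
  simp only [ite_mul, zero_mul, Finset.sum_ite_eq, Finset.mem_univ, if_true] at e
  exact (mul_eq_zero.mp e).resolve_left hk

/-- Let `X_{ce}` be the column `(c, e)` of `κ`, and `Y` a fixed row, both written as square
matrices. Then `contract` reads `X_{ce} Yᵀ = μ⁻¹ Y_{ce} D`. As `D` is invertible, so is `Yᵀ`, and
all `X_{ce}` are multiples of one matrix. -/
theorem exists_factor : ∃ x y : Matrix (Fin N) (Fin N) ℂ,
    ∀ a b c e, 𝕂 (a, b) (c, e) = x a b * y c e := by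
  obtain ⟨⟨k1, k2⟩, ⟨k3, k4⟩, hk⟩ := d.exists_ne
  have hμ := d.μ_ne
  let X : Fin N → Fin N → Matrix (Fin N) (Fin N) ℂ := fun c e => Matrix.of fun a p => 𝕂 (a, p) (c, e)
  let Y : Matrix (Fin N) (Fin N) ℂ := Matrix.of fun a p => 𝕂 (k1, k2) (a, p)
  have h1 : ∀ c e, X c e * Y.transpose = (μ⁻¹ * Y c e) • D := by
    intro c e
    ext a a'
    rw [Matrix.mul_apply]
    exact (Finset.sum_congr rfl fun p _ => mul_comm _ _).trans (d.contract a k1 k2 a' c e)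
  have hc : μ⁻¹ * Y k3 k4 ≠ 0 := mul_ne_zero (inv_ne_zero hμ) hk
  have h2 : IsUnit (X k3 k4 * Y.transpose) := by
    rw [h1, Matrix.isUnit_iff_isUnit_det, Matrix.det_smul]
    exact ((IsUnit.mk0 _ hc).pow _).mul ((Matrix.isUnit_iff_isUnit_det D).mp d.D_isUnit)
  have h3 : IsUnit Y.transpose := by
    rw [Matrix.isUnit_iff_isUnit_det] at h2 ⊢
    rw [Matrix.det_mul] at h2
    exact isUnit_of_mul_isUnit_right h2
  have h4 : Y.transpose * (Y.transpose)⁻¹ = 1 :=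
    Matrix.mul_nonsing_inv _ ((Matrix.isUnit_iff_isUnit_det _).mp h3)
  refine ⟨μ⁻¹ • (D * (Y.transpose)⁻¹), Y, fun a b c e => ?_⟩
  have h5 : X c e = (μ⁻¹ * Y c e) • (D * (Y.transpose)⁻¹) := by
    rw [← smul_mul_assoc, ← h1, mul_assoc, h4, mul_one]
  have := congrFun (congrFun h5 a) b
  rw [Matrix.smul_apply] at this
  rw [Matrix.smul_apply]
  change 𝕂 (a, b) (c, e) = _ at this
  rw [this, smul_eq_mul, smul_eq_mul]
  ring

theorem rankOne (s t u v : Fin N × Fin N) : 𝕂 s t * 𝕂 u v = 𝕂 s v * 𝕂 u t := by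
  obtain ⟨x, y, h⟩ := d.exists_factor
  obtain ⟨s1, s2⟩ := s
  obtain ⟨t1, t2⟩ := t
  obtain ⟨u1, u2⟩ := u
  obtain ⟨v1, v2⟩ := v
  simp only [h]
  ring

theorem trace_kappa : (𝕂).trace = eta q μ := by
  obtain ⟨B, B', hk⟩ := d.exists_ne
  have := congrFun (congrFun d.kk B) B'
  rw [Matrix.mul_apply, Matrix.smul_apply, smul_eq_mul] at this
  have e : ∑ j, 𝕂 B j * 𝕂 j B' = (𝕂).trace * 𝕂 B B' := by
    rw [Matrix.trace, Finset.sum_mul]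
    refine Finset.sum_congr rfl fun j _ => ?_
    rw [d.rankOne B j j B', mul_comm]
    rfl
  rw [e] at this
  exact mul_right_cancel₀ hk this

/-- Write `κ = x ⊗ y`, so that `D = μ x yᵀ`. The zigzag relation makes `xᵀ` inverse to `yᵀ x y`,
whence `D x Dᵀ = μ² x` and `Dᵀ y D = μ² y`; both sides equal `μ² κ`. -/
theorem D_kappa (a b c e : Fin N) : ∑ p, ∑ r, D a p * D b r * 𝕂 (p, r) (c, e) =
    ∑ p, ∑ r, 𝕂 (a, b) (p, r) * (D p c * D r e) := by
  obtain ⟨x, y, h⟩ := d.exists_factor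
  obtain ⟨⟨k1, k2⟩, ⟨k3, k4⟩, hk⟩ := d.exists_ne
  have hμ := d.μ_ne
  have hD : D = μ • (x * y.transpose) := by
    ext a a'
    have := d.contract a k1 k2 a' k3 k4
    rw [Matrix.smul_apply, Matrix.mul_apply, smul_eq_mul]
    have e : ∑ p, 𝕂 (k1, k2) (a', p) * 𝕂 (a, p) (k3, k4) =
        𝕂 (k1, k2) (k3, k4) * ∑ p, x a p * y.transpose p a' := by
      rw [Finset.mul_sum]
      refine Finset.sum_congr rfl fun p _ => ?_
      simp only [h, Matrix.transpose_apply]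
      ring
    rw [e] at this
    refine mul_left_cancel₀ hk ?_
    rw [mul_left_comm, this]
    field_simp
  have z1 : x.transpose * (y.transpose * x * y) = 1 := by
    ext c c'
    have := d.kkk_zero k1 k2 c k3 k4 c'
    have e : ∑ i, ∑ j, ∑ z, 𝕂 (k1, k2) (z, i) * 𝕂 (i, c) (j, c') * 𝕂 (z, j) (k3, k4) =
        𝕂 (k1, k2) (k3, k4) * (x.transpose * (y.transpose * x * y)) c c' := by
      simp only [Matrix.mul_apply, Finset.mul_sum, Finset.sum_mul, Matrix.transpose_apply, h]
      refine Finset.sum_congr rfl fun i _ => Finset.sum_congr rfl fun j _ =>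
        Finset.sum_congr rfl fun z _ => by ring
    rw [e] at this
    refine mul_left_cancel₀ hk ?_
    rw [this, Matrix.one_apply]
    split_ifs <;> simp
  have z2 : y.transpose * x * y * x.transpose = 1 := mul_eq_one_comm.mp z1
  have z3 : x.transpose * y * x * y.transpose = 1 := by
    have := congrArg Matrix.transpose z2
    simp only [Matrix.transpose_mul, Matrix.transpose_transpose, Matrix.transpose_one] at this
    have h2 := mul_eq_one_comm.mp this
    rw [mul_assoc, mul_assoc, mul_eq_one_comm] at h2
    simpa only [mul_assoc] using h2
  have e1 : D * x * D.transpose = μ ^ 2 • x := by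
    rw [hD]
    simp only [Matrix.transpose_smul, Matrix.transpose_mul, Matrix.transpose_transpose,
      smul_mul_assoc, mul_smul_comm, smul_smul]
    rw [← sq]
    congr 1
    calc _ = x * (y.transpose * x * y * x.transpose) := by simp only [mul_assoc]
      _ = x := by rw [z2, mul_one]
  have e2 : D.transpose * y * D = μ ^ 2 • y := by
    rw [hD]
    simp only [Matrix.transpose_smul, Matrix.transpose_mul, Matrix.transpose_transpose,
      smul_mul_assoc, mul_smul_comm, smul_smul]
    rw [← sq]
    congr 1
    calc _ = y * (x.transpose * y * x * y.transpose) := by simp only [mul_assoc]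
      _ = y := by rw [z3, mul_one]
  have e3 := congrFun (congrFun e1 a) b
  have e4 := congrFun (congrFun e2 c) e
  simp only [Matrix.mul_apply, Matrix.smul_apply, smul_eq_mul, Matrix.transpose_apply,
    Finset.sum_mul] at e3 e4
  calc _ = (∑ r, ∑ p, D a p * x p r * D b r) * y c e := by
        simp only [h, Finset.sum_mul]
        rw [Finset.sum_comm]
        refine Finset.sum_congr rfl fun i _ => Finset.sum_congr rfl fun j _ => by ring
    _ = x a b * (∑ r, ∑ p, D p c * y p r * D r e) := by
        rw [e3, e4]
        ring
    _ = _ := by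
        simp only [h, Finset.mul_sum]
        rw [Finset.sum_comm]
        refine Finset.sum_congr rfl fun i _ => Finset.sum_congr rfl fun j _ => by ring

/-- The tensor power is `D ⊗ D` in the factors `i`, `i + 1`, which commutes with `κ` by `D_kappa`,
times an operator in the other factors. -/
theorem tensorPow_commute {n i : ℕ} (hi : i + 1 < n) :
    Commute (tensorPow D n) (site2 𝕂 n i) := by
  let DD : Op2 N := Matrix.of fun x y => D x.1 y.1 * D x.2 y.2
  let S := pairSet n i
  let Q : Op N n ℂ := Matrix.of fun s t =>
    if ∀ j ∈ S, s j = t j then ∏ j ∈ Sᶜ, D (s j) (t j) else 0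
  have hQ0 : ∀ s t, (¬ ∀ j ∈ S, s j = t j) → Q s t = 0 := fun s t h => if_neg h
  have hQ : ActsOn Sᶜ Q := by
    constructor
    · intro s t h
      exact hQ0 s t (by simpa using h)
    · intro s t s' t' h1 h2 h3 h4
      simp only [Q, Matrix.of_apply]
      rw [if_pos (by simpa using h1), if_pos (by simpa using h2)]
      exact Finset.prod_congr rfl fun j hj => by rw [h3 j hj, h4 j hj]
  have hDD := actsOn_num_site2 (A := ℂ) DD n i
  have hK := actsOn_num_site2 (A := ℂ) 𝕂 n i
  rw [num_complex] at hDD hK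
  have e : tensorPow D n = site2 DD n i * Q := by
    ext s t
    rw [mul_apply_of_actsOn hDD.eq_zero hQ0]
    have h1 : ∀ j ∉ S, s j = S.piecewise t s j := fun j hj => by
      rw [Finset.piecewise_eq_of_notMem _ _ _ hj]
    have h2 : ∀ j ∈ S, S.piecewise t s j = t j := fun j hj => by
      rw [Finset.piecewise_eq_of_mem _ _ _ hj]
    have m1 : (⟨i, by omega⟩ : Fin n) ∈ S := by simp [S, pairSet]
    have m2 : (⟨i + 1, hi⟩ : Fin n) ∈ S := by simp [S, pairSet]
    have hS : S = {⟨i, by omega⟩, ⟨i + 1, hi⟩} := by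
      ext j
      simp [S, pairSet, Fin.ext_iff]
    have hne : (⟨i, by omega⟩ : Fin n) ≠ ⟨i + 1, hi⟩ := by simp
    have e1 : site2 DD n i s (S.piecewise t s) = ∏ j ∈ S, D (s j) (t j) := by
      rw [site2, Matrix.of_apply, dif_pos hi, if_pos, h2 _ m1, h2 _ m2, hS, Finset.prod_pair hne]
      · rfl
      · intro j hj hj'
        exact h1 j (by simp [S, pairSet, hj, hj'])
    have e2 : Q (S.piecewise t s) t = ∏ j ∈ Sᶜ, D (s j) (t j) := by
      simp only [Q, Matrix.of_apply]
      rw [if_pos h2]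
      exact Finset.prod_congr rfl fun j hj => by rw [← h1 j (by simpa using hj)]
    rw [e1, e2, tensorPow, Matrix.of_apply, Finset.prod_mul_prod_compl]
  have hc : DD * 𝕂 = 𝕂 * DD := by
    ext ⟨a, b⟩ ⟨c, e⟩
    simp only [Matrix.mul_apply, Fintype.sum_prod_type]
    exact d.D_kappa a b c e
  have c1 : Commute (site2 DD n i) (site2 𝕂 n i) := by
    rw [commute_iff_eq, ← site2_mul, ← site2_mul, hc]
  rw [e]
  exact c1.mul_left (commute_of_actsOn hK hQ fun _ _ _ _ => mul_comm _ _).symm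

end BMWData

/-! ### Stability of the words under adding a strand. -/

section Congr

variable {A : Type} [Ring A] {x y : ℕ → A}

theorem row_congr {p n : ℕ} (h : ∀ j, p ≤ j → j < p + n → x j = y j) : row x p n = row y p n := by
  induction n with
  | zero => rfl
  | succ n ih => rw [row, row, ih fun j h1 h2 => h j h1 (by omega), h _ (by omega) (by omega)]

theorem rowRev_congr {p n : ℕ} (h : ∀ j, p ≤ j → j < p + n → x j = y j) :
    rowRev x p n = rowRev y p n := by
  induction n with
  | zero => rfl
  | succ n ih => rw [rowRev, rowRev, ih fun j h1 h2 => h j h1 (by omega), h _ (by omega) (by omega)]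

theorem capWord_congr {n p : ℕ} (h : ∀ j, p ≤ j → j + 1 < p + 2 * n → x j = y j) :
    capWord x n p = capWord y n p := by
  induction n generalizing p with
  | zero => rfl
  | succ n ih =>
    rw [capWord, capWord, ih fun j h1 h2 => h j (by omega) (by omega),
      row_congr fun j h1 h2 => h j (by omega) (by omega)]

theorem cupWord_congr {n p : ℕ} (h : ∀ j, p ≤ j → j + 1 < p + 2 * n → x j = y j) :
    cupWord x n p = cupWord y n p := by
  induction n generalizing p with
  | zero => rfl
  | succ n ih =>
    rw [cupWord, cupWord, ih fun j h1 h2 => h j (by omega) (by omega),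
      rowRev_congr fun j h1 h2 => h j (by omega) (by omega)]

theorem pairWord_congr {n p : ℕ} (h : ∀ j, p ≤ j → j + 1 < p + 2 * n → x j = y j) :
    pairWord x n p = pairWord y n p := by
  induction n generalizing p with
  | zero => rfl
  | succ n ih =>
    rw [pairWord, pairWord, ih fun j h1 h2 => h j (by omega) (by omega),
      h p (by omega) (by omega)]

end Congr

section Operators

variable {N : ℕ} (A : Type) [Ring A] [Algebra ℂ A] (q μ : ℂ) (R : Op2 N)

/-- The operator `κ` in the factors `i` and `i + 1`. -/
noncomputable def kapOp (n i : ℕ) : Op N n A := kappa q μ (gen A R n i)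

/-- The antisymmetrizer in the factors `p, …, p + i - 1`. -/
noncomputable def antiOp (n p i : ℕ) : Op N n A := antisym q μ (fun j => gen A R n (j + p)) i

variable {A q μ R}

theorem kapOp_eq {n i : ℕ} (h : i + 1 < n) : kapOp A q μ R n i = gen A (kappa q μ R) n i :=
  kappa_gen q μ R h

theorem ext_kapOp {n i : ℕ} (h : i + 1 < n) : ext (kapOp A q μ R n i) = kapOp A q μ R (n + 1) i := by
  rw [kapOp, map_kappa, ext_gen R h]
  rfl

theorem ext_antiOp {n p i : ℕ} (h : p + i ≤ n) :
    ext (antiOp A q μ R n p i) = antiOp A q μ R (n + 1) p i := by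
  rw [antiOp, map_antisym]
  exact antisym_congr _ fun j hj => ext_gen R (by omega)

theorem antiOp_eq_num (n p i : ℕ) : antiOp A q μ R n p i = num A (antisymOp q μ R n p i) :=
  (map_antisym (numHom A N n) _ i).symm

theorem ext_row_kapOp {n p i : ℕ} (h : p + i < n) :
    ext (row (kapOp A q μ R n) p i) = row (kapOp A q μ R (n + 1)) p i :=
  (map_row (ext (N := N) (A := A) (n := n)).toRingHom p i).trans
    (row_congr fun j h1 h2 => ext_kapOp (by omega))

theorem ext_rowRev_kapOp {n p i : ℕ} (h : p + i < n) :
    ext (rowRev (kapOp A q μ R n) p i) = rowRev (kapOp A q μ R (n + 1)) p i :=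
  (map_rowRev (ext (N := N) (A := A) (n := n)).toRingHom p i).trans
    (rowRev_congr fun j h1 h2 => ext_kapOp (by omega))

theorem ext_capWord_kapOp {n p l : ℕ} (h : p + 2 * l ≤ n) :
    ext (capWord (kapOp A q μ R n) l p) = capWord (kapOp A q μ R (n + 1)) l p :=
  (map_capWord (ext (N := N) (A := A) (n := n)).toRingHom l p).trans
    (capWord_congr fun j h1 h2 => ext_kapOp (by omega))

theorem ext_cupWord_kapOp {n p l : ℕ} (h : p + 2 * l ≤ n) :
    ext (cupWord (kapOp A q μ R n) l p) = cupWord (kapOp A q μ R (n + 1)) l p :=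
  (map_cupWord (ext (N := N) (A := A) (n := n)).toRingHom l p).trans
    (cupWord_congr fun j h1 h2 => ext_kapOp (by omega))

end Operators

/-! ### Partial traces of antisymmetrizers and diagram words. -/

namespace BMWData

variable {N : ℕ} {q μ : ℂ} {R : Op2 N} {D : Matrix (Fin N) (Fin N) ℂ} (d : BMWData q μ R D)
variable {A : Type} [Ring A] [Algebra ℂ A]
include d

local notation "𝕂" => kappa q μ R

theorem rep (n : ℕ) : IsBMWRepresentation q μ (n - 1) (gen A R n) (gen A R⁻¹ n) := by
  obtain _ | n := n
  · constructor <;> intro i hi <;> simp at hi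
  · exact d.bmw.gen_rep n

/-- The entrywise form of `contract`. It turns partial traces into products in the BMW algebra, so
that they can be computed from its relations. -/
theorem sandwich {m : ℕ} (X : Op N (m + 1) A) :
    gen A 𝕂 (m + 2) m * ext X * gen A 𝕂 (m + 2) m =
      μ⁻¹ • (ext (ext (ptr D X)) * gen A 𝕂 (m + 2) m) := by
  apply ext_snoc
  intro s c t c'
  obtain ⟨s, b, rfl⟩ : ∃ s' b, s = Fin.snoc s' b := ⟨_, _, (Fin.snoc_init_self s).symm⟩
  obtain ⟨t, b', rfl⟩ : ∃ s' b, t = Fin.snoc s' b := ⟨_, _, (Fin.snoc_init_self t).symm⟩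
  rw [Matrix.smul_apply, ext_ext_mul_gen_last, mul_gen_last_apply, ptr_apply]
  simp only [gen_last_mul_apply, ext_snoc_apply, smul_ite, smul_zero,
    Finset.sum_ite_eq', Finset.mem_univ, if_true, Finset.smul_sum, smul_smul]
  calc _ = ∑ x, ∑ y, (∑ p, 𝕂 (b, c) (x, p) * 𝕂 (y, p) (b', c')) •
        X (Fin.snoc s x) (Fin.snoc t y) := by
        simp only [Finset.sum_smul]
        rw [Finset.sum_comm_cycle]
        refine Finset.sum_congr rfl fun x _ => Finset.sum_congr rfl fun y _ =>
          Finset.sum_congr rfl fun p _ => by rw [mul_comm]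
    _ = _ := by simp only [d.contract, mul_assoc]

theorem ptr_kapOp (m : ℕ) : ptr D (kapOp A q μ R (m + 2) m) = μ • 1 := by
  have h := (d.rep (A := A) (m + 3)).kappa_kappa_kappa (m + 1) (by omega) m (by omega) (Or.inr rfl)
  have e := d.sandwich (A := A) (m := m + 1) (kapOp A q μ R (m + 2) m)
  have h' : gen A 𝕂 (m + 1 + 2) (m + 1) * ext (kapOp A q μ R (m + 2) m) *
      gen A 𝕂 (m + 1 + 2) (m + 1) = gen A 𝕂 (m + 1 + 2) (m + 1) := by
    rw [ext_kapOp (by omega), ← kapOp_eq (by omega)]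
    exact h
  rw [h'] at e
  refine eq_of_ext_ext_mul_gen_last d.kappa_ne ?_
  rw [map_smul, map_smul, map_one, map_one, smul_mul_assoc, one_mul]
  conv_rhs => rw [e]
  rw [smul_smul, mul_inv_cancel₀ d.μ_ne, one_smul]

theorem ptr_one (m : ℕ) : ptr D (1 : Op N (m + 1) A) = (μ * eta q μ) • 1 := by
  have h := (d.rep (A := A) (m + 2)).kappa_sq m (by omega)
  have e := d.sandwich (A := A) (m := m) 1
  have h' : gen A 𝕂 (m + 2) m * ext 1 * gen A 𝕂 (m + 2) m = eta q μ • gen A 𝕂 (m + 2) m := by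
    rw [map_one, mul_one, ← kapOp_eq (by omega)]
    exact h
  rw [h'] at e
  refine eq_of_ext_ext_mul_gen_last d.kappa_ne ?_
  have e1 : ext (ext ((μ * eta q μ) • (1 : Op N m A))) = (μ * eta q μ) • 1 := by
    rw [map_smul, map_smul, map_one, map_one]
  rw [e1, smul_mul_assoc, one_mul, mul_smul, e, smul_smul, mul_inv_cancel₀ d.μ_ne, one_smul]

/-- By compatibility `F_m F_{m+1}` carries `κ_m` to `κ_{m+1}`, so sandwiching the conjugate of `X`
by `κ_{m+1}` reduces to sandwiching `X` by `κ_m`. This makes the R-trace compatible with passing to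
the next matrix copy. -/
theorem ptr_conj {F : Op2 N} (hF : IsUnit F)
    (ht : site2 R 3 1 * site2 F 3 0 * site2 F 3 1 = site2 F 3 0 * site2 F 3 1 * site2 R 3 0)
    {m : ℕ} (X : Op N (m + 1) A) :
    ptr D (gen A F (m + 2) m * ext X * gen A F⁻¹ (m + 2) m) = ext (ptr D X) := by
  have e := d.sandwich (m := m + 1) (gen A F (m + 2) m * ext X * gen A F⁻¹ (m + 2) m)
  have e0 := congrArg (ext (N := N) (A := A)) (d.sandwich X)
  have cT1 := ext_ext_commute_gen_last F (ext (ptr D X))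
  have cT0 := congrArg (ext (N := N) (A := A)) (ext_ext_commute_gen_last F (ptr D X)).eq
  have cZ := (ext_ext_commute_gen_last F X).eq
  have hF1 := gen_mul_inv (A := A) (n := m + 3) (i := m + 1) hF (by omega)
  have hF1' := gen_inv_mul (A := A) (n := m + 3) (i := m + 1) hF (by omega)
  have hF0 := gen_mul_inv (A := A) (n := m + 3) (i := m) hF (by omega)
  have hF0' := gen_inv_mul (A := A) (n := m + 3) (i := m) hF (by omega)
  have hk := kappa_intertwine (q := q) (μ := μ) (x := gen A F (m + 3) m * gen A F (m + 3) (m + 1))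
    (s := gen A R (m + 3) m) (t := gen A R (m + 3) (m + 1))
    (by rw [← mul_assoc]; exact (gen_relation ht (by omega)).symm)
  rw [kappa_gen q μ R (by omega), kappa_gen q μ R (by omega)] at hk
  refine eq_of_ext_ext_mul_gen_last d.kappa_ne ?_
  simp only [map_mul, map_smul, ext_gen _ (show m + 1 < m + 2 by omega)] at e e0 cT0
  change gen A 𝕂 (m + 3) (m + 1) * (gen A F (m + 3) m * ext (ext X) * gen A F⁻¹ (m + 3) m) *
    gen A 𝕂 (m + 3) (m + 1) = μ⁻¹ • (_ * gen A 𝕂 (m + 3) (m + 1)) at e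
  change gen A 𝕂 (m + 3) m * ext (ext X) * gen A 𝕂 (m + 3) m =
    μ⁻¹ • (_ * gen A 𝕂 (m + 3) m) at e0
  change _ * gen A F (m + 3) m = gen A F (m + 3) m * _ at cT0
  change _ * gen A F (m + 3) (m + 1) = gen A F (m + 3) (m + 1) * _ at cT1
  change _ * gen A F (m + 3) (m + 1) = gen A F (m + 3) (m + 1) * _ at cZ
  change _ * gen A 𝕂 (m + 3) (m + 1) = _ * gen A 𝕂 (m + 3) (m + 1)
  generalize gen A 𝕂 (m + 3) (m + 1) = k1 at *
  generalize gen A 𝕂 (m + 3) m = k0 at *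
  generalize gen A F (m + 3) (m + 1) = f1 at *
  generalize gen A F (m + 3) m = f0 at *
  generalize gen A F⁻¹ (m + 3) (m + 1) = f1' at *
  generalize gen A F⁻¹ (m + 3) m = f0' at *
  set T := ext (ext (ext (ptr D X)))
  set Z := ext (ext X)
  have a1 : k1 * f0 = f0 * f1 * k0 * f1' := by
    rw [hk, mul_assoc, mul_assoc, hF1, mul_one]
  have a2 : f0' * k1 = f1 * k0 * f1' * f0' := by
    calc f0' * k1 = f0' * (k1 * f0) * f0' := by rw [mul_assoc, mul_assoc, hF0, mul_one]
      _ = (f0' * f0) * f1 * k0 * f1' * f0' := by rw [a1]; simp only [mul_assoc]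
      _ = _ := by rw [hF0', one_mul]
  have a3 : k1 * (f0 * Z * f0') * k1 = μ⁻¹ • (T * k1) := by
    calc k1 * (f0 * Z * f0') * k1 = (k1 * f0) * Z * (f0' * k1) := by simp only [mul_assoc]
      _ = f0 * f1 * k0 * f1' * (Z * f1) * k0 * f1' * f0' := by
          rw [a1, a2]; simp only [mul_assoc]
      _ = f0 * f1 * k0 * (f1' * f1) * Z * k0 * f1' * f0' := by rw [cZ]; simp only [mul_assoc]
      _ = f0 * f1 * (k0 * Z * k0) * f1' * f0' := by rw [hF1', mul_one]; simp only [mul_assoc]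
      _ = μ⁻¹ • (f0 * (f1 * T) * k0 * f1' * f0') := by
          rw [e0]; simp only [mul_smul_comm, smul_mul_assoc, mul_assoc]
      _ = μ⁻¹ • (T * (f0 * f1 * k0 * f1') * f0') := by
          rw [← cT1, ← mul_assoc f0, ← cT0]; simp only [mul_assoc]
      _ = μ⁻¹ • (T * k1) := by rw [← a1, mul_assoc, mul_assoc, hF0, mul_one]
  rw [a3] at e
  exact (smul_right_injective _ (inv_ne_zero d.μ_ne) e).symm

section Traces

variable {k : ℕ}

theorem ptr_antiOp (g : IsGeneric k q μ) {p i : ℕ} (hi : 1 ≤ i) (hk : i + 1 ≤ k) :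
    ptr D (antiOp A q μ R (p + i + 1) p (i + 1)) =
      (μ * sandwichCoeff q μ i) • antiOp A q μ R (p + i) p i := by
  have h := ((d.rep (A := A) (p + i + 2)).shift (p := p) (m' := i + 1)
    (by omega)).kappa_antisym_kappa g hi (by omega) hk
  have e := d.sandwich (A := A) (antiOp A q μ R (p + i + 1) p (i + 1))
  refine eq_of_ext_ext_mul_gen_last d.kappa_ne ?_
  rw [mul_smul, map_smul, map_smul, smul_mul_assoc, map_smul, map_smul, smul_mul_assoc,
    ext_antiOp le_rfl, ext_antiOp (by omega)]
  rw [ext_antiOp (by omega)] at e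
  have h' : gen A 𝕂 (p + i + 2) (p + i) * antiOp A q μ R (p + i + 2) p (i + 1) *
      gen A 𝕂 (p + i + 2) (p + i) = sandwichCoeff q μ i •
        (antiOp A q μ R (p + i + 2) p i * gen A 𝕂 (p + i + 2) (p + i)) := by
    rw [← kappa_gen q μ R (by omega)]
    rw [show i + p = p + i from add_comm _ _] at h
    exact h
  rw [← h', e, smul_smul, mul_inv_cancel₀ d.μ_ne, one_smul]

theorem Ptr_antiOp (g : IsGeneric k q μ) {p i : ℕ} (hi : 1 ≤ i) (l : ℕ) (hk : i + l ≤ k) :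
    Ptr D (p + i) l (p + i + l) (antiOp A q μ R (p + i + l) p (i + l))
      ((∏ j ∈ Finset.range l, μ * sandwichCoeff q μ (i + j)) • antiOp A q μ R (p + i) p i) := by
  induction l with
  | zero =>
    rw [Finset.prod_range_zero, one_smul]
    exact Ptr.refl _
  | succ l ih =>
    refine Ptr.step ?_
    have := d.ptr_antiOp (A := A) g (p := p) (i := i + l) (by omega) (by omega)
    rw [← add_assoc] at this
    change Ptr D _ _ _ (ptr D (antiOp A q μ R (p + i + l + 1) p (i + l + 1))) _
    rw [this]
    have h2 := (ih (by omega)).smul (μ * sandwichCoeff q μ (i + l))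
    rwa [smul_smul, mul_comm (μ * sandwichCoeff q μ (i + l)), ← Finset.prod_range_succ] at h2

/-- After the inner caps and cups are traced out, the two outermost rows meet and give `η κ`; one
more partial trace turns `κ` into `μ`. -/
theorem Ptr_cupWord_capWord (l : ℕ) {p p' n : ℕ} (hp : p' = p + l) (hn : n = p + 2 * l) :
    Ptr D p' l n (cupWord (kapOp A q μ R n) l p * capWord (kapOp A q μ R n) l p)
      ((eta q μ * μ) ^ l • 1) := by
  induction l generalizing p p' n with
  | zero =>
    obtain rfl : p' = p := hp
    obtain rfl : n = p' := hn
    simpa [cupWord, capWord] using Ptr.refl 1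
  | succ l ih =>
    obtain rfl := hp
    have h1 := ih (p := p + 2) (p' := p + 2 + l) (n := n) rfl (by omega)
    have h2 := (h1.mul_left (fun n => rowRev (kapOp A q μ R n) p (l + 1))
      fun j h1 h2 => ext_rowRev_kapOp (by omega)).mul_right
        (fun n => row (kapOp A q μ R n) p (l + 1)) fun j h1 h2 => ext_row_kapOp (by omega)
    rw [show p + 2 + l = p + (l + 1) + 1 by omega] at h2
    have h3 := h2.ptr
    rw [cupWord, capWord, mul_assoc, ← mul_assoc (cupWord _ _ _), ← mul_assoc]
    convert h3 using 1
    have e : rowRev (kapOp A q μ R (p + l + 2)) p (l + 1) *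
        row (kapOp A q μ R (p + l + 2)) p (l + 1) =
        eta q μ • kapOp A q μ R (p + l + 2) (p + l) :=
      (d.rep (A := A) (p + l + 2)).rowRev_mul_row (p := p) (n := l) (by omega)
    change _ = ptr D (rowRev (kapOp A q μ R (p + l + 2)) p (l + 1) *
      (eta q μ * μ) ^ l • (1 : Op N (p + l + 2) A) * row (kapOp A q μ R (p + l + 2)) p (l + 1))
    rw [mul_smul_comm, smul_mul_assoc, mul_one, e, map_smul, map_smul, d.ptr_kapOp, smul_smul,
      smul_smul, pow_succ, mul_assoc]

/-- Each `κ` takes two traces: the first yields `μ`, the second, of the identity, yields `μη`. -/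
theorem Ptr_pairWord (l : ℕ) {p n : ℕ} (hn : n = p + 2 * l) :
    Ptr D p (2 * l) n (pairWord (kapOp A q μ R n) l p) ((μ ^ 2 * eta q μ) ^ l • 1) := by
  induction l generalizing p n with
  | zero =>
    obtain rfl : n = p := hn
    simpa [pairWord] using Ptr.refl 1
  | succ l ih =>
    have h1 := ih (p := p + 2) (n := n) (by omega)
    have h2 := (h1.mul_left (fun n => kapOp A q μ R n p)
      fun j h1 h2 => ext_kapOp (by omega)).ptr.ptr
    rw [pairWord]
    change Ptr D p (2 * l + 1 + 1) n _ _
    convert h2 using 1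
    rw [mul_smul_comm, mul_one, map_smul, map_smul, d.ptr_kapOp, map_smul, d.ptr_one, smul_smul,
      smul_smul, pow_succ]
    congr 1
    ring

theorem Ptr_kapOp (p : ℕ) :
    Ptr D p 2 (p + 2) (kapOp A q μ R (p + 2) p) ((μ ^ 2 * eta q μ) • 1) := by
  simpa [pairWord] using d.Ptr_pairWord (A := A) 1 (p := p) rfl

end Traces

end BMWData

/-! ### Ordered products and conjugation. -/

section Row

variable {A : Type} [Ring A] {x y : ℕ → A}

theorem row_add (p a b : ℕ) : row x p (a + b) = row x p a * row x (p + a) b := by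
  induction b with
  | zero => simp [row]
  | succ b ih => rw [← add_assoc, row, ih, row, mul_assoc, add_assoc]

theorem row_mul_rowRev_inv {p n : ℕ} (h : ∀ j, p ≤ j → j < p + n → x j * y j = 1) :
    row x p n * rowRev y p n = 1 := by
  induction n with
  | zero => simp [row, rowRev]
  | succ n ih =>
    rw [row, rowRev, mul_assoc, ← mul_assoc (x _), h _ (by omega) (by omega), one_mul,
      ih fun j h1 h2 => h j h1 (by omega)]

theorem rowRev_mul_row_inv {p n : ℕ} (h : ∀ j, p ≤ j → j < p + n → y j * x j = 1) :
    rowRev y p n * row x p n = 1 := by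
  induction n generalizing p with
  | zero => simp [row, rowRev]
  | succ n ih =>
    have e : rowRev y p (n + 1) = rowRev y (p + 1) n * y p := by
      clear ih h
      induction n with
      | zero => simp [rowRev]
      | succ n ih => rw [rowRev, ih, rowRev, mul_assoc, show p + (n + 1) = p + 1 + n by omega]
    rw [row_succ_left, e, mul_assoc, ← mul_assoc (y _), h _ le_rfl (by omega), one_mul,
      ih fun j h1 h2 => h j (by omega) (by omega)]

theorem mul_row_eq {z : A} {p p' n : ℕ} (h : ∀ i < n, z * x (p + i) = y (p' + i) * z) :
    z * row x p n = row y p' n * z := by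
  induction n with
  | zero => simp [row]
  | succ n ih =>
    rw [row, row, ← mul_assoc, ih fun i hi => h i (by omega), mul_assoc, h n (by omega), mul_assoc]

theorem prod_range_eq_row (n : ℕ) : ((List.range n).map x).prod = row x 0 n := by
  induction n with
  | zero => simp [row]
  | succ n ih => rw [List.range_succ, List.map_append, List.prod_append, ih, row]; simp

theorem commute_conj {u u' z w c : A} (hu : u' * u = 1) (hu' : u * u' = 1) (hz : z * u = u * w)
    (hc : Commute w c) : Commute z (u * c * u') := by
  have e : w * u' = u' * z := by
    calc w * u' = u' * (u * w) * u' := by rw [← mul_assoc, hu, one_mul]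
      _ = u' * z := by rw [← hz, mul_assoc, mul_assoc, hu', mul_one]
  calc z * (u * c * u') = (z * u) * c * u' := by simp only [mul_assoc]
    _ = u * (w * c) * u' := by rw [hz]; simp only [mul_assoc]
    _ = u * c * (w * u') := by rw [hc.eq]; simp only [mul_assoc]
    _ = _ := by rw [e]; simp only [mul_assoc]

end Row

/-- The data of a quantum matrix `M` with entries in `A`. -/
structure QMData {N : ℕ} {A : Type} [Ring A] [Algebra ℂ A] (R F : Op2 N)
    (M : Matrix (Fin N) (Fin N) A) : Prop where
  F_isUnit : IsUnit F
  braid : site2 F 3 0 * site2 F 3 1 * site2 F 3 0 = site2 F 3 1 * site2 F 3 0 * site2 F 3 1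
  twist₁ : site2 R 3 0 * site2 F 3 1 * site2 F 3 0 = site2 F 3 1 * site2 F 3 0 * site2 R 3 1
  twist₂ : site2 R 3 1 * site2 F 3 0 * site2 F 3 1 = site2 F 3 0 * site2 F 3 1 * site2 R 3 0
  rel : qmLeft R F M = qmRight R F M

/-! ### Copies of the quantum matrix and their products with words. -/

section Copies

variable {N : ℕ} {A : Type} [Ring A] [Algebra ℂ A] {R F : Op2 N}
variable {M : Matrix (Fin N) (Fin N) A} {n : ℕ}

theorem copy_succ (i : ℕ) :
    copy F M n (i + 1) = gen A F n i * copy F M n i * gen A F⁻¹ n i := rfl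

theorem ext_copy {i : ℕ} (h : i < n) : ext (copy F M n i) = copy F M (n + 1) i := by
  induction i with
  | zero => exact ext_site1 M h
  | succ i ih => rw [copy_succ, copy_succ, map_mul, map_mul, ih (by omega), ext_gen F h,
      ext_gen F⁻¹ h]

theorem gen_commute_copy (X : Op2 N) {i j : ℕ} (h : i < j) :
    Commute (gen A X n j) (copy F M n i) := by
  induction i with
  | zero => exact num_site2_commute_site1 X M h
  | succ i ih =>
    rw [copy_succ]
    exact ((gen_commute X F (Or.inr (by omega))).mul_right (ih (by omega))).mul_right
      (gen_commute X F⁻¹ (Or.inr (by omega)))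

theorem ext_row_copy {p k : ℕ} (h : p + k ≤ n) :
    ext (row (copy F M n) p k) = row (copy F M (n + 1)) p k :=
  (map_row (ext (N := N) (A := A) (n := n)).toRingHom p k).trans
    (row_congr fun j h1 h2 => ext_copy (by omega))

theorem ext_row_gen (X : Op2 N) {p k : ℕ} (h : p + k < n) :
    ext (row (gen A X n) p k) = row (gen A X (n + 1)) p k :=
  (map_row (ext (N := N) (A := A) (n := n)).toRingHom p k).trans
    (row_congr fun j h1 h2 => ext_gen X (by omega))

theorem ext_rowRev_gen (X : Op2 N) {p k : ℕ} (h : p + k < n) :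
    ext (rowRev (gen A X n) p k) = rowRev (gen A X (n + 1)) p k :=
  (map_rowRev (ext (N := N) (A := A) (n := n)).toRingHom p k).trans
    (rowRev_congr fun j h1 h2 => ext_gen X (by omega))

theorem string_eq : string F M n = row (copy F M n) 0 n := prod_range_eq_row n

namespace QMData

variable (h : QMData R F M)
include h

theorem gen_mul_copy {i : ℕ} (hi : i + 1 < n) :
    gen A F n i * copy F M n i = copy F M n (i + 1) * gen A F n i := by
  rw [copy_succ, mul_assoc, gen_inv_mul h.F_isUnit hi, mul_one]

/-- Copy `j + 2` is copy `j` conjugated by `F_{j+1} F_j`, which carries `X_{j+1}` to `X_j`; and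
`X_{j+1}` commutes with copy `j`. Later copies only add conjugations by distant `F`'s. -/
theorem gen_commute_copy_right {X : Op2 N}
    (hX : site2 X 3 0 * site2 F 3 1 * site2 F 3 0 = site2 F 3 1 * site2 F 3 0 * site2 X 3 1)
    {i j : ℕ} (hi : i < n) (hj : j + 1 < i) : Commute (gen A X n j) (copy F M n i) := by
  obtain ⟨i, rfl⟩ : ∃ i', i = j + 2 + i' := ⟨i - (j + 2), by omega⟩
  clear hj
  induction i with
  | zero =>
    have e := gen_relation (A := A) hX.symm hi
    have c1 : Commute (gen A X n (j + 1)) (copy F M n j) := gen_commute_copy X (by omega)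
    have h1 := gen_mul_inv (A := A) (n := n) (i := j) h.F_isUnit (by omega)
    have h2 := gen_mul_inv (A := A) (n := n) (i := j + 1) h.F_isUnit (by omega)
    have h3 := gen_inv_mul (A := A) (n := n) (i := j) h.F_isUnit (by omega)
    have h4 := gen_inv_mul (A := A) (n := n) (i := j + 1) h.F_isUnit (by omega)
    have := commute_conj (u := gen A F n (j + 1) * gen A F n j)
      (u' := gen A F⁻¹ n j * gen A F⁻¹ n (j + 1))
      (by rw [mul_assoc, ← mul_assoc _ _ (gen A F n j), h4, one_mul, h3])
      (by rw [mul_assoc, ← mul_assoc _ _ (gen A F⁻¹ n (j + 1)), h1, one_mul, h2])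
      (by rw [← mul_assoc]; exact e.symm) c1
    simpa only [add_zero, copy_succ, mul_assoc] using this
  | succ i ih =>
    rw [← add_assoc, copy_succ]
    exact ((gen_commute X F (Or.inl (by omega))).mul_right (ih (by omega))).mul_right
      (gen_commute X F⁻¹ (Or.inl (by omega)))

/-- Only the letter `F_j` of the row moves copy `j` to copy `j + 1`; the letters after it commute
with copy `j`, those before it with copy `j + 1`. Thus a row of `F`'s shifts strings of copies by
one place. -/
theorem row_mul_copy {p k j : ℕ} (hk : p + k < n) (hj : p ≤ j) (hj' : j < p + k) :
    row (gen A F n) p k * copy F M n j = copy F M n (j + 1) * row (gen A F n) p k := by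
  obtain ⟨a, rfl⟩ : ∃ a, j = p + a := ⟨j - p, by omega⟩
  obtain ⟨b, rfl⟩ : ∃ b, k = a + 1 + b := ⟨k - (a + 1), by omega⟩
  have c1 : Commute (copy F M n (p + a)) (row (gen A F n) (p + (a + 1)) b) :=
    row_commute fun i h1 h2 => (gen_commute_copy F (by omega)).symm
  have c2 : Commute (copy F M n (p + a + 1)) (row (gen A F n) p a) :=
    row_commute fun i h1 h2 => (h.gen_commute_copy_right h.braid (by omega) (by omega)).symm
  rw [row_add, mul_assoc, ← c1.eq, row, ← mul_assoc, mul_assoc _ _ (copy F M n (p + a)),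
    h.gen_mul_copy (by omega), ← mul_assoc, ← c2.eq]
  simp only [mul_assoc]

theorem row_mul_gen {p k j : ℕ} (hk : p + k < n) (hj : p ≤ j) (hj' : j + 1 < p + k) :
    row (gen A F n) p k * gen A R n j = gen A R n (j + 1) * row (gen A F n) p k := by
  obtain ⟨a, rfl⟩ : ∃ a, j = p + a := ⟨j - p, by omega⟩
  obtain ⟨b, rfl⟩ : ∃ b, k = a + 2 + b := ⟨k - (a + 2), by omega⟩
  have c1 : Commute (gen A R n (p + a)) (row (gen A F n) (p + (a + 2)) b) :=
    row_commute fun i h1 h2 => gen_commute R F (by omega)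
  have c2 : Commute (gen A R n (p + a + 1)) (row (gen A F n) p a) :=
    row_commute fun i h1 h2 => gen_commute R F (by omega)
  have e := gen_relation (A := A) h.twist₂ (n := n) (i := p + a) (by omega)
  have e4 : row (gen A F n) p (a + 2) =
      row (gen A F n) p a * (gen A F n (p + a) * gen A F n (p + a + 1)) := by
    rw [row, row, mul_assoc, add_assoc]
  rw [row_add, mul_assoc, ← c1.eq, e4, ← mul_assoc, mul_assoc _ _ (gen A R n (p + a)), ← e,
    mul_assoc (gen A R n (p + a + 1)), ← mul_assoc _ (gen A R n (p + a + 1)), ← c2.eq]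
  simp only [mul_assoc]

theorem row_mul_row_copy {p k : ℕ} (hk : p + k < n) :
    row (gen A F n) p k * row (copy F M n) p k =
      row (copy F M n) (p + 1) k * row (gen A F n) p k :=
  mul_row_eq fun i hi => by
    rw [h.row_mul_copy hk (by omega) (by omega), show p + 1 + i = p + i + 1 by omega]

theorem row_mul_rowRev {p k : ℕ} (hk : p + k < n) :
    row (gen A F n) p k * rowRev (gen A F⁻¹ n) p k = 1 :=
  row_mul_rowRev_inv fun _ _ _ => gen_mul_inv h.F_isUnit (by omega)

theorem rowRev_mul_row {p k : ℕ} (hk : p + k < n) :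
    rowRev (gen A F⁻¹ n) p k * row (gen A F n) p k = 1 :=
  rowRev_mul_row_inv fun _ _ _ => gen_inv_mul h.F_isUnit (by omega)

/-- The defining relation is the case `i = 0`; conjugation by `F_i F_{i+1}` shifts it to the next
pair. -/
theorem gen_commute_copies {i : ℕ} (hi : i + 1 < n) :
    Commute (gen A R n i) (copy F M n i * copy F M n (i + 1)) := by
  induction i with
  | zero =>
    induction n, hi using Nat.le_induction with
    | base => exact h.rel
    | succ n hn ih =>
      have := congrArg (ext (N := N) (A := A)) ih.eq
      simp only [map_mul, ext_copy (show 0 < n by omega), ext_copy (show 0 + 1 < n by omega),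
        ext_gen R hn] at this
      exact this
  | succ i ih =>
    have e := gen_relation (A := A) h.twist₂ (n := n) (i := i) (by omega)
    have hi' : i + 2 < n := by omega
    have e1 : row (gen A F n) i 2 * (copy F M n i * copy F M n (i + 1)) =
        copy F M n (i + 1) * copy F M n (i + 1 + 1) * row (gen A F n) i 2 := by
      rw [← mul_assoc, h.row_mul_copy hi' le_rfl (by omega), mul_assoc,
        h.row_mul_copy hi' (by omega) (by omega), mul_assoc]
    have := commute_conj (h.rowRev_mul_row hi') (h.row_mul_rowRev hi')
      (h.row_mul_gen hi' le_rfl (by omega)).symm (ih (by omega))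
    rwa [e1, mul_assoc, h.row_mul_rowRev hi', mul_one] at this

theorem gen_commute_string {j k : ℕ} (hj : j + 1 < k) (hk : k ≤ n) :
    Commute (gen A R n j) (row (copy F M n) 0 k) := by
  obtain ⟨b, rfl⟩ : ∃ b, k = j + 2 + b := ⟨k - (j + 2), by omega⟩
  have e4 : row (copy F M n) 0 (j + 2) =
      row (copy F M n) 0 j * (copy F M n j * copy F M n (j + 1)) := by
    rw [row, row, mul_assoc, zero_add, zero_add]
  rw [row_add, e4]
  refine ((row_commute fun i h1 h2 => ?_).mul_right (h.gen_commute_copies (by omega))).mul_right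
    (row_commute fun i h1 h2 => ?_)
  · exact gen_commute_copy R (by omega)
  · exact h.gen_commute_copy_right h.twist₁ (by omega) (by omega)

end QMData

/-! ### Words in the braid generators -/

/-- A family of operators in `k` consecutive factors, expressed through the braid generators. -/
structure IsWord (R : Op2 N) (k : ℕ) (w : (n p : ℕ) → Op N n ℂ) : Prop where
  ext : ∀ {n p}, p + k ≤ n → ext (w n p) = w (n + 1) p
  prepend : ∀ {n p}, p + k ≤ n → prepend (w n p) = w (n + 1) (p + 1)
  intertwine : ∀ {B : Type} [Ring B] [Algebra ℂ B] {n p p' : ℕ} (y : Op N n B),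
    (p + k ≤ n) → (p' + k ≤ n) →
    (∀ j, j + 1 < k → y * gen B R n (j + p) = gen B R n (j + p') * y) →
      y * num B (w n p) = num B (w n p') * y

/-- A word of rank one, not nilpotent. -/
structure IsRankOneWord (R : Op2 N) (k : ℕ) (w : (n p : ℕ) → Op N n ℂ) : Prop
    extends IsWord R k w where
  rankOne : ∀ s t u v, w k 0 s t * w k 0 u v = w k 0 s v * w k 0 u t
  trace_ne : (w k 0).trace ≠ 0

variable {k : ℕ} {w : (n p : ℕ) → Op N n ℂ}

theorem IsWord.commute (hw : IsWord R k w) {p : ℕ} (hp : p + k ≤ n) {y : Op N n A}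
    (hy : ∀ j, p ≤ j → j + 1 < p + k → Commute y (gen A R n j)) :
    Commute y (num A (w n p)) :=
  hw.intertwine y hp hp fun j hj => hy _ (by omega) (by omega)

theorem IsWord.ext_num (hw : IsWord R k w) {p : ℕ} (hp : p + k ≤ n) :
    QMA.ext (num A (w n p)) = num A (w (n + 1) p) := by
  rw [QMA.ext_num, hw.ext hp]

variable (F M) in
/-- The coefficient of `w` in `M₁ ⋯ M_k w`. -/
noncomputable def wordCoeff (k : ℕ) (w : (n p : ℕ) → Op N n ℂ) : A :=
  ((w k 0).trace)⁻¹ • (row (copy F M k) 0 k * num A (w k 0)).trace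

theorem IsRankOneWord.mul_self (hw : IsRankOneWord R k w) :
    w k 0 * w k 0 = (w k 0).trace • w k 0 := by
  ext s t
  rw [Matrix.mul_apply, Matrix.smul_apply, smul_eq_mul, Matrix.trace, Finset.sum_mul]
  exact Finset.sum_congr rfl fun u _ => by rw [hw.rankOne s u u t, mul_comm]; rfl

theorem IsRankOneWord.num_mul_num (hw : IsRankOneWord R k w) (X : Op N k A) :
    num A (w k 0) * X * num A (w k 0) = sc N k (X * num A (w k 0)).trace * num A (w k 0) := by
  ext s t
  rw [sc_mul_apply]
  simp only [Matrix.trace, Matrix.diag, Matrix.mul_apply, Finset.sum_mul, num_apply]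
  rw [Finset.sum_comm]
  refine Finset.sum_congr rfl fun u _ => Finset.sum_congr rfl fun v _ => ?_
  rw [Algebra.commutes, mul_assoc, ← map_mul, mul_assoc, ← map_mul, mul_comm (w k 0 v u),
    hw.rankOne]

namespace QMData

variable (h : QMData R F M)
include h

theorem string_commute (hw : IsWord R k w) (hk : k ≤ n) :
    Commute (row (copy F M n) 0 k) (num A (w n 0)) :=
  hw.commute (by omega) fun j _ hj => (h.gen_commute_string (by omega) hk).symm

/-- The string `S` commutes with `w` and `w² = tr(w) w`, so `S w` is proportional to `w S w`, and
for `w` of rank one this is a coefficient times `w`. -/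
theorem string_mul_word (hw : IsRankOneWord R k w) :
    row (copy F M k) 0 k * num A (w k 0) = sc N k (wordCoeff F M k w) * num A (w k 0) := by
  have e1 : num A (w k 0) * num A (w k 0) = (w k 0).trace • num A (w k 0) := by
    rw [← numHom_apply, ← map_mul, hw.mul_self, map_smul]
  have e2 := hw.num_mul_num (row (copy F M k) 0 k)
  rw [← (h.string_commute hw.toIsWord le_rfl).eq, mul_assoc, e1, mul_smul_comm] at e2
  rw [wordCoeff, sc_smul, smul_mul_assoc, ← e2, smul_smul, inv_mul_cancel₀ hw.trace_ne, one_smul]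

/-- The row of `F`'s shifts the string and the word together and commutes with the scalar, so the
coefficient does not depend on the position. -/
theorem row_copy_mul_word (hw : IsRankOneWord R k w) {p : ℕ} (hp : p + k ≤ n) :
    row (copy F M n) p k * num A (w n p) = sc N n (wordCoeff F M k w) * num A (w n p) := by
  induction p with
  | zero =>
    rw [zero_add] at hp
    induction n, hp using Nat.le_induction with
    | base => exact h.string_mul_word hw
    | succ n hn ih =>
      have := congrArg (QMA.ext (N := N) (A := A)) ih
      rwa [map_mul, map_mul, ext_row_copy (by omega), hw.ext_num (by omega), ext_sc] at this
  | succ p ih =>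
    have e := congrArg (row (gen A F n) p k * ·) (ih (by omega))
    have e1 := hw.intertwine (row (gen A F n) p k) (p := p) (p' := p + 1) (by omega) hp
      fun j hj => by
        rw [h.row_mul_gen (by omega) (by omega) (by omega), show j + p + 1 = j + (p + 1) by omega]
    have c : Commute (sc N n (wordCoeff F M k w)) (row (gen A F n) p k) :=
      row_commute fun j _ _ => sc_commute_num _ _
    simp only [← mul_assoc, h.row_mul_row_copy (show p + k < n by omega), ← c.eq] at e
    rw [mul_assoc, e1, mul_assoc _ _ (num A (w n p)), e1] at e
    have e2 := congrArg (· * rowRev (gen A F⁻¹ n) p k) e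
    simpa only [mul_assoc, h.row_mul_rowRev (show p + k < n by omega), mul_one] using e2

variable {q μ : ℂ} {D : Matrix (Fin N) (Fin N) ℂ} (d : BMWData q μ R D)
include d

theorem Ptr_shift {p k n : ℕ} {X : Op N n A} {Y : Op N p A} (hX : Ptr D p k n X Y) :
    Ptr D (p + 1) k (n + 1)
      (row (gen A F (n + 1)) p k * ext X * rowRev (gen A F⁻¹ (n + 1)) p k) (ext Y) := by
  induction hX with
  | refl X => simpa [row, rowRev] using Ptr.refl _
  | @step k n X Y hX ih =>
    refine Ptr.step ?_
    obtain rfl := hX.add_eq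
    have e : row (gen A F (p + k + 1 + 1)) p (k + 1) * ext X *
        rowRev (gen A F⁻¹ (p + k + 1 + 1)) p (k + 1) = ext (row (gen A F (p + k + 1)) p k) *
        (gen A F (p + k + 2) (p + k) * ext X * gen A F⁻¹ (p + k + 2) (p + k)) *
        ext (rowRev (gen A F⁻¹ (p + k + 1)) p k) := by
      rw [ext_row_gen F (by omega), ext_rowRev_gen F⁻¹ (by omega), row, rowRev]
      simp only [mul_assoc]
    rw [e, ptr_mul_ext, ptr_ext_mul, d.ptr_conj h.F_isUnit h.twist₂]
    exact ih

/-- A shift by one place conjugates the traced operator by a row of `F`'s, and by `Ptr_shift` this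
only adds a strand to the result. So the trace over shifted copies is the same scalar wherever they
stand, with no rank condition on the word. -/
theorem Ptr_row_copy_word (hw : IsWord R k w) (p : ℕ) {n : ℕ} (hn : n = p + k) :
    Ptr D p k n (row (copy F M n) p k * num A (w n p))
      (sc N p (wtr D (row (copy F M k) 0 k * num A (w k 0)))) := by
  induction p generalizing n with
  | zero =>
    obtain rfl : n = k := by omega
    obtain ⟨Y, hY⟩ := Ptr.exists_of_eq (D := D) (show n = 0 + n by omega)
      (row (copy F M n) 0 n * num A (w n 0))
    -- On zero strands there is a single multi-index, so every operator is scalar.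
    have : Y = sc N 0 (wtr D Y) := by
      ext s t
      rw [sc_apply, if_pos (Subsingleton.elim _ _), wtr_eq]
      simp [tensorPow, Subsingleton.elim t s, Unique.eq_default s]
    rw [hY.wtr_eq, ← this]
    exact hY
  | succ p ih =>
    obtain rfl : n = p + k + 1 := by omega
    have h1 := h.Ptr_shift d (ih rfl)
    rw [ext_sc, map_mul, ext_row_copy le_rfl, hw.ext_num le_rfl, ← mul_assoc,
      h.row_mul_row_copy (by omega), mul_assoc (row (copy F M _) _ _),
      hw.intertwine (row (gen A F (p + k + 1)) p k) (p := p) (p' := p + 1) (by omega) (by omega)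
        (fun j hj => by
          rw [h.row_mul_gen (by omega) (by omega) (by omega),
            show j + p + 1 = j + (p + 1) by omega]), mul_assoc, mul_assoc,
      h.row_mul_rowRev (by omega), mul_one] at h1
    exact h1

end QMData

end Copies

/-! ### Separating the first tensor factor from the others. -/

section FirstFactor

variable {N : ℕ} {A : Type} [Ring A] [Algebra ℂ A] {n : ℕ}

theorem sum_cons {B : Type} [AddCommMonoid B] (f : (Fin (n + 1) → Fin N) → B) :
    ∑ u, f u = ∑ a : Fin N, ∑ v : Fin n → Fin N, f (Fin.cons a v) := by
  rw [← (Fin.consEquiv fun _ : Fin (n + 1) => Fin N).sum_comp, Fintype.sum_prod_type]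
  rfl

theorem ext_cons {B : Type} {X Y : Matrix (Fin (n + 1) → Fin N) (Fin (n + 1) → Fin N) B}
    (h : ∀ a s b t, X (Fin.cons a s) (Fin.cons b t) = Y (Fin.cons a s) (Fin.cons b t)) :
    X = Y := by
  ext s t
  rw [← Fin.cons_self_tail s, ← Fin.cons_self_tail t]
  exact h _ _ _ _

theorem site1_cons (Y : Matrix (Fin N) (Fin N) A) (a b : Fin N) (s t : Fin n → Fin N) :
    site1 Y (n + 1) 0 (Fin.cons a s) (Fin.cons b t) = if s = t then Y a b else 0 := by
  have e : (∀ j : Fin (n + 1), j.val ≠ 0 → (Fin.cons a s : Fin (n + 1) → Fin N) j =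
      (Fin.cons b t : Fin (n + 1) → Fin N) j) ↔ s = t := by
    rw [Fin.forall_fin_succ, funext_iff]
    simp
  simp only [site1, Matrix.of_apply, dif_pos (Nat.succ_pos n), e]
  rfl

theorem prepend_cons (W : Op N n ℂ) (a b : Fin N) (s t : Fin n → Fin N) :
    prepend W (Fin.cons a s) (Fin.cons b t) = if a = b then W s t else 0 := by
  simp [prepend, unfold, num, Matrix.algebraMap_matrix_apply]

theorem site1_mul_num_prepend (Y : Matrix (Fin N) (Fin N) A) (W : Op N n ℂ) (a b : Fin N)
    (s t : Fin n → Fin N) :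
    (site1 Y (n + 1) 0 * num A (prepend W)) (Fin.cons a s) (Fin.cons b t) = W s t • Y a b := by
  rw [Matrix.mul_apply, sum_cons, Finset.sum_comm]
  simp only [site1_cons, num_apply, prepend_cons, ite_mul, zero_mul]
  rw [Finset.sum_eq_single s (fun u _ hu => by simp [hu.symm]) (by simp),
    Finset.sum_eq_single b (fun u _ hu => by simp [hu]) (by simp), if_pos rfl, if_pos rfl,
    ← Algebra.commutes, Algebra.smul_def]

/-- The two factors act on different strands, so a nonzero entry of `W` suffices to cancel it. -/
theorem eq_of_site1_mul_num_prepend {W : Op N n ℂ} (hW : W ≠ 0) {Y Z : Matrix (Fin N) (Fin N) A}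
    (h : site1 Y (n + 1) 0 * num A (prepend W) = site1 Z (n + 1) 0 * num A (prepend W)) :
    Y = Z := by
  obtain ⟨s, t, hW⟩ : ∃ x y, W x y ≠ 0 := by
    by_contra! h0
    exact hW (Matrix.ext h0)
  ext a b
  have := congrFun (congrFun h (Fin.cons a s)) (Fin.cons b t)
  rw [site1_mul_num_prepend, site1_mul_num_prepend] at this
  exact smul_right_injective A hW this

theorem site1_mul (Y Z : Matrix (Fin N) (Fin N) A) :
    site1 (Y * Z) (n + 1) 0 = site1 Y (n + 1) 0 * site1 Z (n + 1) 0 := by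
  apply ext_cons
  intro a s b t
  rw [Matrix.mul_apply, sum_cons, site1_cons]
  by_cases h : s = t
  · subst h
    simp [site1_cons, Matrix.mul_apply]
  · rw [if_neg h]
    symm
    refine Finset.sum_eq_zero fun x _ => Finset.sum_eq_zero fun u _ => ?_
    by_cases hu : s = u
    · subst hu
      simp [site1_cons, h]
    · simp [site1_cons, hu]

theorem site1_scalar (a : A) : site1 (Matrix.scalar (Fin N) a) (n + 1) 0 = sc N (n + 1) a := by
  apply ext_cons
  intro b s c t
  have : (Fin.cons b s : Fin (n + 1) → Fin N) = Fin.cons c t ↔ b = c ∧ s = t := Fin.cons_inj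
  simp only [site1_cons, sc_apply, Matrix.scalar_apply, Matrix.diagonal_apply, this]
  split_ifs <;> simp_all

theorem site1_zero : site1 (0 : Matrix (Fin N) (Fin N) A) (n + 1) 0 = 0 := by
  apply ext_cons
  intro b s c t
  simp [site1_cons]

theorem num_site1 (Y : Matrix (Fin N) (Fin N) ℂ) :
    num A (site1 Y n 0) = site1 (Y.map (algebraMap ℂ A)) n 0 :=
  site1_map (Algebra.ofId ℂ A) Y n 0

theorem unfold_sc (O : Matrix (Fin N) (Fin N) ℂ) : unfold (sc N n O) = site1 O (n + 1) 0 := by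
  apply ext_cons
  intro a s b t
  simp only [unfold, Matrix.of_apply, Fin.tail_cons, Fin.cons_zero, sc_apply, site1_cons]
  split_ifs <;> rfl

/-- `unfold` as a homomorphism. -/
def unfoldHom (N n : ℕ) : Op N n (Matrix (Fin N) (Fin N) ℂ) →+* Op N (n + 1) ℂ where
  toFun X := unfold X
  map_one' := by
    have := map_one (prependHom N n)
    rwa [show prependHom N n 1 = unfold 1 from congrArg unfold (map_one (numHom _ N n))] at this
  map_mul' X Y := unfold_mul X Y
  map_zero' := by ext s t; simp [unfold]
  map_add' X Y := by ext s t; simp [unfold]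

theorem unfold_site1_blockMatrix (X : Op2 N) (n : ℕ) :
    unfold (site1 (blockMatrix X) (n + 1) 0) = site2 X (n + 2) 0 := by
  ext s t
  have e1 : (∀ j : Fin (n + 1), j.val ≠ 0 → Fin.tail s j = Fin.tail t j) ↔
      ∀ j : Fin n, s j.succ.succ = t j.succ.succ := by
    simp [Fin.forall_fin_succ, Fin.tail]
  have e2 : (∀ j : Fin (n + 2), j.val ≠ 0 → j.val ≠ 0 + 1 → s j = t j) ↔
      ∀ j : Fin n, s j.succ.succ = t j.succ.succ := by
    simp [Fin.forall_fin_succ]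
  simp only [unfold, site1, site2, Matrix.of_apply, dif_pos (Nat.succ_pos n),
    dif_pos (show 0 + 1 < n + 2 by omega), e1, e2]
  by_cases h : ∀ j : Fin n, s j.succ.succ = t j.succ.succ
  · rw [if_pos h, if_pos h]
    rfl
  · rw [if_neg h, if_neg h]
    rfl

end FirstFactor

/-! ### The words `κ` and `a^(k)`. -/

section Words

variable {N : ℕ} {q μ : ℂ} {R : Op2 N} {D : Matrix (Fin N) (Fin N) ℂ}

theorem isWord_kappa : IsWord R 2 (fun n p => kappa q μ (site2 R n p)) where
  ext {n p} hp := by rw [map_kappa, ext_site2 R (by omega)]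
  prepend {n p} hp := (map_kappa (prependHom N n) _).trans (by rw [prependHom_site2])
  intertwine {B} _ _ {n p p'} y _ _ hy := by
    have e : ∀ p, num B (kappa q μ (site2 R n p)) = kappa q μ (gen B R n p) :=
      fun p => map_kappa (numHom B N n) _
    rw [e, e]
    exact kappa_intertwine (by simpa using hy 0 (by omega))

theorem isWord_antisym (k : ℕ) : IsWord R k (fun n p => antisymOp q μ R n p k) where
  ext {n p} hp := ext_antiOp (A := ℂ) hp
  prepend {n p} hp := by
    refine (map_antisym (prependHom N n) _ k).trans ?_
    exact antisym_congr _ fun j hj => prependHom_site2 R n (j + p)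
  intertwine {B} _ _ {n p p'} y _ _ hy := by
    rw [← antiOp_eq_num, ← antiOp_eq_num]
    exact antisym_intertwine k hy

theorem site2_two_zero (X : Op2 N) (s t : Fin 2 → Fin N) :
    site2 X 2 0 s t = X (s 0, s 1) (t 0, t 1) := by
  have : ∀ j : Fin 2, j.val ≠ 0 → j.val ≠ 0 + 1 → s j = t j := by
    intro j h1 h2
    omega
  simp only [site2, Matrix.of_apply, dif_pos (show 0 + 1 < 2 by omega), if_pos this]
  rfl

theorem BMWData.trace_kappa_site2 (d : BMWData q μ R D) :
    (kappa q μ (site2 R 2 0)).trace = eta q μ := by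
  rw [kappa_site2 q μ R (show 0 + 1 < 2 by omega), ← d.trace_kappa]
  simp only [Matrix.trace, Matrix.diag, site2_two_zero]
  exact Fintype.sum_equiv (finTwoArrowEquiv (Fin N)) _ _ fun s => rfl

theorem BMWData.isRankOneWord (d : BMWData q μ R D) :
    IsRankOneWord R 2 (fun n p => kappa q μ (site2 R n p)) where
  toIsWord := isWord_kappa
  rankOne s t u v := by
    simp only [kappa_site2 q μ R (show 0 + 1 < 2 by omega), site2_two_zero]
    exact d.rankOne _ _ _ _
  trace_ne := by
    rw [d.trace_kappa_site2]
    exact d.eta_ne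

theorem exists_factor_of_rank_eq_one {m : Type} [Fintype m] [DecidableEq m] {W : Matrix m m ℂ}
    (hW : W.rank = 1) : ∃ v c : m → ℂ, ∀ s t, W s t = v s * c t := by
  obtain ⟨⟨v, hv⟩, -, h⟩ := finrank_eq_one_iff'.mp hW
  have h1 : ∀ t, ∃ c : ℂ, ∀ s, W s t = v s * c := by
    intro t
    obtain ⟨c, hc⟩ := h ⟨W.mulVecLin (Pi.single t 1), LinearMap.mem_range_self _ _⟩
    refine ⟨c, fun s => ?_⟩
    have := congrFun (congrArg Subtype.val hc) s
    simp only [Matrix.mulVecLin_apply, Matrix.mulVec_single_one] at this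
    rw [mul_comm]
    exact this.symm
  choose c hc using h1
  exact ⟨v, c, fun s t => hc t s⟩

/-- A rank-one matrix of trace zero has square zero, which an idempotent of rank one cannot have; so
the trace is nonzero. -/
theorem isRankOneWord_antisym (d : BMWData q μ R D) {k : ℕ} (g : IsGeneric k q μ)
    (hr : (antisymOp q μ R k 0 k).rank = 1) :
    IsRankOneWord R k (fun n p => antisymOp q μ R n p k) := by
  obtain ⟨v, c, h⟩ := exists_factor_of_rank_eq_one hr
  refine { toIsWord := isWord_antisym k, rankOne := fun s t u v => ?_, trace_ne := fun h0 => ?_ }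
  · simp only [h]
    ring
  · have hI : antisymOp q μ R k 0 k * antisymOp q μ R k 0 k = antisymOp q μ R k 0 k :=
      (d.rep (A := ℂ) k).antisym_mul_self g (n := k) (by omega) le_rfl
    have h1 : antisymOp q μ R k 0 k = 0 := by
      rw [← hI]
      ext s t
      have : ∑ u, v u * c u = 0 := by
        rw [← h0]
        simp [Matrix.trace, h]
      rw [Matrix.mul_apply, Matrix.zero_apply]
      calc _ = v s * c t * ∑ u, v u * c u := by
            simp only [h, Finset.mul_sum]
            exact Finset.sum_congr rfl fun u _ => by ring
        _ = 0 := by rw [this, mul_zero]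
    rw [h1, Matrix.rank_zero] at hr
    exact zero_ne_one hr

end Words

/-! ### Exchange of a word coefficient with the quantum matrix; the string in the representations.
-/

section Permutation

variable {N : ℕ} {A : Type} [Ring A] [Algebra ℂ A] {R F X : Op2 N} {n k : ℕ}
variable {M : Matrix (Fin N) (Fin N) A} {w : (n p : ℕ) → Op N n ℂ}

theorem row_gen_mul_gen
    (ht : site2 R 3 1 * site2 X 3 0 * site2 X 3 1 = site2 X 3 0 * site2 X 3 1 * site2 R 3 0)
    {p k j : ℕ} (hk : p + k < n) (hj : p ≤ j) (hj' : j + 1 < p + k) :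
    row (gen A X n) p k * gen A R n j = gen A R n (j + 1) * row (gen A X n) p k := by
  obtain ⟨a, rfl⟩ : ∃ a, j = p + a := ⟨j - p, by omega⟩
  obtain ⟨b, rfl⟩ : ∃ b, k = a + 2 + b := ⟨k - (a + 2), by omega⟩
  have c1 : Commute (gen A R n (p + a)) (row (gen A X n) (p + (a + 2)) b) :=
    row_commute fun i h1 h2 => gen_commute R X (by omega)
  have c2 : Commute (gen A R n (p + a + 1)) (row (gen A X n) p a) :=
    row_commute fun i h1 h2 => gen_commute R X (by omega)
  have e := gen_relation (A := A) ht (n := n) (i := p + a) (by omega)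
  have e4 : row (gen A X n) p (a + 2) =
      row (gen A X n) p a * (gen A X n (p + a) * gen A X n (p + a + 1)) := by
    rw [row, row, mul_assoc, add_assoc]
  rw [row_add, mul_assoc, ← c1.eq, e4, ← mul_assoc, mul_assoc _ _ (gen A R n (p + a)), ← e,
    mul_assoc (gen A R n (p + a + 1)), ← mul_assoc _ (gen A R n (p + a + 1)), ← c2.eq]
  simp only [mul_assoc]

theorem copy_mul_rowRev (hF : IsUnit F) {k : ℕ} (hk : k < n) :
    copy F M n k * rowRev (gen A F n) 0 k = rowRev (gen A F n) 0 k * copy F M n 0 := by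
  induction k with
  | zero => simp [rowRev]
  | succ k ih =>
    rw [rowRev, zero_add, copy_succ, mul_assoc, ← mul_assoc (gen A F⁻¹ n k),
      gen_inv_mul hF hk, one_mul, mul_assoc, ih (by omega), mul_assoc]

/-- The relation between a word of rank one and the quantum matrix, before extraction of the
coefficients. -/
theorem QMData.copy_zero_word (h : QMData R F M) (hw : IsRankOneWord R k w)
    (hX : site2 R 3 1 * site2 X 3 0 * site2 X 3 1 = site2 X 3 0 * site2 X 3 1 * site2 R 3 0)
    (hXS : ∀ j < k, Commute (gen A X (k + 1) j) (row (copy F M (k + 1)) 0 (k + 1))) :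
    copy F M (k + 1) 0 * sc N (k + 1) (wordCoeff F M k w) * num A (w (k + 1) 1) *
      (row (gen A X (k + 1)) 0 k * rowRev (gen A F (k + 1)) 0 k) =
    sc N (k + 1) (wordCoeff F M k w) * num A (w (k + 1) 1) *
      (row (gen A X (k + 1)) 0 k * rowRev (gen A F (k + 1)) 0 k) * copy F M (k + 1) 0 := by
  have e0 := h.row_copy_mul_word hw (n := k + 1) (p := 0) (by omega)
  have e1 := h.row_copy_mul_word hw (n := k + 1) (p := 1) (by omega)
  have s0 : row (copy F M (k + 1)) 0 (k + 1) =
      row (copy F M (k + 1)) 0 k * copy F M (k + 1) k := by rw [row, zero_add]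
  have s1 : row (copy F M (k + 1)) 0 (k + 1) =
      copy F M (k + 1) 0 * row (copy F M (k + 1)) 1 k := row_succ_left 0 k
  have cP : Commute (row (copy F M (k + 1)) 0 (k + 1)) (row (gen A X (k + 1)) 0 k) :=
    row_commute fun j _ hj => (hXS j (by omega)).symm
  have cw : Commute (copy F M (k + 1) k) (num A (w (k + 1) 0)) :=
    hw.commute (by omega) fun j _ hj =>
      (h.gen_commute_copy_right h.twist₁ (by omega) (by omega)).symm
  have cs : Commute (sc N (k + 1) (wordCoeff F M k w)) (row (gen A X (k + 1)) 0 k) :=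
    row_commute fun j _ _ => sc_commute_num _ _
  have iP := hw.intertwine (row (gen A X (k + 1)) 0 k) (p := 0) (p' := 1) (by omega) (by omega)
    fun j hj => row_gen_mul_gen hX (by omega) (by omega) (by omega)
  have iΦ := copy_mul_rowRev (M := M) h.F_isUnit (show k < k + 1 by omega)
  set S := row (copy F M (k + 1)) 0 (k + 1)
  set P := row (gen A X (k + 1)) 0 k
  set Φ := rowRev (gen A F (k + 1)) 0 k
  set Δ := sc N (k + 1) (wordCoeff F M k w)
  -- `S` is read both as the first copy times the rest and as the first `k` copies times the last.
  -- `P` commutes with `S` and carries the word from position 0 to position 1, while `Φ` carries the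
  -- last copy to the first.
  have es : S * num A (w (k + 1) 1) = copy F M (k + 1) 0 * (Δ * num A (w (k + 1) 1)) := by
    rw [s1, mul_assoc, e1]
  calc _ = S * num A (w (k + 1) 1) * P * Φ := by
        rw [es]
        simp only [mul_assoc]
    _ = S * P * num A (w (k + 1) 0) * Φ := by rw [mul_assoc S, ← iP]; simp only [mul_assoc]
    _ = P * (row (copy F M (k + 1)) 0 k * (copy F M (k + 1) k * num A (w (k + 1) 0))) * Φ := by
        rw [cP.eq, s0]; simp only [mul_assoc]
    _ = P * (row (copy F M (k + 1)) 0 k * num A (w (k + 1) 0)) * (copy F M (k + 1) k * Φ) := by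
        rw [cw.eq]; simp only [mul_assoc]
    _ = (P * Δ) * num A (w (k + 1) 0) * Φ * copy F M (k + 1) 0 := by
        rw [e0, iΦ]; simp only [mul_assoc]
    _ = Δ * (P * num A (w (k + 1) 0)) * Φ * copy F M (k + 1) 0 := by
        rw [← cs.eq]; simp only [mul_assoc]
    _ = _ := by rw [iP]; simp only [mul_assoc]

theorem rowRev_mul_unfold_copy (hF : IsUnit F)
    (hb : site2 F 3 0 * site2 F 3 1 * site2 F 3 0 = site2 F 3 1 * site2 F 3 0 * site2 F 3 1)
    (hX : site2 X 3 1 * site2 F 3 0 * site2 F 3 1 = site2 F 3 0 * site2 F 3 1 * site2 X 3 0)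
    {i : ℕ} (hi : i < n) :
    rowRev (site2 F (n + 1)) 0 i * unfold (copy F (blockMatrix (X * F)) n i) =
      site2 X (n + 1) i * site2 F (n + 1) i * rowRev (site2 F (n + 1)) 0 i := by
  induction i with
  | zero =>
    obtain ⟨n, rfl⟩ : ∃ n', n = n' + 1 := ⟨n - 1, by omega⟩
    rw [copy, unfold_site1_blockMatrix, site2_mul]
    simp [rowRev]
  | succ i ih =>
    have c1 : Commute (site2 F (n + 1) (i + 1)) (rowRev (site2 F (n + 1)) 0 i) :=
      rowRev_commute fun j h1 h2 => gen_commute (A := ℂ) F F (Or.inr (by omega))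
    have b1 : site2 X (n + 1) (i + 1) * site2 F (n + 1) i * site2 F (n + 1) (i + 1) =
        site2 F (n + 1) i * site2 F (n + 1) (i + 1) * site2 X (n + 1) i :=
      gen_relation (A := ℂ) hX (by omega)
    have b2 : site2 F (n + 1) (i + 1) * site2 F (n + 1) i * site2 F (n + 1) (i + 1) =
        site2 F (n + 1) i * site2 F (n + 1) (i + 1) * site2 F (n + 1) i :=
      gen_relation (A := ℂ) hb.symm (by omega)
    have b3 : site2 F (n + 1) (i + 1) * site2 F⁻¹ (n + 1) (i + 1) = 1 :=
      gen_mul_inv (A := ℂ) hF (by omega)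
    rw [copy, unfold_mul, unfold_mul, unfold_num, unfold_num, rowRev, zero_add]
    have ih := ih (by omega)
    set f1 := site2 F (n + 1) (i + 1)
    set f0 := site2 F (n + 1) i
    set x0 := site2 X (n + 1) i
    set x1 := site2 X (n + 1) (i + 1)
    set f1' := site2 F⁻¹ (n + 1) (i + 1)
    set C := unfold (copy F (blockMatrix (X * F)) n i)
    set Φ := rowRev (site2 F (n + 1)) 0 i
    calc f0 * Φ * (f1 * C * f1') = f0 * (Φ * f1) * C * f1' := by simp only [mul_assoc]
      _ = f0 * f1 * (Φ * C) * f1' := by rw [← c1.eq]; simp only [mul_assoc]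
      _ = (f0 * f1 * x0) * f0 * Φ * f1' := by rw [ih]; simp only [mul_assoc]
      _ = x1 * (f0 * f1 * f0) * Φ * f1' := by rw [← b1]; simp only [mul_assoc]
      _ = x1 * f1 * f0 * (f1 * Φ) * f1' := by rw [← b2]; simp only [mul_assoc]
      _ = x1 * f1 * f0 * Φ * (f1 * f1') := by rw [c1.eq]; simp only [mul_assoc]
      _ = _ := by rw [b3, mul_one]; simp only [mul_assoc]

/-- In the representation each new copy contributes `X_i F_i` once the accumulated `F`'s have been
moved past it. The resulting braid of the strand `V₀` around the others is the operator occurring in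
`copy_zero_word`. -/
theorem unfold_string_blockMatrix (hF : IsUnit F)
    (hb : site2 F 3 0 * site2 F 3 1 * site2 F 3 0 = site2 F 3 1 * site2 F 3 0 * site2 F 3 1)
    (hX : site2 X 3 1 * site2 F 3 0 * site2 F 3 1 = site2 F 3 0 * site2 F 3 1 * site2 X 3 0)
    {i : ℕ} (hi : i ≤ n) :
    unfold (row (copy F (blockMatrix (X * F)) n) 0 i) =
      row (site2 X (n + 1)) 0 i * rowRev (site2 F (n + 1)) 0 i := by
  induction i with
  | zero => simp only [row, rowRev, mul_one]; exact map_one (unfoldHom N n)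
  | succ i ih =>
    rw [row, zero_add, unfold_mul, ih (by omega), mul_assoc, rowRev_mul_unfold_copy hF hb hX hi,
      row, rowRev, zero_add]
    simp only [mul_assoc]

end Permutation

/-! ### The permutation relation and invertibility in the representations. -/

section Permutation

variable {N : ℕ} {A : Type} [Ring A] [Algebra ℂ A] {R F X : Op2 N} {n k : ℕ}
variable {M : Matrix (Fin N) (Fin N) A} {w : (n p : ℕ) → Op N n ℂ}

/-- The operator `X` is `R` or its inverse, for a compatible pair `R`, `F`. -/
structure IsCompanion (R F X : Op2 N) : Prop where
  compatible : IsCompatiblePair R F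
  isUnit : IsUnit X
  eq_or : X = R ∨ X = R⁻¹
  braid : site2 R 3 1 * site2 X 3 0 * site2 X 3 1 = site2 X 3 0 * site2 X 3 1 * site2 R 3 0
  twist : site2 X 3 1 * site2 F 3 0 * site2 F 3 1 = site2 F 3 0 * site2 F 3 1 * site2 X 3 0

theorem IsCompatiblePair.isCompanion_self (h : IsCompatiblePair R F) : IsCompanion R F R :=
  ⟨h, h.left.isUnit, Or.inl rfl, h.left.braid.symm, h.twist₂⟩

theorem IsCompatiblePair.isCompanion_inv (h : IsCompatiblePair R F) : IsCompanion R F R⁻¹ := by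
  have a0 : site2 R 3 0 * site2 R⁻¹ 3 0 = 1 :=
    gen_mul_inv (A := ℂ) (n := 3) (i := 0) h.left.isUnit (by omega)
  have a1 : site2 R 3 1 * site2 R⁻¹ 3 1 = 1 :=
    gen_mul_inv (A := ℂ) (n := 3) (i := 1) h.left.isUnit (by omega)
  have b0 : site2 R⁻¹ 3 0 * site2 R 3 0 = 1 :=
    gen_inv_mul (A := ℂ) (n := 3) (i := 0) h.left.isUnit (by omega)
  have b1 : site2 R⁻¹ 3 1 * site2 R 3 1 = 1 :=
    gen_inv_mul (A := ℂ) (n := 3) (i := 1) h.left.isUnit (by omega)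
  refine ⟨h, (Matrix.isUnit_nonsing_inv_iff).mpr h.left.isUnit, Or.inr rfl, ?_, ?_⟩
  · have t := h.left.braid
    generalize site2 R 3 0 = r0 at *
    generalize site2 R 3 1 = r1 at *
    generalize site2 R⁻¹ 3 0 = s0 at *
    generalize site2 R⁻¹ 3 1 = s1 at *
    calc r1 * s0 * s1 = (s0 * (s1 * r1) * r0) * r1 * s0 * s1 := by
          rw [b1, mul_one, b0, one_mul]
      _ = s0 * s1 * (r1 * r0 * r1) * s0 * s1 := by simp only [mul_assoc]
      _ = s0 * s1 * r0 * r1 * (r0 * s0) * s1 := by rw [← t]; simp only [mul_assoc]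
      _ = s0 * s1 * r0 * (r1 * s1) := by rw [a0, mul_one]; simp only [mul_assoc]
      _ = s0 * s1 * r0 := by rw [a1, mul_one]
  · have t := h.twist₂
    generalize site2 R 3 0 = r0 at *
    generalize site2 R 3 1 = r1 at *
    generalize site2 R⁻¹ 3 0 = s0 at *
    generalize site2 R⁻¹ 3 1 = s1 at *
    generalize site2 F 3 0 = f0 at *
    generalize site2 F 3 1 = f1 at *
    calc s1 * f0 * f1 = s1 * (f0 * f1 * r0) * s0 := by
          simp only [mul_assoc, a0, mul_one]
      _ = s1 * r1 * (f0 * f1 * s0) := by rw [← t]; simp only [mul_assoc]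
      _ = f0 * f1 * s0 := by rw [b1, one_mul]

theorem IsCompatiblePair.qmData (h : IsCompatiblePair R F) (hM : qmLeft R F M = qmRight R F M) :
    QMData R F M :=
  ⟨h.right.isUnit, h.right.braid, h.twist₁, h.twist₂, hM⟩

theorem IsCompanion.qmData (hX : IsCompanion R F X) : QMData R F (blockMatrix (X * F)) :=
  hX.compatible.qmData
    (qm_blockMatrix hX.compatible.right hX.compatible.twist₁ hX.twist hX.braid)

theorem QMData.companion_commute_string (h : QMData R F M) (hX : IsCompanion R F X) {j k : ℕ}
    (hj : j + 1 < k) (hk : k ≤ n) : Commute (gen A X n j) (row (copy F M n) 0 k) := by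
  have c := h.gen_commute_string hj hk
  rcases hX.eq_or with rfl | rfl
  · exact c
  · have hR := hX.compatible.left.isUnit
    have h1 := gen_mul_inv (A := A) (n := n) (i := j) hR (by omega)
    have h2 := gen_inv_mul (A := A) (n := n) (i := j) hR (by omega)
    set u : (Op N n A)ˣ := ⟨gen A R n j, gen A R⁻¹ n j, h1, h2⟩
    exact c.units_inv_left (u := u)

theorem num_row_mul_rowRev (m a : ℕ) :
    num A (row (site2 X m) 0 a * rowRev (site2 F m) 0 a) =
      row (gen A X m) 0 a * rowRev (gen A F m) 0 a := by
  rw [← numHom_apply, map_mul]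
  exact congrArg₂ _ (map_row (numHom A N m).toRingHom 0 a) (map_rowRev (numHom A N m).toRingHom 0 a)

theorem IsCompanion.mul_word (hX : IsCompanion R F X) (hw : IsRankOneWord R k w) :
    row (site2 X (k + 1)) 0 k * rowRev (site2 F (k + 1)) 0 k * w (k + 1) 1 =
      site1 (wordCoeff F (blockMatrix (X * F)) k w) (k + 1) 0 * w (k + 1) 1 := by
  have e := congrArg unfold (hX.qmData.string_mul_word hw)
  rw [unfold_mul, unfold_mul, unfold_sc, unfold_string_blockMatrix hX.compatible.right.isUnit
    hX.compatible.right.braid hX.twist le_rfl] at e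
  rw [← hw.prepend (p := 0) (by omega)]
  exact e

theorem IsCompanion.word_commute (hX : IsCompanion R F X) (hw : IsRankOneWord R k w) :
    Commute (row (site2 X (k + 1)) 0 k * rowRev (site2 F (k + 1)) 0 k) (w (k + 1) 1) := by
  have e := congrArg unfold (hX.qmData.string_commute hw.toIsWord le_rfl).eq
  rw [unfold_mul, unfold_mul, unfold_string_blockMatrix hX.compatible.right.isUnit
    hX.compatible.right.braid hX.twist le_rfl] at e
  rw [← hw.prepend (p := 0) (by omega)]
  exact e

theorem IsRankOneWord.ne_zero (hw : IsRankOneWord R k w) : w k 0 ≠ 0 := fun h =>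
  hw.trace_ne (by rw [h, Matrix.trace_zero])

theorem IsWord.commute_site1 (hw : IsWord R k w) (Y : Matrix (Fin N) (Fin N) A) :
    Commute (site1 Y (k + 1) 0) (num A (w (k + 1) 1)) :=
  hw.commute (by omega) fun j hj _ =>
    (num_site2_commute_site1 R Y hj).symm

/-- The permutation relation of the coefficient of a word of rank one with the quantum matrix. -/
theorem QMData.commute_wordCoeff (h : QMData R F M) (hX : IsCompanion R F X)
    (hw : IsRankOneWord R k w) :
    Commute M (Matrix.scalar (Fin N) (wordCoeff F M k w) *
      (wordCoeff F (blockMatrix (X * F)) k w).map (algebraMap ℂ A)) := by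
  have e := h.copy_zero_word hw hX.braid fun j hj =>
    h.companion_commute_string hX (by omega) le_rfl
  -- The braid is the image of the string under the representation, so on `w` it acts as the image
  -- of the coefficient, a numeric matrix in the first factor alone.
  have e2 : num A (w (k + 1) 1) * (row (gen A X (k + 1)) 0 k * rowRev (gen A F (k + 1)) 0 k) =
      site1 ((wordCoeff F (blockMatrix (X * F)) k w).map (algebraMap ℂ A)) (k + 1) 0 *
        num A (w (k + 1) 1) := by
    rw [← num_row_mul_rowRev, ← num_site1, ← numHom_apply, ← numHom_apply, ← numHom_apply,
      ← map_mul, ← map_mul, ← (hX.word_commute hw).eq, hX.mul_word hw]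
  have c := hw.commute_site1 M
  rw [mul_assoc, e2, mul_assoc (sc N _ _), e2] at e
  change site1 M (k + 1) 0 * _ * _ = _ * site1 M (k + 1) 0 at e
  rw [← site1_scalar, mul_assoc (site1 (Matrix.scalar _ _) _ _), mul_assoc (site1 _ _ _) _ (site1 M _ _),
    ← c.eq] at e
  simp only [← mul_assoc, ← site1_mul] at e
  rw [← hw.prepend (p := 0) (by omega)] at e
  have := eq_of_site1_mul_num_prepend hw.ne_zero e
  rw [mul_assoc] at this
  exact this

/-- The represented string is a product of invertible `X`'s and `F`'s. If the coefficient kills `V`,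
the string kills `V ⊗ w`, so `V = 0`. -/
theorem IsCompanion.isUnit_wordCoeff (hX : IsCompanion R F X) (hw : IsRankOneWord R k w) :
    IsUnit (wordCoeff F (blockMatrix (X * F)) k w) := by
  set O := wordCoeff F (blockMatrix (X * F)) k w with hO
  have reg : ∀ V : Matrix (Fin N) (Fin N) ℂ, O * V = 0 → V = 0 := by
    intro V hV
    have c := hw.commute_site1 V
    have hu := rowRev_mul_row_inv (x := site2 X (k + 1)) (y := site2 X⁻¹ (k + 1)) (p := 0) (n := k)
      fun j _ hj => gen_inv_mul (A := ℂ) hX.isUnit (by omega)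
    have hF := row_mul_rowRev_inv (x := site2 F⁻¹ (k + 1)) (y := site2 F (k + 1)) (p := 0) (n := k)
      fun j _ hj => gen_inv_mul (A := ℂ) hX.compatible.right.isUnit (by omega)
    have e : row (site2 X (k + 1)) 0 k * rowRev (site2 F (k + 1)) 0 k *
        (site1 V (k + 1) 0 * w (k + 1) 1) = 0 := by
      have c' : site1 V (k + 1) 0 * w (k + 1) 1 = w (k + 1) 1 * site1 V (k + 1) 0 := c.eq
      rw [c', ← mul_assoc, hX.mul_word hw, mul_assoc, ← c', ← mul_assoc, ← site1_mul, hV,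
        site1_zero, zero_mul]
    have e1 : site1 V (k + 1) 0 * w (k + 1) 1 = 0 := by
      have := congrArg (fun z => row (site2 F⁻¹ (k + 1)) 0 k *
        (rowRev (site2 X⁻¹ (k + 1)) 0 k * z)) e
      simp only [mul_zero] at this
      rw [mul_assoc, ← mul_assoc (rowRev _ _ _) (row _ _ _), hu, one_mul, ← mul_assoc, hF,
        one_mul] at this
      exact this
    refine eq_of_site1_mul_num_prepend hw.ne_zero (n := k) ?_
    rw [hw.prepend (p := 0) (by omega), site1_zero, zero_mul]
    exact e1
  rw [Matrix.isUnit_iff_isUnit_det, isUnit_iff_ne_zero]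
  intro h0
  obtain ⟨v, hv, hOv⟩ := Matrix.exists_mulVec_eq_zero_iff.mpr h0
  apply hv
  -- A kernel vector is made into a square matrix by repeating it in every column.
  have := reg (Matrix.of fun a _ => v a) (by
    ext a b
    exact congrFun hOv a)
  funext a
  exact congrFun (congrFun this a) a

end Permutation

/-! ### Identities between `kapCoeff`, `antiCoeff` and the elementary sums. -/

section Identity

variable {N : ℕ} {A : Type} [Ring A] [Algebra ℂ A] {q μ : ℂ} {R F : Op2 N} {n : ℕ}
variable {M : Matrix (Fin N) (Fin N) A} {D : Matrix (Fin N) (Fin N) ℂ}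

variable (q μ R F M) in
/-- The coefficient of `κ` in `M₁ M₂ κ`. -/
noncomputable def kapCoeff : A := wordCoeff F M 2 fun n p => kappa q μ (site2 R n p)

variable (q μ R F M) in
/-- The coefficient of the antisymmetrizer `a` of rank one in `M₁ ⋯ M_k a`. -/
noncomputable def antiCoeff (k : ℕ) : A := wordCoeff F M k fun n p => antisymOp q μ R n p k

variable (D q μ R F M) in
/-- The elementary sum with respect to the matrix `D`. -/
noncomputable def elemSum (l : ℕ) : A :=
  wtr D (row (copy F M l) 0 l * num A (antisymOp q μ R l 0 l))

theorem num_kappa (n p : ℕ) : num A (kappa q μ (site2 R n p)) = kapOp A q μ R n p :=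
  map_kappa (numHom A N n) _

theorem num_kapOp (n p : ℕ) : num A (kapOp ℂ q μ R n p) = kapOp A q μ R n p :=
  num_kappa n p

theorem num_cupWord (n l p : ℕ) :
    num A (cupWord (kapOp ℂ q μ R n) l p) = cupWord (kapOp A q μ R n) l p :=
  (map_cupWord (numHom A N n).toRingHom l p).trans (cupWord_congr fun j _ _ => num_kapOp n j)

theorem num_row_kapOp (n p l : ℕ) :
    num A (row (kapOp ℂ q μ R n) p l) = row (kapOp A q μ R n) p l :=
  (map_row (numHom A N n).toRingHom p l).trans (row_congr fun j _ _ => num_kapOp n j)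

theorem ext_pairWord_kapOp {n p l : ℕ} (h : p + 2 * l ≤ n) :
    ext (pairWord (kapOp A q μ R n) l p) = pairWord (kapOp A q μ R (n + 1)) l p :=
  (map_pairWord (ext (N := N) (A := A) (n := n)).toRingHom l p).trans
    (pairWord_congr fun j h1 h2 => ext_kapOp (by omega))

theorem sc_commute_kapOp (a : A) (n p : ℕ) : Commute (sc N n a) (kapOp A q μ R n p) := by
  rw [← num_kappa]
  exact sc_commute_num _ _

theorem kapOp_commute {y : Op N n A} {i : ℕ} (h : Commute y (gen A R n i)) :
    Commute y (kapOp A q μ R n i) :=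
  kappa_commute h

theorem wtr_zero_one : wtr D (1 : Op N 0 A) = 1 := by
  rw [wtr_eq]
  simp [tensorPow, Matrix.one_apply, Subsingleton.elim _ (default : Fin 0 → Fin N)]

theorem BMWData.tensorPow_commute_kapOp (d : BMWData q μ R D) {n i : ℕ} (hi : i + 1 < n) :
    Commute (tensorPow D n) (kapOp ℂ q μ R n i) := by
  rw [kapOp_eq hi]
  exact d.tensorPow_commute hi

namespace QMData

variable (h : QMData R F M) (d : BMWData q μ R D)
include h

theorem kapOp_commute_row_copy {i p l : ℕ} (hi : i + 1 < p) (hp : p + l ≤ n) :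
    Commute (kapOp A q μ R n i) (row (copy F M n) p l) :=
  (kapOp_commute (row_commute fun _ _ _ =>
    h.gen_commute_copy_right h.twist₁ (by omega) (by omega)).symm).symm

include d

theorem row_copy_mul_kapOp {p : ℕ} (hp : p + 2 ≤ n) :
    row (copy F M n) p 2 * kapOp A q μ R n p =
      sc N n (kapCoeff q μ R F M) * kapOp A q μ R n p := by
  have := h.row_copy_mul_word d.isRankOneWord hp
  rwa [num_kappa] at this

theorem row_copy_mul_pairWord {p l : ℕ} (hp : p + 2 * l ≤ n) :
    row (copy F M n) p (2 * l) * pairWord (kapOp A q μ R n) l p =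
      sc N n (kapCoeff q μ R F M ^ l) * pairWord (kapOp A q μ R n) l p := by
  induction l generalizing p with
  | zero => simp [row, pairWord]
  | succ l ih =>
    have c := h.kapOp_commute_row_copy (q := q) (μ := μ) (i := p) (p := p + 2) (l := 2 * l) (n := n)
      (by omega) (by omega)
    rw [show 2 * (l + 1) = 2 + 2 * l by omega, row_add, pairWord, mul_assoc, ← mul_assoc (row _ (p + 2) _),
      ← c.eq, mul_assoc (kapOp A q μ R n p), ih (by omega), ← mul_assoc, ← mul_assoc,
      ← mul_assoc, h.row_copy_mul_kapOp d (by omega), mul_assoc (sc N n (kapCoeff q μ R F M)),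
      ← (sc_commute_kapOp (kapCoeff q μ R F M ^ l) n p).eq, pow_succ', map_mul]
    simp only [mul_assoc]

/-- `capWord` absorbs `pairWord` at the cost of `η^l`. Once `pairWord` is inserted, each adjacent
pair of copies meets its own `κ` and contributes one factor `kapCoeff`. -/
theorem row_copy_mul_capWord {l r : ℕ} (hn : n = 2 * l + r) :
    row (copy F M n) 0 n * capWord (kapOp A q μ R n) l 0 =
      sc N n (kapCoeff q μ R F M ^ l) * capWord (kapOp A q μ R n) l 0 *
        row (copy F M n) (2 * l) r := by
  have e : pairWord (kapOp A q μ R n) l 0 * capWord (kapOp A q μ R n) l 0 =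
      eta q μ ^ l • capWord (kapOp A q μ R n) l 0 := by
    obtain _ | l := l
    · simp [pairWord, capWord]
    · exact (d.rep (A := A) n).pairWord_mul_capWord (p := 0) (by omega)
  have c1 : Commute (row (copy F M n) (2 * l) r) (capWord (kapOp A q μ R n) l 0) :=
    capWord_commute fun j _ hj => (h.kapOp_commute_row_copy (by omega) (by omega)).symm
  have c2 : Commute (row (copy F M n) (2 * l) r) (pairWord (kapOp A q μ R n) l 0) :=
    pairWord_commute fun j _ hj => (h.kapOp_commute_row_copy (by omega) (by omega)).symm
  have e2 : row (copy F M n) 0 n = row (copy F M n) 0 (2 * l) * row (copy F M n) (2 * l) r := by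
    have := row_add (x := copy F M n) 0 (2 * l) r
    rwa [zero_add, ← hn] at this
  have e1 := h.row_copy_mul_pairWord d (n := n) (p := 0) (l := l) (by omega)
  refine smul_right_injective _ (pow_ne_zero l d.eta_ne) ?_
  simp only
  calc eta q μ ^ l • (row (copy F M n) 0 n * capWord (kapOp A q μ R n) l 0)
      = row (copy F M n) 0 n * (pairWord (kapOp A q μ R n) l 0 *
          capWord (kapOp A q μ R n) l 0) := by rw [e, mul_smul_comm]
    _ = row (copy F M n) 0 (2 * l) * (row (copy F M n) (2 * l) r *
          pairWord (kapOp A q μ R n) l 0) * capWord (kapOp A q μ R n) l 0 := by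
        rw [e2]; simp only [mul_assoc]
    _ = (row (copy F M n) 0 (2 * l) * pairWord (kapOp A q μ R n) l 0) *
          (row (copy F M n) (2 * l) r * capWord (kapOp A q μ R n) l 0) := by
        rw [c2.eq]; simp only [mul_assoc]
    _ = sc N n (kapCoeff q μ R F M ^ l) * (pairWord (kapOp A q μ R n) l 0 *
          capWord (kapOp A q μ R n) l 0) * row (copy F M n) (2 * l) r := by
        rw [e1, c1.eq]; simp only [mul_assoc]
    _ = _ := by rw [e, mul_smul_comm, smul_mul_assoc]

theorem capWord_commute_row_copy {l : ℕ} (hn : 2 * l ≤ n) :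
    Commute (row (copy F M n) 0 n) (capWord (kapOp A q μ R n) l 0) :=
  capWord_commute fun j _ hj => kapOp_commute (h.gen_commute_string (by omega) le_rfl).symm

theorem wtr_pairWord {l : ℕ} :
    wtr D (pairWord (kapOp A q μ R (l + l)) l 0) = (μ ^ 2 * eta q μ) ^ l • (1 : A) := by
  rw [(d.Ptr_pairWord (A := A) l (p := 0) (n := l + l) (by omega)).wtr_eq, wtr_smul, wtr_zero_one]

/-- First evaluation: the caps commute with the string and turn its first `2l` copies into scalars,
while the antisymmetrizer between caps and cups reduces to `a^(l)` on the last `l` strands, giving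
the elementary sum. -/
theorem wtr_cap_cup {l : ℕ} (g : IsGeneric (l + l) q μ) (hl : 1 ≤ l) :
    wtr D (capWord (kapOp A q μ R (l + l + l)) l 0 * row (copy F M (l + l + l)) 0 (l + l + l) *
        antiOp A q μ R (l + l + l) l (l + l) * cupWord (kapOp A q μ R (l + l + l)) l 0) =
      ((∏ j ∈ Finset.range l, sandwichCoeff q μ (l + j)) * (μ ^ 2 * eta q μ) ^ l) •
        (kapCoeff q μ R F M ^ l * elemSum q μ R F M D l) := by
  have e1 := h.row_copy_mul_capWord d (n := l + l + l) (l := l) (r := l) (by omega)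
  have e2 : capWord (kapOp A q μ R (l + l + l)) l 0 * antiOp A q μ R (l + l + l) l (l + l) *
      cupWord (kapOp A q μ R (l + l + l)) l 0 =
      (∏ j ∈ Finset.range l, sandwichCoeff q μ (l + j)) •
        (pairWord (kapOp A q μ R (l + l + l)) l 0 * antiOp A q μ R (l + l + l) (2 * l) l) := by
    have := (d.rep (A := A) (l + l + l)).capWord_antisym_cupWord g (p := 0) (n := l) (i := l)
      (by omega) hl le_rfl
    simp only [zero_add] at this
    exact this
  have c1 : Commute (row (copy F M (l + l + l)) (2 * l) l)
      (capWord (kapOp A q μ R (l + l + l)) l 0) :=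
    capWord_commute fun j _ hj => (h.kapOp_commute_row_copy (by omega) (by omega)).symm
  have c2 : Commute (row (copy F M (l + l + l)) (2 * l) l)
      (pairWord (kapOp A q μ R (l + l + l)) l 0) :=
    pairWord_commute fun j _ hj => (h.kapOp_commute_row_copy (by omega) (by omega)).symm
  have t := (h.Ptr_row_copy_word d (isWord_antisym (q := q) (μ := μ) (R := R) l) (l + l)
    (n := l + l + l) rfl).mul_left (fun j => pairWord (kapOp A q μ R j) l 0)
      fun j h1 h2 => ext_pairWord_kapOp (by omega)
  have t2 := t.wtr_eq
  rw [wtr_mul_sc, wtr_pairWord h d, ← antiOp_eq_num, ← two_mul, smul_mul_assoc, one_mul] at t2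
  rw [← (h.capWord_commute_row_copy d (by omega)).eq, e1, mul_assoc (sc N _ _), ← c1.eq]
  rw [mul_assoc, mul_assoc, mul_assoc, ← mul_assoc (capWord _ _ _), e2, mul_smul_comm, mul_smul_comm,
    wtr_smul, wtr_sc_mul, ← mul_assoc, c2.eq, mul_assoc]
  rw [two_mul] at t2 ⊢
  rw [t2, mul_smul_comm, smul_smul]
  rfl

/-- Second evaluation: the cups are moved cyclically to the left. The copies on the last `2l`
strands meet `a^(2l)` and become `antiCoeff`; tracing `l` strands leaves `a^(l)`, which slides over
the caps to the first `l` strands; tracing cups against caps leaves the elementary sum there. -/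
theorem wtr_cap_cup_cyclic {l : ℕ} (g : IsGeneric (l + l) q μ) (hl : 1 ≤ l)
    (hw : IsRankOneWord R (l + l) fun n p => antisymOp q μ R n p (l + l)) :
    wtr D (capWord (kapOp A q μ R (l + l + l)) l 0 * row (copy F M (l + l + l)) 0 (l + l + l) *
        antiOp A q μ R (l + l + l) l (l + l) * cupWord (kapOp A q μ R (l + l + l)) l 0) =
      ((∏ j ∈ Finset.range l, sandwichCoeff q μ (l + j)) * (μ ^ 2 * eta q μ) ^ l) •
        (elemSum q μ R F M D l * antiCoeff q μ R F M (l + l)) := by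
  have c0 : Commute (tensorPow D (l + l + l)) (cupWord (kapOp ℂ q μ R (l + l + l)) l 0) :=
    cupWord_commute fun j _ hj => d.tensorPow_commute_kapOp (by omega)
  have e1 : row (copy F M (l + l + l)) 0 (l + l + l) * antiOp A q μ R (l + l + l) l (l + l) =
      row (copy F M (l + l + l)) 0 l * sc N (l + l + l) (antiCoeff q μ R F M (l + l)) *
        antiOp A q μ R (l + l + l) l (l + l) := by
    have := h.row_copy_mul_word hw (n := l + l + l) (p := l) (by omega)
    rw [add_assoc l l l, row_add, zero_add, ← add_assoc l l l, antiOp_eq_num, mul_assoc, this,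
      mul_assoc]
    rfl
  rw [← num_cupWord, ← wtr_num_mul (A := A) D c0, num_cupWord, mul_assoc (capWord _ _ _), e1, ← mul_assoc]
  have t := (d.Ptr_antiOp (A := A) g (p := l) (i := l) hl l le_rfl).mul_left
    (fun j => cupWord (kapOp A q μ R j) l 0 * capWord (kapOp A q μ R j) l 0 *
      (row (copy F M j) 0 l * sc N j (antiCoeff q μ R F M (l + l))))
    (fun j h1 h2 => by
      rw [map_mul, map_mul, map_mul, ext_cupWord_kapOp (by omega), ext_capWord_kapOp (by omega),
        ext_row_copy (by omega), ext_sc])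
  have t1 := t.wtr_eq
  have ca : Commute (row (copy F M (l + l)) 0 l) (antiOp A q μ R (l + l) l l) := by
    rw [antiOp_eq_num]
    exact (isWord_antisym l).commute le_rfl fun j h1 _ =>
      (row_commute fun i _ h3 => gen_commute_copy R (by omega)).symm
  have cd : Commute (sc N (l + l) (antiCoeff q μ R F M (l + l)))
      (antiOp A q μ R (l + l) l l) := by
    rw [antiOp_eq_num]
    exact sc_commute_num _ _
  have cc : capWord (kapOp A q μ R (l + l)) l 0 * antiOp A q μ R (l + l) l l =
      capWord (kapOp A q μ R (l + l)) l 0 * antiOp A q μ R (l + l) 0 l := by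
    have := (d.rep (A := A) (l + l)).capWord_mul_antisym g (p := 0) (n := l) (by omega) (by omega)
    simp only [zero_add] at this
    exact this
  have t3 := ((d.Ptr_cupWord_capWord (A := A) l (p := 0) (p' := l) (n := l + l) (by omega)
    (by omega)).mul_right (fun j => antiOp A q μ R j 0 l * (row (copy F M j) 0 l *
      sc N j (antiCoeff q μ R F M (l + l)))) fun j h1 h2 => by
        rw [map_mul, map_mul, ext_antiOp (by omega), ext_row_copy (by omega), ext_sc]).wtr_eq
  have ce : Commute (row (copy F M l) 0 l) (antiOp A q μ R l 0 l) := by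
    rw [antiOp_eq_num]
    exact h.string_commute (isWord_antisym l) le_rfl
  rw [← mul_assoc (cupWord _ _ _ * _), t1, mul_smul_comm, wtr_smul,
    mul_assoc (cupWord _ _ _ * _), mul_assoc (row _ _ _), cd.eq, ← mul_assoc (row _ _ _), ca.eq,
    mul_assoc (antiOp _ _ _ _ _ _ _), ← mul_assoc (cupWord _ _ _ * _), mul_assoc (cupWord _ _ _), cc,
    ← mul_assoc (cupWord _ _ _), mul_assoc (cupWord _ _ _ * _), t3, smul_mul_assoc, one_mul,
    ← mul_assoc, ← ce.eq, wtr_smul, wtr_mul_sc, smul_smul, antiOp_eq_num,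
    Finset.prod_mul_distrib, Finset.prod_const, Finset.card_range]
  change _ • (elemSum q μ R F M D l * _) = _
  congr 1
  ring

theorem kapCoeff_pow_mul_elemSum {l : ℕ} (g : IsGeneric (l + l) q μ) (hl : 1 ≤ l)
    (hs : ∀ j < l, sandwichCoeff q μ (l + j) ≠ 0)
    (hw : IsRankOneWord R (l + l) fun n p => antisymOp q μ R n p (l + l)) :
    kapCoeff q μ R F M ^ l * elemSum q μ R F M D l =
      elemSum q μ R F M D l * antiCoeff q μ R F M (l + l) := by
  refine smul_right_injective A (r := (∏ j ∈ Finset.range l, sandwichCoeff q μ (l + j)) *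
    (μ ^ 2 * eta q μ) ^ l) (mul_ne_zero (Finset.prod_ne_zero_iff.mpr fun j hj =>
      hs j (Finset.mem_range.mp hj)) (pow_ne_zero l (mul_ne_zero (pow_ne_zero 2 d.μ_ne)
        d.eta_ne))) ?_
  exact (h.wtr_cap_cup d g hl).symm.trans (h.wtr_cap_cup_cyclic d g hl hw)

/-- A trace over `l + 2` strands with `κ` at the left end and `a^(l)` to its right. Since `η κ` is a
row times its reverse, moving the row cyclically brings `κ` to the right end and `a^(l)` to the
left, which exchanges the two factors. -/
theorem elemSum_commute_kapCoeff (l : ℕ) :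
    Commute (elemSum q μ R F M D l) (kapCoeff q μ R F M) := by
  have r := d.rep (A := A) (l + 2)
  have ck : Commute (kapOp A q μ R (l + 2) 0) (row (copy F M (l + 2)) 0 (l + 2)) :=
    (kapOp_commute (h.gen_commute_string (by omega) le_rfl).symm).symm
  have ck' : Commute (kapOp A q μ R (l + 2) l) (row (copy F M (l + 2)) 0 (l + 2)) :=
    (kapOp_commute (h.gen_commute_string (by omega) le_rfl).symm).symm
  have s0 : row (copy F M (l + 2)) 0 (l + 2) =
      row (copy F M (l + 2)) 0 2 * row (copy F M (l + 2)) 2 l := by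
    rw [← zero_add 2, ← row_add, add_comm 2 l]
  have s1 : row (copy F M (l + 2)) 0 (l + 2) =
      row (copy F M (l + 2)) 0 l * row (copy F M (l + 2)) l 2 := by
    rw [row_add, zero_add]
  have e1 : wtr D (kapOp A q μ R (l + 2) 0 * row (copy F M (l + 2)) 0 (l + 2) *
      antiOp A q μ R (l + 2) 2 l) =
      (μ ^ 2 * eta q μ) • (kapCoeff q μ R F M * elemSum q μ R F M D l) := by
    have c := h.kapOp_commute_row_copy (q := q) (μ := μ) (i := 0) (p := 2) (l := l) (n := l + 2)
      (by omega) (by omega)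
    have t := ((h.Ptr_row_copy_word d (isWord_antisym (q := q) (μ := μ) (R := R) l) 2
      (n := l + 2) (by omega)).mul_left (fun j => kapOp A q μ R j 0)
        fun j h1 h2 => ext_kapOp (by omega)).wtr_eq
    have t2 := (d.Ptr_kapOp (A := A) 0).wtr_eq
    rw [wtr_smul, wtr_zero_one] at t2
    rw [ck.eq, s0, mul_assoc (row _ 0 2), ← c.eq, ← mul_assoc (row _ 0 2),
      h.row_copy_mul_kapOp d (by omega), mul_assoc, mul_assoc, wtr_sc_mul, antiOp_eq_num, t,
      wtr_mul_sc, t2, smul_mul_assoc, one_mul, mul_smul_comm]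
    rfl
  have e2 : eta q μ • wtr D (kapOp A q μ R (l + 2) 0 * row (copy F M (l + 2)) 0 (l + 2) *
      antiOp A q μ R (l + 2) 2 l) =
      eta q μ • ((μ ^ 2 * eta q μ) • (elemSum q μ R F M D l * kapCoeff q μ R F M)) := by
    have u1 : row (kapOp A q μ R (l + 2)) 0 (l + 1) * rowRev (kapOp A q μ R (l + 2)) 0 (l + 1) =
        eta q μ • kapOp A q μ R (l + 2) 0 := r.row_mul_rowRev (by omega)
    have u2 : rowRev (kapOp A q μ R (l + 2)) 0 (l + 1) * row (kapOp A q μ R (l + 2)) 0 (l + 1) =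
        eta q μ • kapOp A q μ R (l + 2) l := by
      have := r.rowRev_mul_row (p := 0) (n := l) (by omega)
      simp only [zero_add] at this
      exact this
    have u3 : antiOp A q μ R (l + 2) 2 l * row (kapOp A q μ R (l + 2)) 0 (l + 1) =
        row (kapOp A q μ R (l + 2)) 0 (l + 1) * antiOp A q μ R (l + 2) 0 l :=
      r.antisym_mul_row (p := 0) (n := l) (by omega)
    have c0 : Commute (tensorPow D (l + 2)) (row (kapOp ℂ q μ R (l + 2)) 0 (l + 1)) :=
      row_commute fun j _ hj => d.tensorPow_commute_kapOp (by omega)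
    have c1 : Commute (row (copy F M (l + 2)) 0 (l + 2))
        (row (kapOp A q μ R (l + 2)) 0 (l + 1)) :=
      row_commute fun j _ hj => kapOp_commute (h.gen_commute_string (by omega) le_rfl).symm
    have t := (((d.Ptr_kapOp (A := A) l).mul_left (fun j => row (copy F M j) 0 l *
      sc N j (kapCoeff q μ R F M)) (fun j h1 h2 => by
        rw [map_mul, ext_row_copy (by omega), ext_sc])).mul_right
      (fun j => antiOp A q μ R j 0 l) fun j h1 h2 => ext_antiOp (by omega)).wtr_eq
    have cd : Commute (sc N l (kapCoeff q μ R F M)) (antiOp A q μ R l 0 l) := by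
      rw [antiOp_eq_num]
      exact sc_commute_num _ _
    rw [← wtr_smul, ← smul_mul_assoc, ← smul_mul_assoc, ← u1, ← num_row_kapOp, mul_assoc, mul_assoc,
      wtr_num_mul (A := A) D c0, num_row_kapOp, mul_assoc, mul_assoc, u3, ← mul_assoc (row (copy _ _ _) _ _),
      c1.eq, ← mul_assoc, ← mul_assoc, u2, smul_mul_assoc, smul_mul_assoc, wtr_smul, ck'.eq, s1,
      mul_assoc (row _ 0 l), h.row_copy_mul_kapOp d le_rfl, ← mul_assoc, t, mul_smul_comm, mul_one,
      smul_mul_assoc, wtr_smul, mul_assoc, cd.eq, ← mul_assoc, wtr_mul_sc, antiOp_eq_num]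
    rfl
  rw [e1] at e2
  have hc := mul_ne_zero (pow_ne_zero 2 d.μ_ne) d.eta_ne
  exact (smul_right_injective A hc (smul_right_injective A d.eta_ne e2)).symm

end QMData

end Identity

/-! ### Behaviour under algebra homomorphisms; contraction and elementary sums as coefficients. -/

section Functoriality

variable {N : ℕ} {A B : Type} [Ring A] [Algebra ℂ A] [Ring B] [Algebra ℂ B] {q μ : ℂ}
variable {R F : Op2 N} {M : Matrix (Fin N) (Fin N) A} (f : A →ₐ[ℂ] B)

theorem map_trace_matrix {m : Type} [Fintype m] (X : Matrix m m A) :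
    f X.trace = (X.map f).trace := by
  simp [Matrix.trace]

theorem map_row_copy (n p k : ℕ) :
    (row (copy F M n) p k).map f = row (copy F (M.map f) n) p k :=
  (map_row (f.mapMatrix (m := Fin n → Fin N)).toRingHom p k).trans
    (row_congr fun j _ _ => copy_map f F M n j)

theorem map_elementary (i : ℕ) :
    f (elementary R F q μ i M) = elementary R F q μ i (M.map f) := by
  simp only [elementary, ch, map_trace_matrix, Matrix.map_mul, num_map, string_eq, map_row_copy]

theorem map_contraction :
    f (contraction R F q μ M) = contraction R F q μ (M.map f) := by
  simp only [contraction, map_smul, map_trace_matrix, Matrix.map_mul, num_map, string_eq,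
    map_row_copy]

theorem elementary_eq (i : ℕ) : elementary R F q μ i M = elemSum q μ R F M (matD R) i := by
  rw [elementary, ch, string_eq]
  rfl

theorem map_qmLeft : (qmLeft R F M).map f = qmLeft R F (M.map f) := by
  simp only [qmLeft, Matrix.map_mul, num_map, copy_map]

theorem map_qmRight : (qmRight R F M).map f = qmRight R F (M.map f) := by
  simp only [qmRight, Matrix.map_mul, num_map, copy_map]

theorem liftQM_quantumMatrix (h : qmLeft R F M = qmRight R F M) :
    (quantumMatrix R F).map (liftQM M h) = M := by
  ext a b
  simp [quantumMatrix, liftQM, freeMatrix]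

/-- The contraction is natural in the coefficient algebra; naturality is applied to the inclusion of
`S`. -/
theorem contraction_mem (S : Subalgebra ℂ A) (hM : ∀ a b, M a b ∈ S) :
    contraction R F q μ M ∈ S := by
  have e : M = (Matrix.of fun a b => (⟨M a b, hM a b⟩ : S)).map S.val := by
    ext a b
    rfl
  rw [e, ← map_contraction]
  exact Subtype.property _

theorem BMWData.contraction_eq {D : Matrix (Fin N) (Fin N) ℂ} (d : BMWData q μ R D) :
    contraction R F q μ M = μ ^ 2 • kapCoeff q μ R F M := by
  rw [contraction, kapCoeff, wordCoeff, d.trace_kappa_site2, string_eq, ← numHom_apply, map_smul,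
    mul_smul_comm, Matrix.trace_smul]
  rfl

theorem contraction_eq_zero (hK : kappa q μ R = 0) : contraction R F q μ M = 0 := by
  have e : site2 (0 : Op2 N) 2 0 = 0 := by
    ext s t
    simp [site2]
  rw [contraction, kappa_site2 q μ R (show 0 + 1 < 2 by omega), hK, e, smul_zero, ← numHom_apply,
    map_zero, mul_zero, Matrix.trace_zero, smul_zero]

theorem QMData.elemSum_eq (h : QMData R F M) {k : ℕ} (D : Matrix (Fin N) (Fin N) ℂ)
    (hw : IsRankOneWord R k fun n p => antisymOp q μ R n p k) :
    ∃ c : ℂ, elemSum q μ R F M D k = c • antiCoeff q μ R F M k := by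
  refine ⟨(tensorPow D k * antisymOp q μ R k 0 k).trace, ?_⟩
  rw [elemSum, h.string_mul_word hw, wtr_sc_mul, wtr, ← numHom_apply, ← numHom_apply, ← map_mul,
    Algebra.smul_def, Algebra.commutes]
  exact congrArg _ (map_trace_matrix (Algebra.ofId ℂ A) _).symm

end Functoriality

/-! ### The extended algebra and its centre. -/

section Extended

variable {N : ℕ} {q μ : ℂ} {R F : Op2 N}

theorem extMatrix_rel : qmLeft R F (extMatrix R F q μ) = qmRight R F (extMatrix R F q μ) := by
  rw [extMatrix, ← map_qmLeft, ← map_qmRight]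
  ext s t
  exact RingQuot.mkAlgHom_rel ℂ (ExtRel.qm s t)

theorem contractionInv_mul :
    contractionInv R F q μ * contraction R F q μ (extMatrix R F q μ) = 1 := by
  rw [extMatrix, ← map_contraction, contractionInv, ← map_mul,
    RingQuot.mkAlgHom_rel ℂ ExtRel.inv_mul, map_one]

theorem mul_contractionInv :
    contraction R F q μ (extMatrix R F q μ) * contractionInv R F q μ = 1 := by
  rw [extMatrix, ← map_contraction, contractionInv, ← map_mul,
    RingQuot.mkAlgHom_rel ℂ ExtRel.mul_inv, map_one]

/-- The contraction lies in the subalgebra generated by the entries of the matrix, so it commutes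
with `x`, and then so does its inverse, the one remaining generator. -/
theorem mem_center_extAlgebra {x : ExtAlgebra R F q μ}
    (hx : ∀ a b, Commute (extMatrix R F q μ a b) x) :
    x ∈ Subalgebra.center ℂ (ExtAlgebra R F q μ) := by
  have hg : Commute (contraction R F q μ (extMatrix R F q μ)) x := by
    have := contraction_mem (R := R) (F := F) (q := q) (μ := μ) (Subalgebra.centralizer ℂ {x})
      (M := extMatrix R F q μ) fun a b => by
        rw [Subalgebra.mem_centralizer_iff]
        rintro _ rfl
        exact (hx a b).symm.eq
    exact (Subalgebra.mem_centralizer_iff ℂ |>.mp this x rfl).symm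
  have hg' : Commute (contractionInv R F q μ) x := by
    set u : (ExtAlgebra R F q μ)ˣ := ⟨_, _, mul_contractionInv, contractionInv_mul⟩
    exact Commute.units_inv_left (u := u) hg
  rw [Subalgebra.mem_center_iff]
  intro b
  obtain ⟨b, rfl⟩ := RingQuot.mkAlgHom_surjective ℂ (ExtRel R F q μ) b
  change Commute _ _
  induction b using FreeAlgebra.induction with
  | grade0 r =>
    rw [AlgHom.commutes]
    exact Algebra.commutes r x
  | grade1 i =>
    obtain _ | ⟨a, b⟩ := i
    · exact hg'
    · exact hx a b
  | mul a b ha hb =>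
    rw [map_mul]
    exact ha.mul_left hb
  | add a b ha hb =>
    rw [map_add]
    exact ha.add_left hb

end Extended

/-! ### Centrality. -/

section Centrality

variable {N : ℕ} {A : Type} [Ring A] [Algebra ℂ A]

theorem scalar_commute_map (a : A) (G : Matrix (Fin N) (Fin N) ℂ) :
    Commute (Matrix.scalar (Fin N) a) (G.map (algebraMap ℂ A)) := by
  ext i j
  simpa using (Algebra.commutes (G i j) a).symm

/-- With `T = γG` one has `ΔG^l = (Δγ^{-l}) T^l`; since `M` commutes with both sides and with the
invertible `T^l`, it commutes with the scalar. -/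
theorem commute_scalar_of_commute {M : Matrix (Fin N) (Fin N) A} {G : Matrix (Fin N) (Fin N) ℂ}
    {γ γ' Δ : A} {l : ℕ} (h1 : γ' * γ = 1) (h2 : γ * γ' = 1) (hG : IsUnit G)
    (c1 : Commute M (Matrix.scalar (Fin N) γ * G.map (algebraMap ℂ A)))
    (c2 : Commute M (Matrix.scalar (Fin N) Δ * (G ^ l).map (algebraMap ℂ A))) (a b : Fin N) :
    Commute (M a b) (Δ * γ' ^ l) := by
  set φ := (Algebra.ofId ℂ A).mapMatrix (m := Fin N)
  change Commute M (Matrix.scalar (Fin N) γ * φ G) at c1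
  change Commute M (Matrix.scalar (Fin N) Δ * φ (G ^ l)) at c2
  have cs : ∀ a, Commute (Matrix.scalar (Fin N) a) (φ G) := fun a => scalar_commute_map a G
  have hT := (c1.pow_right l)
  have e : Matrix.scalar (Fin N) Δ * φ (G ^ l) =
      Matrix.scalar (Fin N) (Δ * γ' ^ l) * (Matrix.scalar (Fin N) γ * φ G) ^ l := by
    have h3 : γ' ^ l * γ ^ l = 1 := by
      rw [← (show Commute γ' γ from h1.trans h2.symm).mul_pow, h1, one_pow]
    rw [(cs γ).mul_pow, ← map_pow, ← map_pow, ← mul_assoc, ← map_mul, mul_assoc Δ, h3, mul_one]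
  have uT : IsUnit ((Matrix.scalar (Fin N) γ * φ G) ^ l) := by
    refine IsUnit.pow l (IsUnit.mul ?_ (hG.map φ))
    exact (show IsUnit γ from ⟨⟨γ, γ', h2, h1⟩, rfl⟩).map (Matrix.scalar (Fin N))
  have key : Commute M (Matrix.scalar (Fin N) (Δ * γ' ^ l)) := by
    rw [e] at c2
    refine uT.mul_left_injective ?_
    change M * _ * _ = _ * M * _
    rw [mul_assoc, c2.eq, mul_assoc, mul_assoc, hT.eq]
  have := congrFun (congrFun key.eq a) b
  simp only [Matrix.scalar_apply, Matrix.mul_diagonal, Matrix.diagonal_mul] at this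
  exact this

theorem HasHeight.isGeneric {k : ℕ} {q μ : ℂ} {R : Op2 N} (h : HasHeight k q μ R) :
    IsGeneric k q μ where
  q_ne := h.bmw.q_ne.1
  μ_ne := h.bmw.μ_ne.1
  q_pow := h.q_pow_ne
  denom i h1 h2 e := by
    apply h.μ_ne i h1 h2
    rw [zpow_sub₀ h.bmw.q_ne.1, zpow_one, div_eq_mul_inv]
    exact eq_neg_of_add_eq_zero_left e

theorem HasHeight.bmwData {k : ℕ} {q μ : ℂ} {R : Op2 N} (h : HasHeight k q μ R)
    (hK : kappa q μ R ≠ 0) : BMWData q μ R (matD R) where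
  bmw := h.bmw
  kappa_ne := hK
  lam_ne := h.isGeneric.lam_ne (by have := h.two_le; omega)
  contract a b c a' b' c' := by
    rw [h.bmw.contract h.skew.choose_spec]
    simp only [matD, skewInverse, dif_pos h.skew, Matrix.of_apply]

theorem elementary_central {l : ℕ} {q μ : ℂ} {R F X : Op2 N} (hR : IsOrthogonal (2 * l) q μ R)
    (hX : IsCompanion R F X) (hE : (elementary R F q μ l (blockMatrix (X * F))).det ≠ 0) :
    contractionInv R F q μ ^ l * elementary R F q μ (2 * l) (extMatrix R F q μ) ∈
      Subalgebra.center ℂ (ExtAlgebra R F q μ) := by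
  -- If `κ = 0`, the contraction vanishes, and inverting it makes the extended algebra trivial.
  by_cases hK : kappa q μ R = 0
  · have h01 : (0 : ExtAlgebra R F q μ) = 1 := by
      rw [← contractionInv_mul, contraction_eq_zero hK, mul_zero]
    have := subsingleton_of_zero_eq_one h01
    rw [Subsingleton.elim (_ * _ : ExtAlgebra R F q μ) 0]
    exact zero_mem _
  have d := hR.height.bmwData hK
  have g := hR.height.isGeneric
  have hl : 1 ≤ l := by have := hR.height.two_le; omega
  have hs : ∀ j < l, sandwichCoeff q μ (l + j) ≠ 0 := fun j hj =>
    g.sandwichCoeff_ne hR.μ_eq (by omega) (by omega)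
  have hw := isRankOneWord_antisym d g hR.rank_one
  have hκ := d.isRankOneWord
  have hB := hX.qmData
  have hM : QMData R F (extMatrix R F q μ) := hX.compatible.qmData extMatrix_rel
  have hG := hX.isUnit_wordCoeff hκ
  have c1 := hM.commute_wordCoeff hX hκ
  have c2 := hM.commute_wordCoeff hX hw
  obtain ⟨c, hc⟩ := hM.elemSum_eq (matD R) hw
  rw [elementary_eq] at hE
  -- The only use of nondegeneracy: with `γ`, `Δ` taken in the representation, `e_l` is cancelled
  -- from `e_l γ^l = γ^l e_l = e_l Δ`.
  have hO : wordCoeff F (blockMatrix (X * F)) (2 * l) (fun n p => antisymOp q μ R n p (2 * l)) =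
      kapCoeff q μ R F (blockMatrix (X * F)) ^ l := by
    have e2 := (hB.elemSum_commute_kapCoeff d (q := q) (μ := μ) l).pow_right l
    have e1 : kapCoeff q μ R F (blockMatrix (X * F)) ^ l * elemSum q μ R F (blockMatrix (X * F)) (matD R) l =
        elemSum q μ R F (blockMatrix (X * F)) (matD R) l * antiCoeff q μ R F (blockMatrix (X * F)) (2 * l) := by
      rw [two_mul] at g hw ⊢
      exact hB.kapCoeff_pow_mul_elemSum d g hl hs hw
    rw [← e2.eq] at e1
    exact ((Matrix.isUnit_iff_isUnit_det _).mpr (isUnit_iff_ne_zero.mpr hE)).mul_right_injective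
      e1.symm
  rw [hO] at c2
  have hμ2 : μ ^ 2 ≠ 0 := pow_ne_zero 2 d.μ_ne
  have i1 := contractionInv_mul (R := R) (F := F) (q := q) (μ := μ)
  have i2 := mul_contractionInv (R := R) (F := F) (q := q) (μ := μ)
  rw [d.contraction_eq] at i1 i2
  set γ := kapCoeff q μ R F (extMatrix R F q μ)
  -- The inverse of `γ`, since `g = μ² γ`.
  set γ' := μ ^ 2 • contractionInv R F q μ
  have j1 : γ' * γ = 1 := by rw [smul_mul_assoc, ← mul_smul_comm, i1]
  have j2 : γ * γ' = 1 := by rw [mul_smul_comm, ← smul_mul_assoc, i2]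
  set Δ := antiCoeff q μ R F (extMatrix R F q μ) (2 * l)
  have hx : Δ * γ' ^ l ∈ Subalgebra.center ℂ (ExtAlgebra R F q μ) :=
    mem_center_extAlgebra (commute_scalar_of_commute j1 j2 hG c1 c2)
  -- The order of the factors may be exchanged because `Δγ^{-l}` is already known to be central.
  have e : contractionInv R F q μ ^ l * Δ = ((μ ^ 2) ^ l)⁻¹ • (Δ * γ' ^ l) := by
    have k1 : γ' ^ l * γ ^ l = 1 := by
      rw [← (show Commute γ' γ from j1.trans j2.symm).mul_pow, j1, one_pow]
    have k2 : contractionInv R F q μ ^ l = ((μ ^ 2) ^ l)⁻¹ • γ' ^ l := by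
      rw [smul_pow, smul_smul, inv_mul_cancel₀ (pow_ne_zero l hμ2), one_smul]
    have k3 : γ' ^ l * (Δ * γ' ^ l) = Δ * γ' ^ l * γ' ^ l :=
      Subalgebra.mem_center_iff.mp hx _
    rw [k2, smul_mul_assoc]
    congr 1
    calc γ' ^ l * Δ = γ' ^ l * (Δ * γ' ^ l) * γ ^ l := by
          rw [mul_assoc, mul_assoc, k1, mul_one]
      _ = Δ * γ' ^ l := by rw [k3, mul_assoc, k1, mul_one]
  rw [elementary_eq, hc, mul_smul_comm, e, smul_smul]
  exact Subalgebra.smul_mem _ hx _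

end Centrality

end QMA

theorem mainTheorem7 {N : ℕ} (ℓ : ℕ) (q μ : ℂ) (R F : QMA.Op2 N)
    (hR : QMA.IsOrthogonal (2 * ℓ) q μ R)
    (hRs : QMA.StrictSkewInvertible R) (hFs : QMA.StrictSkewInvertible F)
    (hRF : QMA.IsCompatiblePair R F)
    (hnd :
      (QMA.alphaPlus hRF (QMA.elementary R F q μ ℓ (QMA.quantumMatrix R F))).det ≠ 0 ∨
      (QMA.alphaMinus hRF (QMA.elementary R F q μ ℓ (QMA.quantumMatrix R F))).det ≠ 0) :
    QMA.contractionInv R F q μ ^ ℓ *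
        QMA.elementary R F q μ (2 * ℓ) (QMA.extMatrix R F q μ) ∈
      Subalgebra.center ℂ (QMA.ExtAlgebra R F q μ) := by
  rcases hnd with hE | hE
  · rw [QMA.alphaPlus, QMA.map_elementary, QMA.liftQM_quantumMatrix] at hE
    exact QMA.elementary_central hR hRF.isCompanion_self hE
  · rw [QMA.alphaMinus, QMA.map_elementary, QMA.liftQM_quantumMatrix] at hE
    exact QMA.elementary_central hR hRF.isCompanion_inv hE
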